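/- Let $\gamma,\lambda,\mu>0$. Let $Q=H^1(\mathbb R^+)\oplus H^1(\mathbb R^-)$ be the space of functions $\psi:\mathbb R\to\mathbb C$ whose restrictions to the two open half-lines are of class $H^1$. Write $\psi'$ for the derivative of $\psi$ away from the origin, $\psi(0\pm)$ for the one-sided boundary values at $0$, $\|\cdot\|_p$ for the $L^p(\mathbb R)$ norm and $\|\cdot\|=\|\cdot\|_2$. For $\omega\in\mathbb R$ and $\psi\in Q$ put $$S_\omega(\psi)=\tfrac12\|\psi'\|^2+\tfrac{\omega}{2}\|\psi\|^2-\tfrac1{2\gamma}|\psi(0+)-\psi(0-)|^2-\tfrac{\lambda}{2\mu+2}\|\psi\|_{2\mu+2}^{2\mu+2},$$ $$I_\omega(\psi)=\|\psi'\|^2+\omega\|\psi\|^2-\tfrac1{\gamma}|\psi(0+)-\psi(0-)|^2-\lambda\|\psi\|_{2\mu+2}^{2\mu+2},$$ $$d(\omega)=\inf\{S_\omega(\psi):\ \psi\in Q\setminus\{0\},\ I_\omega(\psi)=0\},\qquad \omega_0=\frac4{\gamma^2},\qquad \omega^*=\frac4{\gamma^2}\,\frac{\mu+1}{\mu}.$$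 **Proposition 6.5.** There is a number $\mu^\star\in(2,\,2.5)$, independent of $\gamma,\lambda$, such that for all $\gamma,\lambda,\mu>0$ the following holds. The function $d$ is differentiable on $(\omega_0,+\infty)$ and twice differentiable on $(\omega_0,\omega^*)\cup(\omega^*,+\infty)$. The limits $d''(\omega^*\pm0)=\lim_{\omega\to\omega^*\pm0}d''(\omega)$ exist in $\mathbb R$ and are equal to the right and left derivatives, respectively, of $d'$ at $\omega^*$. Moreover: 1. If $0<\mu\le2$, then $d''(\omega)>0$ for every $\omega\in(\omega_0,\omega^*)\cup(\omega^*,+\infty)$, and $0<d''(\omega^*+0)<d''(\omega^*-0)$. 2. If $\mu>2$, then $d''(\omega)>0$ for every $\omega\in(\omega_0,\omega^*)$, and $d''(\omega^*-0)>0$. 3. (a) If $\mu<\mu^\star$, then $d''(\omega^*+0)>0$, and there is $\omega_1>\omega^*$ such that $d''(\omega)>0$ for every $\omega\in(\omega^*,\omega_1)$. (b) If $\mu=\mu^\star$, then $d''(\omega^*+0)=0$. (c) If $\mu>\mu^\star$, then $d''(\omega^*+0)<0$. 4. If $\mu>2$, then there is $\omega_2\ge\omega^*$ such that $d''(\omega)<0$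 for every $\omega>\omega_2$. -/

import Mathlib

open MeasureTheory Set Filter Topology

namespace DeltaPrimeNLS

/-- `g` is the weak (distributional) derivative of `u` on the open set `U ⊆ ℝ`. It is only used for
`u` and `g` that are square integrable on `U`, so that all the integrals converge. -/
def IsWeakDerivOn (U : Set ℝ) (u g : ℝ → ℂ) : Prop :=
  ∀ φ : ℝ → ℝ, ContDiff ℝ (⊤ : ℕ∞) φ → HasCompactSupport φ → tsupport φ ⊆ U →
    ∫ x in U, deriv φ x • u x = -∫ x in U, φ x • g x

/-- `u` belongs to the Sobolev space `H¹(U)`, with weak derivative `g`. -/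
structure IsH1On (U : Set ℝ) (u g : ℝ → ℂ) : Prop where
  memLp : MemLp u 2 (volume.restrict U)
  memLp_deriv : MemLp g 2 (volume.restrict U)
  isWeakDeriv : IsWeakDerivOn U u g

/-- `a` is the value `u(0+)`: the value at `0` of the representative of `u` on `(0, ∞)` that is
continuous up to the boundary. -/
def IsRightTrace (u : ℝ → ℂ) (a : ℂ) : Prop :=
  ∃ v : ℝ → ℂ, ContinuousOn v (Ici 0) ∧ v =ᵐ[volume.restrict (Ioi 0)] u ∧ v 0 = a

/-- `a` is the value `u(0-)`: the value at `0` of the representative of `u` on `(-∞, 0)` that is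
continuous up to the boundary. -/
def IsLeftTrace (u : ℝ → ℂ) (a : ℂ) : Prop :=
  ∃ v : ℝ → ℂ, ContinuousOn v (Iic 0) ∧ v =ᵐ[volume.restrict (Iio 0)] u ∧ v 0 = a

/-- The energy space `Q = H¹(ℝ⁺) ⊕ H¹(ℝ⁻)`. An element is given by a representative `ψ : ℝ → ℂ`,
recorded together with its weak derivative `ψ'` away from the origin and its two boundary values
`ψ(0+)`, `ψ(0-)`; the function determines the boundary values, and the derivative up to null
sets. -/
structure EnergySpace where
  toFun : ℝ → ℂ
  weakDeriv : ℝ → ℂ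
  valRight : ℂ
  valLeft : ℂ
  isH1_right : IsH1On (Ioi 0) toFun weakDeriv
  isH1_left : IsH1On (Iio 0) toFun weakDeriv
  isRightTrace : IsRightTrace toFun valRight
  isLeftTrace : IsLeftTrace toFun valLeft

/-- The action `S_ω(ψ) = ½‖ψ'‖² + (ω/2)‖ψ‖² - (1/(2γ))|ψ(0+) - ψ(0-)|²
  - (λ/(2μ+2))‖ψ‖_{2μ+2}^{2μ+2}`; the coupling constant `λ` is called `lam`. -/
noncomputable def action (γ lam μ ω : ℝ) (ψ : EnergySpace) : ℝ :=
  1 / 2 * (∫ x, ‖ψ.weakDeriv x‖ ^ 2) + ω / 2 * (∫ x, ‖ψ.toFun x‖ ^ 2)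
    - 1 / (2 * γ) * ‖ψ.valRight - ψ.valLeft‖ ^ 2
    - lam / (2 * μ + 2) * ∫ x, ‖ψ.toFun x‖ ^ (2 * μ + 2)

/-- The Nehari functional `I_ω(ψ) = ‖ψ'‖² + ω‖ψ‖² - (1/γ)|ψ(0+) - ψ(0-)|²
  - λ‖ψ‖_{2μ+2}^{2μ+2}`. -/
noncomputable def nehari (γ lam μ ω : ℝ) (ψ : EnergySpace) : ℝ :=
  (∫ x, ‖ψ.weakDeriv x‖ ^ 2) + ω * (∫ x, ‖ψ.toFun x‖ ^ 2)
    - 1 / γ * ‖ψ.valRight - ψ.valLeft‖ ^ 2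
    - lam * ∫ x, ‖ψ.toFun x‖ ^ (2 * μ + 2)

/-- `d(ω) = inf {S_ω(ψ) : ψ ∈ Q \ {0}, I_ω(ψ) = 0}`. -/
noncomputable def groundAction (γ lam μ ω : ℝ) : ℝ :=
  sInf {s : ℝ | ∃ ψ : EnergySpace, ¬ ψ.toFun =ᵐ[volume] 0 ∧
    nehari γ lam μ ω ψ = 0 ∧ s = action γ lam μ ω ψ}

/-- The frequency `ω₀ = 4/γ²` of the linear ground state. -/
noncomputable def freqLinear (γ : ℝ) : ℝ := 4 / γ ^ 2

/-- The bifurcation frequency `ω* = (4/γ²)(μ+1)/μ`. -/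
noncomputable def freqBif (γ μ : ℝ) : ℝ := 4 / γ ^ 2 * ((μ + 1) / μ)

/-- `L = f''(a + 0)`: the right limit of `f''` at `a` exists and equals `L`, and so does the right
derivative of `f'` at `a`. -/
def IsRightSecondDeriv (f : ℝ → ℝ) (a L : ℝ) : Prop :=
  Tendsto (deriv (deriv f)) (𝓝[>] a) (𝓝 L) ∧ HasDerivWithinAt (deriv f) L (Ioi a) a

/-- `L = f''(a - 0)`: the left limit of `f''` at `a` exists and equals `L`, and so does the left
derivative of `f'` at `a`. -/
def IsLeftSecondDeriv (f : ℝ → ℝ) (a L : ℝ) : Prop :=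
  Tendsto (deriv (deriv f)) (𝓝[<] a) (𝓝 L) ∧ HasDerivWithinAt (deriv f) L (Iio a) a

end DeltaPrimeNLS

/-!
A function in `Q` is determined by its two halves, which are continuous up to the origin. By the
Modica–Mortola trick `a² + b² ≥ 2ab`, the action of a half with a given boundary value is at least
that of a piece of soliton, so `S_ω` on the Nehari manifold is bounded below by a function of the
two boundary values alone. Rescaled, this function, `reducedAction μ k x y` below, depends on `γ`,
`λ`, `ω` only through `k = γ √ω`. On its ray, a function of the Nehari manifold has maximal action,
whence `d(ω)` is `λ^{-1/μ} ω^{1/2+1/μ}`, up to a constant depending on `μ`, times the minimax over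
rays of the reduced action. The minimax is attained at critical points realised by pairs of soliton
pieces.

The critical pair is symmetric for `k ≤ 2 √((μ+1)/μ)`, that is for `ω ≤ ω*`. Beyond this value it is
asymmetric, and writing it in terms of the logarithm `z` of the ratio of the two boundary values
makes all quantities explicit in hyperbolic functions. At a critical point the `k`-derivative of the
reduced action only sees the explicit `k`, so `d'` involves just the minimax value and the squared
jump; differentiating once more brings in the logarithmic derivative `R` of the squared jump, which
drops from `2` to a negative value at `ω*`. With this negative value, the sign of `d''(ω* + 0)` is
that of a function of `μ` which is strictly decreasing on `[2, 5/2]` and changes sign there.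
-/

namespace DeltaPrimeNLS

/-! ### Weak derivatives and continuous representatives -/

section SmoothStep

variable {x y ε s : ℝ}

/-- A smooth step from `0` on `(-∞, x]` to `1` on `[x + ε, ∞)`. The difference of two such steps is
the test function that recovers the increments of a function from its weak derivative. -/
noncomputable def smoothStep (x ε s : ℝ) : ℝ := Real.smoothTransition ((s - x) / ε)

lemma contDiff_smoothStep (x ε : ℝ) : ContDiff ℝ (⊤ : ℕ∞) (smoothStep x ε) :=
  Real.smoothTransition.contDiff.comp (by fun_prop)

lemma smoothStep_nonneg : 0 ≤ smoothStep x ε s := Real.smoothTransition.nonneg _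

lemma smoothStep_le_one : smoothStep x ε s ≤ 1 := Real.smoothTransition.le_one _

lemma smoothStep_of_le (hε : 0 < ε) (hs : s ≤ x) : smoothStep x ε s = 0 :=
  Real.smoothTransition.zero_of_nonpos (div_nonpos_of_nonpos_of_nonneg (sub_nonpos.2 hs) hε.le)

lemma smoothStep_of_ge (hε : 0 < ε) (hs : x + ε ≤ s) : smoothStep x ε s = 1 :=
  Real.smoothTransition.one_of_one_le ((one_le_div hε).2 (by linarith))

lemma tendsto_smoothStep (x s : ℝ) :
    Tendsto (fun ε => smoothStep x ε s) (𝓝[>] 0) (𝓝 ((Ioi x).indicator 1 s)) := by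
  refine tendsto_const_nhds.congr' ?_
  rcases le_or_gt s x with hs | hs
  · filter_upwards [self_mem_nhdsWithin] with ε hε
    rw [indicator_of_notMem (notMem_Ioi.2 hs), smoothStep_of_le hε hs]
  · filter_upwards [Ioo_mem_nhdsGT (sub_pos.2 hs)] with ε hε
    rw [indicator_of_mem (mem_Ioi.2 hs), smoothStep_of_ge hε.1 (by linarith [hε.2]), Pi.one_apply]

lemma smoothStep_sub_eq_zero (hxy : x ≤ y) (hε : 0 < ε) (hs : s ∉ Icc x (y + ε)) :
    smoothStep x ε s - smoothStep y ε s = 0 := by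
  rcases lt_or_ge s x with h | h
  · rw [smoothStep_of_le hε h.le, smoothStep_of_le hε (by linarith), sub_zero]
  · have h' : y + ε < s := not_le.1 fun h' => hs ⟨h, h'⟩
    rw [smoothStep_of_ge hε (by linarith), smoothStep_of_ge hε h'.le, sub_self]

lemma continuous_deriv_smoothStep (x ε : ℝ) : Continuous (deriv (smoothStep x ε)) :=
  (contDiff_smoothStep x ε).continuous_deriv (by simp)

lemma deriv_smoothStep_of_notMem (hε : 0 < ε) (hs : s ∉ Icc x (x + ε)) :
    deriv (smoothStep x ε) s = 0 := by
  rcases lt_or_ge s x with h | h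
  · refine (EventuallyEq.deriv_eq (?_ : smoothStep x ε =ᶠ[𝓝 s] fun _ => 0)).trans (deriv_const s 0)
    filter_upwards [Iio_mem_nhds h] with t ht using smoothStep_of_le hε (le_of_lt ht)
  · refine (EventuallyEq.deriv_eq (?_ : smoothStep x ε =ᶠ[𝓝 s] fun _ => 1)).trans (deriv_const s 1)
    filter_upwards [Ioi_mem_nhds (not_le.1 fun h' => hs ⟨h, h'⟩)] with t ht
      using smoothStep_of_ge hε (le_of_lt ht)

lemma integral_deriv_smoothStep (x : ℝ) (hε : 0 < ε) :
    ∫ s in x..x + ε, deriv (smoothStep x ε) s = 1 := by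
  rw [intervalIntegral.integral_deriv_eq_sub
    (fun s _ => (contDiff_smoothStep x ε).differentiable (by simp) s)
    ((continuous_deriv_smoothStep x ε).intervalIntegrable _ _),
    smoothStep_of_ge hε le_rfl, smoothStep_of_le hε le_rfl, sub_zero]

lemma deriv_smoothStep_nonneg (hε : 0 < ε) : 0 ≤ deriv (smoothStep x ε) s :=
  Monotone.deriv_nonneg fun _ _ h =>
    Real.smoothTransition.monotone (by gcongr)

variable {E : Type*} [NormedAddCommGroup E] [NormedSpace ℝ E] {v : ℝ → E}

lemma integrable_deriv_smoothStep_smul (hv : Continuous v) (hε : 0 < ε) :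
    Integrable fun s => deriv (smoothStep x ε) s • v s := by
  refine ((continuous_deriv_smoothStep x ε).fun_smul hv).integrable_of_hasCompactSupport ?_
  refine HasCompactSupport.intro (isCompact_Icc (a := x) (b := x + ε)) fun s hs => ?_
  rw [deriv_smoothStep_of_notMem hε hs, zero_smul]

lemma integral_deriv_smoothStep_smul (hε : 0 < ε) :
    ∫ s, deriv (smoothStep x ε) s • v s = ∫ s in x..x + ε, deriv (smoothStep x ε) s • v s := by
  rw [intervalIntegral.integral_of_le (by linarith), ← integral_Icc_eq_integral_Ioc]
  refine (setIntegral_eq_integral_of_forall_compl_eq_zero fun s hs => ?_).symm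
  rw [deriv_smoothStep_of_notMem hε hs, zero_smul]

lemma tendsto_integral_deriv_smoothStep_smul [CompleteSpace E] (hv : Continuous v) (x : ℝ) :
    Tendsto (fun ε : ℝ => ∫ s, deriv (smoothStep x ε) s • v s) (𝓝[>] 0) (𝓝 (v x)) := by
  refine Metric.tendsto_nhds.2 fun η hη => ?_
  obtain ⟨δ, hδ, hvδ⟩ := Metric.continuousAt_iff.1 (hv.continuousAt (x := x)) (η / 2) (half_pos hη)
  filter_upwards [Ioo_mem_nhdsGT hδ] with ε hε
  have hle : x ≤ x + ε := by linarith [hε.1]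
  have hc := continuous_deriv_smoothStep x ε
  have hsub : (∫ s, deriv (smoothStep x ε) s • v s) - v x =
      ∫ s in x..x + ε, deriv (smoothStep x ε) s • (v s - v x) := by
    simp only [smul_sub]
    rw [intervalIntegral.integral_sub ((hc.fun_smul hv).intervalIntegrable _ _)
      ((hc.fun_smul continuous_const).intervalIntegrable _ _), intervalIntegral.integral_smul_const,
      integral_deriv_smoothStep x hε.1, one_smul, integral_deriv_smoothStep_smul hε.1]
  have hnear : ∀ s ∈ Icc x (x + ε), ‖v s - v x‖ ≤ η / 2 := fun s hs => by
    rw [← dist_eq_norm]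
    refine (hvδ ?_).le
    rw [Real.dist_eq, abs_of_nonneg (by linarith [hs.1])]
    linarith [hs.2, hε.2]
  rw [dist_eq_norm, hsub]
  calc ‖∫ s in x..x + ε, deriv (smoothStep x ε) s • (v s - v x)‖
      ≤ ∫ s in x..x + ε, deriv (smoothStep x ε) s * (η / 2) := by
        refine intervalIntegral.norm_integral_le_of_norm_le hle (.of_forall fun s hs => ?_)
          ((hc.mul continuous_const).intervalIntegrable _ _)
        rw [norm_smul, Real.norm_of_nonneg (deriv_smoothStep_nonneg hε.1)]
        exact mul_le_mul_of_nonneg_left (hnear s (Ioc_subset_Icc_self hs))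
          (deriv_smoothStep_nonneg hε.1)
    _ = η / 2 := by
        rw [intervalIntegral.integral_mul_const, integral_deriv_smoothStep x hε.1, one_mul]
    _ < η := half_lt_self hη

lemma tendsto_setIntegral_smoothStep_sub_smul {U : Set ℝ} {g : ℝ → E} {δ : ℝ}
    (hUm : MeasurableSet U) (hxy : x ≤ y) (hδ : 0 < δ) (hU : Icc x (y + δ) ⊆ U)
    (hg : IntegrableOn g (Icc x (y + δ))) :
    Tendsto (fun ε => ∫ s in U, (smoothStep x ε s - smoothStep y ε s) • g s) (𝓝[>] 0)
      (𝓝 (∫ s in x..y, g s)) := by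
  have hsupp : ∀ ε ∈ Ioo 0 δ, ∀ s ∉ Icc x (y + δ), smoothStep x ε s - smoothStep y ε s = 0 :=
    fun ε hε s hs => smoothStep_sub_eq_zero hxy hε.1 fun h => hs ⟨h.1, by linarith [h.2, hε.2]⟩
  have hlim : Tendsto (fun ε => ∫ s in Icc x (y + δ), (smoothStep x ε s - smoothStep y ε s) • g s)
      (𝓝[>] 0) (𝓝 (∫ s in Icc x (y + δ), (Ioc x y).indicator g s)) := by
    refine tendsto_integral_filter_of_dominated_convergence (fun s => ‖g s‖) ?_ ?_ hg.norm ?_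
    · refine .of_forall fun ε => ?_
      exact ((contDiff_smoothStep x ε).continuous.sub
        (contDiff_smoothStep y ε).continuous).aestronglyMeasurable.smul hg.1
    · refine .of_forall fun ε => .of_forall fun s => ?_
      rw [norm_smul]
      refine mul_le_of_le_one_left (norm_nonneg _) (abs_sub_le_iff.2 ?_)
      constructor <;> linarith [smoothStep_nonneg (x := x) (ε := ε) (s := s),
        smoothStep_nonneg (x := y) (ε := ε) (s := s), smoothStep_le_one (x := x) (ε := ε) (s := s),
        smoothStep_le_one (x := y) (ε := ε) (s := s)]
    · refine .of_forall fun s => ?_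
      have hind : (Ioc x y).indicator g s =
          ((Ioi x).indicator (1 : ℝ → ℝ) s - (Ioi y).indicator 1 s) • g s := by
        rcases le_or_gt s x with hx | hx
        · simp [indicator, hx.not_gt, (hx.trans hxy).not_gt]
        · rcases le_or_gt s y with hy | hy
          · simp [indicator, hx, hy, hy.not_gt]
          · simp [indicator, hx, hy, hy.not_ge]
      rw [hind]
      exact ((tendsto_smoothStep x s).sub (tendsto_smoothStep y s)).smul_const (g s)
  rw [setIntegral_indicator measurableSet_Ioc, inter_eq_right.2
    (Ioc_subset_Icc_self.trans (Icc_subset_Icc_right (by linarith))),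
    ← intervalIntegral.integral_of_le hxy] at hlim
  refine hlim.congr' ?_
  filter_upwards [Ioo_mem_nhdsGT hδ] with ε hε
  refine (setIntegral_eq_of_subset_of_forall_sdiff_eq_zero hUm hU fun s hs => ?_).symm
  rw [hsupp ε hε s hs.2, zero_smul]

end SmoothStep

lemma integrableOn_of_memLp {U s : Set ℝ} {g : ℝ → ℂ} (hg : MemLp g 2 (volume.restrict U))
    (hs : Bornology.IsBounded s) (hsU : s ⊆ U) : IntegrableOn g s := by
  have : IsFiniteMeasure (volume.restrict s) :=
    ⟨by rw [Measure.restrict_apply_univ]; exact hs.measure_lt_top⟩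
  exact (hg.mono_measure (Measure.restrict_mono hsU le_rfl)).integrable one_le_two

lemma intervalIntegrable_of_memLp_Ioi {g : ℝ → ℂ} {x y : ℝ}
    (hg : MemLp g 2 (volume.restrict (Ioi 0))) (hx : 0 ≤ x) (hy : 0 ≤ y) :
    IntervalIntegrable g volume x y :=
  intervalIntegrable_iff.2 <| integrableOn_of_memLp hg (Metric.isBounded_Ioc _ _)
    fun _ hs => (le_min hx hy).trans_lt hs.1

lemma IsWeakDerivOn.integral_deriv_smoothStep_sub {U : Set ℝ} {u g v : ℝ → ℂ} {x y ε δ : ℝ}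
    (hw : IsWeakDerivOn U u g) (hv : Continuous v) (hvu : v =ᵐ[volume.restrict U] u)
    (hxy : x ≤ y) (hε : ε ∈ Ioo 0 δ) (hU : Icc x (y + δ) ⊆ U) :
    (∫ s, deriv (smoothStep y ε) s • v s) - ∫ s, deriv (smoothStep x ε) s • v s =
      ∫ s in U, (smoothStep x ε s - smoothStep y ε s) • g s := by
  have hsupp : tsupport (fun s => smoothStep x ε s - smoothStep y ε s) ⊆ Icc x (y + ε) :=
    closure_minimal (fun s hs => not_not.1 fun h => hs (smoothStep_sub_eq_zero hxy hε.1 h))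
      isClosed_Icc
  have hderiv (s : ℝ) : deriv (fun s => smoothStep x ε s - smoothStep y ε s) s =
      deriv (smoothStep x ε) s - deriv (smoothStep y ε) s :=
    deriv_fun_sub ((contDiff_smoothStep x ε).differentiable (by simp) s)
      ((contDiff_smoothStep y ε).differentiable (by simp) s)
  have hzero : ∀ s ∉ U, (deriv (smoothStep x ε) s - deriv (smoothStep y ε) s) • v s = 0 :=
    fun s hs => by
      rw [deriv_smoothStep_of_notMem hε.1 fun h => hs (hU ⟨h.1, by linarith [h.2, hε.2]⟩),
        deriv_smoothStep_of_notMem hε.1 fun h => hs (hU ⟨by linarith [h.1],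
          by linarith [h.2, hε.2]⟩), sub_zero, zero_smul]
  have htest := hw (fun s => smoothStep x ε s - smoothStep y ε s)
    ((contDiff_smoothStep x ε).sub (contDiff_smoothStep y ε))
    (isCompact_Icc.of_isClosed_subset (isClosed_tsupport _) hsupp)
    (hsupp.trans ((Icc_subset_Icc_right (by linarith [hε.2])).trans hU))
  have hrepr : ∫ s in U, deriv (fun s => smoothStep x ε s - smoothStep y ε s) s • u s =
      ∫ s, (deriv (smoothStep x ε) s - deriv (smoothStep y ε) s) • v s := by
    rw [← setIntegral_eq_integral_of_forall_compl_eq_zero hzero]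
    refine integral_congr_ae ?_
    filter_upwards [hvu] with s hs
    rw [hderiv, hs]
  simp only [hrepr, sub_smul] at htest
  rw [integral_sub (integrable_deriv_smoothStep_smul hv hε.1)
    (integrable_deriv_smoothStep_smul hv hε.1)] at htest
  simp only [sub_smul]
  linear_combination -htest

lemma IsWeakDerivOn.sub_eq_integral {U : Set ℝ} {u g v : ℝ → ℂ} {x y : ℝ}
    (hw : IsWeakDerivOn U u g) (hUo : IsOpen U) (hg : MemLp g 2 (volume.restrict U))
    (hv : Continuous v) (hvu : v =ᵐ[volume.restrict U] u) (hxy : x ≤ y) (hU : Icc x y ⊆ U) :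
    v y - v x = ∫ s in x..y, g s := by
  obtain ⟨δ, hδ, hδU⟩ : ∃ δ > 0, Icc x (y + δ) ⊆ U := by
    obtain ⟨δ, hδ, hball⟩ := Metric.isOpen_iff.1 hUo y (hU (right_mem_Icc.2 hxy))
    refine ⟨δ / 2, half_pos hδ, fun s hs => ?_⟩
    rcases le_or_gt s y with h | h
    · exact hU ⟨hs.1, h⟩
    · refine hball ?_
      rw [Metric.mem_ball, Real.dist_eq, abs_of_pos (sub_pos.2 h)]
      linarith [hs.2]
  refine tendsto_nhds_unique (Tendsto.congr' ?_
    ((tendsto_integral_deriv_smoothStep_smul hv y).sub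
      (tendsto_integral_deriv_smoothStep_smul hv x)))
    (tendsto_setIntegral_smoothStep_sub_smul hUo.measurableSet hxy hδ hδU
      (integrableOn_of_memLp hg (Metric.isBounded_Icc _ _) hδU))
  filter_upwards [Ioo_mem_nhdsGT hδ] with ε hε
  exact hw.integral_deriv_smoothStep_sub hv hvu hxy hε hδU

/-- `v` is the continuous representative on `[0, ∞)` of a function of class `H¹(0, ∞)` with
weak derivative `g`; it is extended to a continuous function on `ℝ` in an arbitrary way. -/
structure HalfLineH1 (v g : ℝ → ℂ) : Prop where
  continuous : Continuous v
  memLp : MemLp v 2 (volume.restrict (Ioi 0))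
  memLp_deriv : MemLp g 2 (volume.restrict (Ioi 0))
  sub_eq : ∀ x y, 0 ≤ x → x ≤ y → v y - v x = ∫ s in x..y, g s

lemma sub_eq_integral_of_pos {v g : ℝ → ℂ} (hv : Continuous v)
    (hg : MemLp g 2 (volume.restrict (Ioi 0)))
    (h : ∀ x y, 0 < x → x ≤ y → v y - v x = ∫ s in x..y, g s) {x y : ℝ} (hx : 0 ≤ x)
    (hxy : x ≤ y) : v y - v x = ∫ s in x..y, g s := by
  rcases hx.eq_or_lt with rfl | hx
  swap
  · exact h x y hx hxy
  rcases hxy.eq_or_lt with rfl | hy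
  · simp
  have hprim : ContinuousOn (fun x => ∫ s in y..x, g s) (uIcc y 0) :=
    intervalIntegral.continuousOn_primitive_interval'
      (intervalIntegrable_of_memLp_Ioi hg hy.le le_rfl) left_mem_uIcc
  have hlim : Tendsto (fun x => ∫ s in y..x, g s) (𝓝[>] 0) (𝓝 (∫ s in y..0, g s)) := by
    refine (hprim 0 right_mem_uIcc).tendsto.mono_left (nhdsWithin_le_of_mem ?_)
    rw [uIcc_of_ge hy.le]
    exact mem_of_superset (Ioo_mem_nhdsGT hy) Ioo_subset_Icc_self
  have hlim' : Tendsto (fun x => v y - v x) (𝓝[>] 0) (𝓝 (v y - v 0)) :=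
    (tendsto_const_nhds.sub hv.continuousAt.tendsto).mono_left nhdsWithin_le_nhds
  rw [intervalIntegral.integral_symm]
  refine tendsto_nhds_unique_of_eventuallyEq hlim' hlim.neg ?_
  filter_upwards [Ioo_mem_nhdsGT hy] with s hs
  rw [h s y hs.1 hs.2.le, intervalIntegral.integral_symm]

lemma IsH1On.exists_halfLineH1 {u g : ℝ → ℂ} {a : ℂ} (h : IsH1On (Ioi 0) u g)
    (ha : IsRightTrace u a) :
    ∃ v, HalfLineH1 v g ∧ v =ᵐ[volume.restrict (Ioi 0)] u ∧ v 0 = a := by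
  obtain ⟨v₀, hv₀, hvu, hva⟩ := ha
  have hv : Continuous fun s => v₀ (max s 0) :=
    hv₀.comp_continuous (by fun_prop) fun s => le_max_right s 0
  have hveq : (fun s => v₀ (max s 0)) =ᵐ[volume.restrict (Ioi 0)] u := by
    filter_upwards [hvu, ae_restrict_mem measurableSet_Ioi] with s hs hs0
    rw [max_eq_left hs0.le, hs]
  refine ⟨_, ⟨hv, (memLp_congr_ae hveq).2 h.memLp, h.memLp_deriv, fun x y hx hxy =>
    sub_eq_integral_of_pos hv h.memLp_deriv (fun x y hx hxy => ?_) hx hxy⟩, hveq, by simp [hva]⟩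
  exact h.isWeakDeriv.sub_eq_integral isOpen_Ioi h.memLp_deriv hv hveq hxy
    fun s hs => hx.trans_le hs.1

lemma measurePreserving_neg_restrict (U : Set ℝ) : MeasurePreserving (fun x : ℝ => -x)
    (volume.restrict ((fun x => -x) ⁻¹' U)) (volume.restrict U) :=
  (Measure.measurePreserving_neg (volume : Measure ℝ)).restrict_preimage_emb
    (Homeomorph.neg ℝ).measurableEmbedding U

lemma IsWeakDerivOn.comp_neg {U : Set ℝ} {u g : ℝ → ℂ} (h : IsWeakDerivOn U u g) :
    IsWeakDerivOn ((fun x => -x) ⁻¹' U) (fun x => u (-x)) (fun x => -g (-x)) := by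
  intro φ hφ hφc hφs
  have hsub : tsupport (fun x => φ (-x)) ⊆ U := by
    rw [show tsupport (fun x => φ (-x)) = (fun x : ℝ => -x) ⁻¹' tsupport φ from
      tsupport_comp_eq_preimage φ (Homeomorph.neg ℝ)]
    exact fun x hx => by simpa using hφs hx
  have hchange (f : ℝ → ℂ) : ∫ x in U, f x = ∫ x in (fun x => -x) ⁻¹' U, f (-x) :=
    ((measurePreserving_neg_restrict U).integral_comp
      (Homeomorph.neg ℝ).measurableEmbedding f).symm
  have htest := h (fun x => φ (-x)) (hφ.comp contDiff_neg)
    (hφc.comp_homeomorph (Homeomorph.neg ℝ)) hsub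
  simp only [hchange, deriv_comp_neg, neg_neg, neg_smul, integral_neg] at htest
  simp only [smul_neg, integral_neg, neg_neg]
  linear_combination -htest

lemma IsH1On.comp_neg {U : Set ℝ} {u g : ℝ → ℂ} (h : IsH1On U u g) :
    IsH1On ((fun x => -x) ⁻¹' U) (fun x => u (-x)) (fun x => -g (-x)) :=
  ⟨h.memLp.comp_measurePreserving (measurePreserving_neg_restrict U),
    (h.memLp_deriv.comp_measurePreserving (measurePreserving_neg_restrict U)).neg,
    h.isWeakDeriv.comp_neg⟩

lemma ae_eq_comp_neg_Ioi {f g : ℝ → ℂ} (h : f =ᵐ[volume.restrict (Ioi 0)] g) :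
    (fun x => f (-x)) =ᵐ[volume.restrict (Iio 0)] fun x => g (-x) := by
  simpa [Function.comp_def] using
    (measurePreserving_neg_restrict (Ioi 0)).quasiMeasurePreserving.ae_eq_comp h

lemma ae_eq_comp_neg_Iio {f g : ℝ → ℂ} (h : f =ᵐ[volume.restrict (Iio 0)] g) :
    (fun x => f (-x)) =ᵐ[volume.restrict (Ioi 0)] fun x => g (-x) := by
  simpa [Function.comp_def] using
    (measurePreserving_neg_restrict (Iio 0)).quasiMeasurePreserving.ae_eq_comp h

lemma IsLeftTrace.comp_neg {u : ℝ → ℂ} {b : ℂ} (hb : IsLeftTrace u b) :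
    IsRightTrace (fun x => u (-x)) b := by
  obtain ⟨v, hv, hvu, hvb⟩ := hb
  exact ⟨fun x => v (-x),
    hv.comp continuousOn_neg fun x (hx : 0 ≤ x) => show -x ≤ 0 by simpa using hx,
    ae_eq_comp_neg_Iio hvu, by simpa using hvb⟩

namespace HalfLineH1

variable {v g : ℝ → ℂ} {x y : ℝ}

lemma smul (h : HalfLineH1 v g) (t : ℝ) : HalfLineH1 (fun x => t • v x) (fun x => t • g x) where
  continuous := h.continuous.const_smul t
  memLp := h.memLp.const_smul t
  memLp_deriv := h.memLp_deriv.const_smul t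
  sub_eq x y hx hxy := by
    rw [intervalIntegral.integral_smul, ← h.sub_eq x y hx hxy, smul_sub]

lemma intervalIntegrable (h : HalfLineH1 v g) (hx : 0 ≤ x) (hy : 0 ≤ y) :
    IntervalIntegrable g volume x y :=
  intervalIntegrable_of_memLp_Ioi h.memLp_deriv hx hy

lemma integrableOn_sq (h : HalfLineH1 v g) : IntegrableOn (fun x => ‖v x‖ ^ 2) (Ioi 0) :=
  h.memLp.integrable_norm_pow two_ne_zero

lemma integrableOn_deriv_sq (h : HalfLineH1 v g) : IntegrableOn (fun x => ‖g x‖ ^ 2) (Ioi 0) :=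
  h.memLp_deriv.integrable_norm_pow two_ne_zero

lemma abs_norm_sub_le (h : HalfLineH1 v g) (hx : 0 ≤ x) (hxy : x ≤ y) :
    |‖v y‖ - ‖v x‖| ≤ ∫ s in x..y, ‖g s‖ := by
  refine (abs_norm_sub_norm_le _ _).trans ?_
  rw [h.sub_eq x y hx hxy]
  exact intervalIntegral.norm_integral_le_integral_norm hxy

end HalfLineH1

/-! ### The Modica–Mortola inequality on a half-line -/

section ChainRule

variable {f N a n F : ℝ → ℝ} {x y K : ℝ}

lemma absolutelyContinuousOnInterval_of_dist_le (hN : AbsolutelyContinuousOnInterval N x y)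
    (h : ∀ s ∈ uIcc x y, ∀ t ∈ uIcc x y, dist (f s) (f t) ≤ K * dist (N s) (N t)) :
    AbsolutelyContinuousOnInterval f x y := by
  refine squeeze_zero' (.of_forall fun _ => by positivity) ?_
    (g := fun I => K * ∑ i ∈ Finset.range I.1, dist (N (I.2 i).1) (N (I.2 i).2))
    (by simpa only [mul_zero] using Tendsto.const_mul K hN)
  filter_upwards [mem_inf_of_right (mem_principal_self _)] with I hI
  rw [Finset.mul_sum]
  exact Finset.sum_le_sum fun i hi => h _ (hI.1 i hi).1 _ (hI.1 i hi).2

lemma absolutelyContinuousOnInterval_integral_comp (hF : Continuous F)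
    (ha : AbsolutelyContinuousOnInterval a x y) (c : ℝ) :
    AbsolutelyContinuousOnInterval (fun s => ∫ r in c..a s, F r) x y := by
  obtain ⟨R, hR⟩ := ha.exists_bound
  obtain ⟨K, hK⟩ := (isCompact_Icc (a := -R) (b := R)).exists_bound_of_continuousOn
    hF.continuousOn
  refine absolutelyContinuousOnInterval_of_dist_le (K := K) ha fun s hs t ht => ?_
  rw [dist_comm, dist_comm (a s), Real.dist_eq, Real.dist_eq,
    intervalIntegral.integral_interval_sub_left (hF.intervalIntegrable _ _)
      (hF.intervalIntegrable _ _)]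
  refine intervalIntegral.norm_integral_le_of_norm_le_const fun r hr => hK r ?_
  exact uIcc_subset_Icc (abs_le.1 (hR s hs)) (abs_le.1 (hR t ht)) (uIoc_subset_uIcc hr)

lemma abs_le_of_hasDerivAt {f' N' s : ℝ} (hf : HasDerivAt f f' s) (hN : HasDerivAt N N' s)
    (h : ∀ᶠ t in 𝓝 s, dist (f t) (f s) ≤ dist (N t) (N s)) : |f'| ≤ |N'| := by
  refine le_of_tendsto_of_tendsto (hasDerivAt_iff_tendsto_slope.1 hf).abs
    (hasDerivAt_iff_tendsto_slope.1 hN).abs ?_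
  filter_upwards [h.filter_mono nhdsWithin_le_nhds] with t ht
  simp only [slope_def_field, abs_div]
  exact div_le_div_of_nonneg_right ht (abs_nonneg _)

lemma dist_le_dist_integral (hn : IntervalIntegrable n volume x y)
    (ha : ∀ s t, x ≤ s → s ≤ t → t ≤ y → |a t - a s| ≤ ∫ r in s..t, n r) {s t : ℝ}
    (hs : s ∈ Icc x y) (ht : t ∈ Icc x y) :
    dist (a s) (a t) ≤ dist (∫ r in x..s, n r) (∫ r in x..t, n r) := by
  wlog hst : s ≤ t generalizing s t
  · rw [dist_comm (a s), dist_comm (∫ r in x..s, n r)]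
    exact this ht hs (le_of_not_ge hst)
  have hinteg : ∀ r ∈ Icc x y, IntervalIntegrable n volume x r := fun r hr =>
    hn.mono_set (uIcc_subset_uIcc_left (Icc_subset_uIcc hr))
  rw [dist_comm (a s), dist_comm (∫ r in x..s, n r), Real.dist_eq, Real.dist_eq,
    intervalIntegral.integral_interval_sub_left (hinteg t ht) (hinteg s hs)]
  exact (ha s t hs.1 hst ht.2).trans (le_abs_self _)

lemma abs_integral_comp_le (hF : Continuous F) (hn : IntervalIntegrable n volume x y)
    (hn0 : ∀ s, 0 ≤ n s) (hxy : x ≤ y)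
    (ha : ∀ s t, x ≤ s → s ≤ t → t ≤ y → |a t - a s| ≤ ∫ r in s..t, n r) :
    |∫ r in a x..a y, F r| ≤ ∫ s in x..y, |F (a s)| * n s := by
  have haac : AbsolutelyContinuousOnInterval a x y :=
    absolutelyContinuousOnInterval_of_dist_le (K := 1)
      (hn.absolutelyContinuousOnInterval_intervalIntegral left_mem_uIcc) fun s hs t ht => by
        rw [uIcc_of_le hxy] at hs ht
        simpa using dist_le_dist_integral hn ha hs ht
  have hderiv : ∀ᵐ s, s ∈ Ioc x y → ‖deriv (fun s => ∫ r in a x..a s, F r) s‖ ≤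
      |F (a s)| * n s := by
    filter_upwards [haac.ae_differentiableAt, hn.ae_hasDerivAt_integral,
      (measure_eq_zero_iff_ae_notMem.1 (measure_singleton y))] with s has hns hsy hs
    have hsI : s ∈ Icc x y := Ioc_subset_Icc_self hs
    have ha' := (has (Icc_subset_uIcc hsI)).hasDerivAt
    have hle : |deriv a s| ≤ |n s| := by
      refine abs_le_of_hasDerivAt ha' (hns (Icc_subset_uIcc hsI) x left_mem_uIcc) ?_
      filter_upwards [Ioo_mem_nhds hs.1 (hs.2.lt_of_ne hsy)] with t ht
      exact dist_le_dist_integral hn ha (Ioo_subset_Icc_self ht) hsI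
    have hcomp : HasDerivAt (fun s => ∫ r in a x..a s, F r) (F (a s) * deriv a s) s :=
      (hF.integral_hasStrictDerivAt (a x) (a s)).hasDerivAt.comp s ha'
    rw [hcomp.deriv, norm_mul, Real.norm_eq_abs, Real.norm_eq_abs]
    exact mul_le_mul_of_nonneg_left (hle.trans_eq (abs_of_nonneg (hn0 s))) (abs_nonneg _)
  have hFTC := (absolutelyContinuousOnInterval_integral_comp hF haac (a x)).integral_deriv_eq_sub
  rw [intervalIntegral.integral_same, sub_zero] at hFTC
  rw [← hFTC]
  exact intervalIntegral.norm_integral_le_of_norm_le hxy hderiv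
    (hn.continuousOn_mul (hF.comp_continuousOn haac.continuousOn).abs)

end ChainRule

namespace HalfLineH1

variable {v g : ℝ → ℂ} {F : ℝ → ℝ} {x y A : ℝ}

lemma abs_integral_norm_le (h : HalfLineH1 v g) (hF : Continuous F) (hx : 0 ≤ x) (hxy : x ≤ y) :
    |∫ s in ‖v x‖..‖v y‖, F s| ≤ ∫ s in x..y, |F ‖v s‖| * ‖g s‖ :=
  abs_integral_comp_le (a := fun s => ‖v s‖) hF (h.intervalIntegrable hx (hx.trans hxy)).norm
    (fun _ => norm_nonneg _) hxy fun _ _ hs hst _ => h.abs_norm_sub_le (hx.trans hs) hst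

lemma two_mul_abs_integral_norm_le (h : HalfLineH1 v g) (hF : Continuous F) (hx : 0 ≤ x)
    (hxy : x ≤ y) :
    2 * |∫ s in ‖v x‖..‖v y‖, F s| ≤ ∫ s in x..y, (‖g s‖ ^ 2 + F ‖v s‖ ^ 2) := by
  have hy := hx.trans hxy
  have hFv : Continuous fun s => F ‖v s‖ := hF.comp h.continuous.norm
  have hgi : IntervalIntegrable (fun s => ‖g s‖ ^ 2) volume x y := by
    rw [intervalIntegrable_iff, uIoc_of_le hxy]
    exact h.integrableOn_deriv_sq.mono_set fun s hs => hx.trans_lt hs.1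
  calc 2 * |∫ s in ‖v x‖..‖v y‖, F s| ≤ 2 * ∫ s in x..y, |F ‖v s‖| * ‖g s‖ := by
        gcongr
        exact h.abs_integral_norm_le hF hx hxy
    _ = ∫ s in x..y, 2 * (|F ‖v s‖| * ‖g s‖) := (intervalIntegral.integral_const_mul _ _).symm
    _ ≤ ∫ s in x..y, (‖g s‖ ^ 2 + F ‖v s‖ ^ 2) := by
        refine intervalIntegral.integral_mono_on hxy
          (((h.intervalIntegrable hx hy).norm.continuousOn_mul hFv.abs.continuousOn).const_mul 2)
          (hgi.add ((hFv.pow 2).intervalIntegrable _ _)) fun s _ => ?_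
        rw [← sq_abs (F ‖v s‖)]
        nlinarith [sq_nonneg (‖g s‖ - |F ‖v s‖|)]

lemma exists_norm_lt (h : HalfLineH1 v g) {ε : ℝ} (hx : 0 ≤ x) (hε : 0 < ε) :
    ∃ y, x ≤ y ∧ ‖v y‖ < ε := by
  by_contra! hge
  have hconst : IntegrableOn (fun _ : ℝ => ε ^ 2) (Ioi x) := by
    refine Integrable.mono' (h.integrableOn_sq.mono_set (Ioi_subset_Ioi hx))
      aestronglyMeasurable_const ?_
    filter_upwards [ae_restrict_mem measurableSet_Ioi] with s hs
    rw [Real.norm_of_nonneg (by positivity)]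
    exact pow_le_pow_left₀ hε.le (hge s (le_of_lt hs)) 2
  simp [integrableOn_const_iff, hε.ne'] at hconst

lemma exists_abs_integral_norm_le (h : HalfLineH1 v g) (hF : Continuous F) {ε : ℝ} (hx : 0 ≤ x)
    (hε : 0 < ε) : ∃ y, x ≤ y ∧ |∫ s in (0 : ℝ)..‖v y‖, F s| ≤ ε := by
  have hcont : Continuous fun a => ∫ s in (0 : ℝ)..a, F s :=
    intervalIntegral.continuous_primitive (fun _ _ => hF.intervalIntegrable _ _) 0
  obtain ⟨η, hη, hball⟩ := Metric.continuousAt_iff.1 (hcont.continuousAt (x := 0)) ε hε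
  obtain ⟨y, hxy, hy⟩ := h.exists_norm_lt hx hη
  refine ⟨y, hxy, ?_⟩
  simpa [Real.dist_eq] using (hball (x := ‖v y‖) (by simpa [Real.dist_eq] using hy)).le

/-- The factor `2` in front of the integral up to `‖v x‖` is due to the fact that `‖v‖` goes from
`‖v 0‖` to `‖v x‖` and then down to `0`. -/
lemma two_mul_sub_le (h : HalfLineH1 v g) (hF : Continuous F)
    (hinteg : IntegrableOn (fun s => ‖g s‖ ^ 2 + F ‖v s‖ ^ 2) (Ioi 0)) (hx : 0 ≤ x) :
    2 * (2 * (∫ s in (0 : ℝ)..‖v x‖, F s) - ∫ s in (0 : ℝ)..‖v 0‖, F s) ≤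
      ∫ s in Ioi 0, (‖g s‖ ^ 2 + F ‖v s‖ ^ 2) := by
  have hFi (a b : ℝ) : IntervalIntegrable F volume a b := hF.intervalIntegrable a b
  refine le_of_forall_pos_le_add fun ε hε => ?_
  obtain ⟨y, hxy, hy⟩ := h.exists_abs_integral_norm_le hF hx (half_pos hε)
  have hup := h.two_mul_abs_integral_norm_le hF le_rfl hx
  have hdown := h.two_mul_abs_integral_norm_le hF hx hxy
  rw [← intervalIntegral.integral_interval_sub_left (hFi 0 _) (hFi 0 _)] at hup hdown
  have htotal : (∫ s in (0 : ℝ)..x, (‖g s‖ ^ 2 + F ‖v s‖ ^ 2)) +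
      (∫ s in x..y, (‖g s‖ ^ 2 + F ‖v s‖ ^ 2)) ≤ ∫ s in Ioi 0, (‖g s‖ ^ 2 + F ‖v s‖ ^ 2) := by
    rw [intervalIntegral.integral_add_adjacent_intervals,
      intervalIntegral.integral_of_le (hx.trans hxy)]
    · exact setIntegral_mono_set hinteg (.of_forall fun s => by positivity)
        Ioc_subset_Ioi_self.eventuallyLE
    · exact (intervalIntegrable_iff_integrableOn_Ioc_of_le hx).2
        (hinteg.mono_set Ioc_subset_Ioi_self)
    · exact (intervalIntegrable_iff_integrableOn_Ioc_of_le hxy).2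
        (hinteg.mono_set fun s hs => hx.trans_lt hs.1)
  linarith [abs_le.1 hy, le_abs_self ((∫ s in (0 : ℝ)..‖v x‖, F s) - ∫ s in (0 : ℝ)..‖v 0‖, F s),
    neg_abs_le ((∫ s in (0 : ℝ)..‖v y‖, F s) - ∫ s in (0 : ℝ)..‖v x‖, F s)]

lemma sq_norm_le (h : HalfLineH1 v g) (hx : 0 ≤ x) :
    ‖v x‖ ^ 2 ≤ ‖v 0‖ ^ 2 + ∫ s in Ioi 0, (‖g s‖ ^ 2 + ‖v s‖ ^ 2) := by
  have hinteg : IntegrableOn (fun s => ‖g s‖ ^ 2 + ‖v s‖ ^ 2) (Ioi 0) :=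
    h.integrableOn_deriv_sq.add h.integrableOn_sq
  have hle := h.two_mul_abs_integral_norm_le continuous_id le_rfl hx
  simp only [id_eq, integral_id] at hle
  have hmono : ∫ s in (0 : ℝ)..x, (‖g s‖ ^ 2 + ‖v s‖ ^ 2) ≤
      ∫ s in Ioi 0, (‖g s‖ ^ 2 + ‖v s‖ ^ 2) := by
    rw [intervalIntegral.integral_of_le hx]
    exact setIntegral_mono_set hinteg (.of_forall fun s => by positivity)
      Ioc_subset_Ioi_self.eventuallyLE
  linarith [le_abs_self ((‖v x‖ ^ 2 - ‖v 0‖ ^ 2) / 2)]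

lemma exists_isLUB (h : HalfLineH1 v g) : ∃ A, IsLUB ((fun x => ‖v x‖) '' Ici 0) A := by
  refine Real.exists_isLUB ⟨_, mem_image_of_mem _ (self_mem_Ici (a := (0 : ℝ)))⟩
    ⟨√(‖v 0‖ ^ 2 + ∫ s in Ioi 0, (‖g s‖ ^ 2 + ‖v s‖ ^ 2)), ?_⟩
  rintro _ ⟨x, hx, rfl⟩
  exact Real.le_sqrt_of_sq_le (h.sq_norm_le hx)

end HalfLineH1

lemma norm_le_of_isLUB {v : ℝ → ℂ} {x A : ℝ} (hA : IsLUB ((fun x => ‖v x‖) '' Ici 0) A)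
    (hx : 0 ≤ x) : ‖v x‖ ≤ A :=
  hA.1 (mem_image_of_mem _ hx)

lemma rpow_two_mul_add_two {s μ : ℝ} (hs : 0 ≤ s) (hμ : 0 < μ) :
    s ^ (2 * μ + 2) = s ^ (2 * μ) * s ^ 2 := by
  rw [Real.rpow_add' hs (by positivity), Real.rpow_two]

lemma HalfLineH1.integrableOn_rpow {v g : ℝ → ℂ} {μ : ℝ} (h : HalfLineH1 v g) (hμ : 0 < μ) :
    IntegrableOn (fun x => ‖v x‖ ^ (2 * μ + 2)) (Ioi 0) := by
  obtain ⟨A, hA⟩ := h.exists_isLUB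
  refine Integrable.mono' (h.integrableOn_sq.const_mul (A ^ (2 * μ))) ?_ ?_
  · exact (h.continuous.norm.rpow_const fun _ => Or.inr (by positivity)).aestronglyMeasurable
  · filter_upwards [ae_restrict_mem measurableSet_Ioi] with x hx
    rw [Real.norm_of_nonneg (by positivity), rpow_two_mul_add_two (norm_nonneg _) hμ]
    gcongr
    exact norm_le_of_isLUB hA (le_of_lt hx)

section Profile

variable {μ s x y : ℝ}

/-- `-w'` as a function of `w`, for the decaying profile of amplitude one at frequency one, i.e.
for the positive solution of `w'' = w - (μ + 1) w ^ (2 μ + 1)` that vanishes at `+∞`. -/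
noncomputable def profileSpeed (μ s : ℝ) : ℝ := s * √(1 - s ^ (2 * μ))

/-- The primitive of `profileSpeed μ`: the action of the decaying profile starting at the
value `x`. -/
noncomputable def profileAction (μ x : ℝ) : ℝ := ∫ s in (0 : ℝ)..x, profileSpeed μ s

/-- The action of two decaying profiles on the half-lines, with boundary values `x` and `-y`. Here
`k` stands for `γ √ω`. -/
noncomputable def reducedAction (μ k x y : ℝ) : ℝ :=
  profileAction μ x + profileAction μ y - (x + y) ^ 2 / (2 * k)

lemma continuous_profileSpeed (hμ : 0 < μ) : Continuous (profileSpeed μ) :=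
  continuous_id.mul (continuous_const.sub (Real.continuous_rpow_const (by positivity))).sqrt

lemma profileSpeed_nonneg (hs : 0 ≤ s) : 0 ≤ profileSpeed μ s := mul_nonneg hs (Real.sqrt_nonneg _)

lemma hasDerivAt_profileAction (hμ : 0 < μ) (x : ℝ) :
    HasDerivAt (profileAction μ) (profileSpeed μ x) x :=
  ((continuous_profileSpeed hμ).integral_hasStrictDerivAt 0 x).hasDerivAt

lemma continuous_profileAction (hμ : 0 < μ) : Continuous (profileAction μ) :=
  continuous_iff_continuousAt.2 fun x => (hasDerivAt_profileAction hμ x).continuousAt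

lemma monotoneOn_profileAction (hμ : 0 < μ) : MonotoneOn (profileAction μ) (Ici 0) := by
  refine monotoneOn_of_deriv_nonneg (convex_Ici 0) (continuous_profileAction hμ).continuousOn
    (fun x _ => (hasDerivAt_profileAction hμ x).differentiableAt.differentiableWithinAt)
    fun x hx => ?_
  rw [(hasDerivAt_profileAction hμ x).deriv]
  exact profileSpeed_nonneg (interior_subset hx)

lemma sq_profileSpeed (hμ : 0 < μ) (hs : 0 ≤ s) (hs1 : s ≤ 1) :
    profileSpeed μ s ^ 2 = s ^ 2 - s ^ (2 * μ + 2) := by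
  rw [profileSpeed, mul_pow, Real.sq_sqrt (sub_nonneg.2 (Real.rpow_le_one hs hs1 (by positivity))),
    rpow_two_mul_add_two hs hμ]
  ring

end Profile

namespace HalfLineH1

variable {v g : ℝ → ℂ} {μ ω A t : ℝ}

lemma sq_norm_add_sq_profileSpeed (hμ : 0 < μ) (hω : 0 < ω) (ht : 0 ≤ t) {a b : ℂ}
    (hb : t * ‖b‖ ≤ 1) :
    ‖t • a‖ ^ 2 + (√ω * profileSpeed μ ‖t • b‖) ^ 2 =
      t ^ 2 * ‖a‖ ^ 2 + ω * (t ^ 2 * ‖b‖ ^ 2 - t ^ (2 * μ + 2) * ‖b‖ ^ (2 * μ + 2)) := by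
  rw [norm_smul, norm_smul, Real.norm_of_nonneg ht, mul_pow, mul_pow, Real.sq_sqrt hω.le,
    sq_profileSpeed hμ (by positivity) hb, Real.mul_rpow ht (norm_nonneg _), mul_pow]

lemma integrableOn_energyDensity (h : HalfLineH1 v g) (hμ : 0 < μ) (ω t : ℝ) :
    IntegrableOn (fun x => t ^ 2 * ‖g x‖ ^ 2 +
      ω * (t ^ 2 * ‖v x‖ ^ 2 - t ^ (2 * μ + 2) * ‖v x‖ ^ (2 * μ + 2))) (Ioi 0) :=
  (h.integrableOn_deriv_sq.const_mul (t ^ 2)).add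
    (((h.integrableOn_sq.const_mul (t ^ 2)).sub
      ((h.integrableOn_rpow hμ).const_mul (t ^ (2 * μ + 2)))).const_mul ω)

lemma integral_energyDensity (h : HalfLineH1 v g) (hμ : 0 < μ) (ω t : ℝ) :
    ∫ x in Ioi 0, (t ^ 2 * ‖g x‖ ^ 2 +
        ω * (t ^ 2 * ‖v x‖ ^ 2 - t ^ (2 * μ + 2) * ‖v x‖ ^ (2 * μ + 2))) =
      t ^ 2 * (∫ x in Ioi 0, ‖g x‖ ^ 2) + ω * (t ^ 2 * (∫ x in Ioi 0, ‖v x‖ ^ 2) -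
        t ^ (2 * μ + 2) * ∫ x in Ioi 0, ‖v x‖ ^ (2 * μ + 2)) := by
  have hsq := h.integrableOn_sq.const_mul (t ^ 2)
  have hpow := (h.integrableOn_rpow hμ).const_mul (t ^ (2 * μ + 2))
  have hdiff : IntegrableOn (fun x => t ^ 2 * ‖v x‖ ^ 2 -
      t ^ (2 * μ + 2) * ‖v x‖ ^ (2 * μ + 2)) (Ioi 0) := hsq.sub hpow
  rw [integral_add (h.integrableOn_deriv_sq.const_mul (t ^ 2)) (hdiff.const_mul ω),
    integral_const_mul, integral_const_mul, integral_sub hsq hpow, integral_const_mul,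
    integral_const_mul]

lemma le_energy (h : HalfLineH1 v g) (hμ : 0 < μ) (hω : 0 < ω)
    (hA : IsLUB ((fun x => ‖v x‖) '' Ici 0) A) (ht : 0 ≤ t) (htA : t * A ≤ 1) :
    2 * √ω * (2 * profileAction μ (t * A) - profileAction μ (t * ‖v 0‖)) ≤
      t ^ 2 * (∫ x in Ioi 0, ‖g x‖ ^ 2) + ω * (t ^ 2 * (∫ x in Ioi 0, ‖v x‖ ^ 2) -
        t ^ (2 * μ + 2) * ∫ x in Ioi 0, ‖v x‖ ^ (2 * μ + 2)) := by
  have hdens : EqOn (fun x => ‖t • g x‖ ^ 2 + (√ω * profileSpeed μ ‖t • v x‖) ^ 2)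
      (fun x => t ^ 2 * ‖g x‖ ^ 2 +
        ω * (t ^ 2 * ‖v x‖ ^ 2 - t ^ (2 * μ + 2) * ‖v x‖ ^ (2 * μ + 2))) (Ioi 0) := fun x hx =>
    sq_norm_add_sq_profileSpeed hμ hω ht
      ((mul_le_mul_of_nonneg_left (norm_le_of_isLUB hA (le_of_lt hx)) ht).trans htA)
  have hbound : ∀ x, 0 ≤ x →
      2 * √ω * (2 * profileAction μ (t * ‖v x‖) - profileAction μ (t * ‖v 0‖)) ≤
        ∫ x in Ioi 0, (‖t • g x‖ ^ 2 + (√ω * profileSpeed μ ‖t • v x‖) ^ 2) := fun x hx => by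
    have := (h.smul t).two_mul_sub_le (F := fun s => √ω * profileSpeed μ s)
      (continuous_const.mul (continuous_profileSpeed hμ))
      ((integrableOn_congr_fun hdens measurableSet_Ioi).2 (h.integrableOn_energyDensity hμ ω t)) hx
    simp only [intervalIntegral.integral_const_mul, norm_smul, Real.norm_of_nonneg ht] at this ⊢
    simp only [profileAction]
    linarith
  obtain ⟨u, -, -, hu, humem⟩ := hA.exists_seq_monotone_tendsto
    ⟨_, mem_image_of_mem _ (self_mem_Ici (a := (0 : ℝ)))⟩
  have hcont : Continuous fun a =>
      2 * √ω * (2 * profileAction μ (t * a) - profileAction μ (t * ‖v 0‖)) := by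
    have := continuous_profileAction hμ
    fun_prop
  rw [← h.integral_energyDensity hμ, ← setIntegral_congr_fun measurableSet_Ioi hdens]
  refine le_of_tendsto' ((hcont.tendsto A).comp hu) fun n => ?_
  obtain ⟨x, hx, hxu⟩ := humem n
  rw [Function.comp_apply, ← hxu]
  exact hbound x hx

end HalfLineH1

/-! ### The lower bound on the Nehari manifold -/

lemma integral_eq_add_comp_neg {f : ℝ → ℝ} (hf : IntegrableOn f (Ioi 0))
    (hf' : IntegrableOn (fun x => f (-x)) (Ioi 0)) :
    ∫ x, f x = (∫ x in Ioi 0, f x) + ∫ x in Ioi 0, f (-x) := by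
  have hneg : IntegrableOn f (Iic 0) :=
    (integrableOn_Iic_iff_integrableOn_Iio (by simp)).2 <|
      ((Measure.measurePreserving_neg (volume : Measure ℝ)).integrableOn_comp_preimage
        (Homeomorph.neg ℝ).measurableEmbedding (s := Iio 0)).1
          (by simpa [Function.comp_def] using hf')
  rw [integral_comp_neg_Ioi, neg_zero, add_comm, intervalIntegral.integral_Iic_add_Ioi hneg hf]

lemma integral_comp_eq_add {f : ℂ → ℝ} {u v w : ℝ → ℂ}
    (hv : v =ᵐ[volume.restrict (Ioi 0)] u)
    (hw : w =ᵐ[volume.restrict (Ioi 0)] fun x => u (-x))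
    (hfv : IntegrableOn (fun x => f (v x)) (Ioi 0))
    (hfw : IntegrableOn (fun x => f (w x)) (Ioi 0)) :
    ∫ x, f (u x) = (∫ x in Ioi 0, f (v x)) + ∫ x in Ioi 0, f (w x) := by
  have hv' : (fun x => f (v x)) =ᵐ[volume.restrict (Ioi 0)] fun x => f (u x) := hv.fun_comp f
  have hw' : (fun x => f (w x)) =ᵐ[volume.restrict (Ioi 0)] fun x => f (u (-x)) := hw.fun_comp f
  rw [integral_eq_add_comp_neg (hfv.congr hv') (hfw.congr hw')]
  exact congrArg₂ _ (integral_congr_ae hv').symm (integral_congr_ae hw').symm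

/-- `v` and `w` represent the right half of `ψ` and the reflection of its left half, with
derivatives `v'` and `w'`, as functions on `[0, ∞)`. -/
structure EnergySpace.HasHalves (ψ : EnergySpace) (v v' w w' : ℝ → ℂ) : Prop where
  right : v =ᵐ[volume.restrict (Ioi 0)] ψ.toFun
  deriv_right : v' =ᵐ[volume.restrict (Ioi 0)] ψ.weakDeriv
  left : w =ᵐ[volume.restrict (Ioi 0)] fun x => ψ.toFun (-x)
  deriv_left : w' =ᵐ[volume.restrict (Ioi 0)] fun x => -ψ.weakDeriv (-x)
  val_right : v 0 = ψ.valRight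
  val_left : w 0 = ψ.valLeft

lemma EnergySpace.exists_hasHalves (ψ : EnergySpace) :
    ∃ v v' w w', HalfLineH1 v v' ∧ HalfLineH1 w w' ∧ ψ.HasHalves v v' w w' := by
  obtain ⟨v, hv, hvψ, hv0⟩ := ψ.isH1_right.exists_halfLineH1 ψ.isRightTrace
  obtain ⟨w, hw, hwψ, hw0⟩ :=
    (by simpa using ψ.isH1_left.comp_neg : IsH1On (Ioi 0) _ _).exists_halfLineH1
      ψ.isLeftTrace.comp_neg
  exact ⟨v, _, w, _, hv, hw, hvψ, .rfl, hwψ, .rfl, hv0, hw0⟩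

namespace EnergySpace.HasHalves

variable {ψ : EnergySpace} {v v' w w' : ℝ → ℂ}

lemma integral_comp (h : ψ.HasHalves v v' w w') {f : ℂ → ℝ}
    (hv : IntegrableOn (fun x => f (v x)) (Ioi 0))
    (hw : IntegrableOn (fun x => f (w x)) (Ioi 0)) :
    ∫ x, f (ψ.toFun x) = (∫ x in Ioi 0, f (v x)) + ∫ x in Ioi 0, f (w x) :=
  integral_comp_eq_add h.right h.left hv hw

lemma integral_sq_norm_deriv (h : ψ.HasHalves v v' w w')
    (hv : IntegrableOn (fun x => ‖v' x‖ ^ 2) (Ioi 0))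
    (hw : IntegrableOn (fun x => ‖w' x‖ ^ 2) (Ioi 0)) :
    ∫ x, ‖ψ.weakDeriv x‖ ^ 2 = (∫ x in Ioi 0, ‖v' x‖ ^ 2) + ∫ x in Ioi 0, ‖w' x‖ ^ 2 := by
  have hleft : (fun x => -w' x) =ᵐ[volume.restrict (Ioi 0)] fun x => ψ.weakDeriv (-x) := by
    filter_upwards [h.deriv_left] with x hx
    rw [hx, neg_neg]
  simpa only [norm_neg] using integral_comp_eq_add (f := fun z => ‖z‖ ^ 2) h.deriv_right hleft hv
    (by simpa only [norm_neg] using hw)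

lemma ae_eq_zero (h : ψ.HasHalves v v' w w') (hv : EqOn v 0 (Ioi 0)) (hw : EqOn w 0 (Ioi 0)) :
    ψ.toFun =ᵐ[volume] 0 := by
  have hzero {u : ℝ → ℂ} (hu : EqOn u 0 (Ioi 0)) : 0 =ᵐ[volume.restrict (Ioi 0)] u :=
    (ae_restrict_mem measurableSet_Ioi).mono fun x hx => (hu hx).symm
  have hleft : (fun x => ψ.toFun x) =ᵐ[volume.restrict (Iio 0)] fun _ => 0 := by
    simpa only [neg_neg, Pi.zero_apply] using (ae_eq_comp_neg_Ioi ((hzero hw).trans h.left)).symm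
  have hunion := (ae_restrict_union_iff _ _ _).2 ⟨hleft, ((hzero hv).trans h.right).symm⟩
  rwa [Iio_union_Ioi, restrict_compl_singleton] at hunion

lemma reducedAction_le (h : ψ.HasHalves v v' w w') (hv : HalfLineH1 v v') (hw : HalfLineH1 w w')
    {γ μ ω A B t : ℝ} (hγ : 0 < γ) (hμ : 0 < μ) (hω : 0 < ω)
    (hA : IsLUB ((fun x => ‖v x‖) '' Ici 0) A) (hB : IsLUB ((fun x => ‖w x‖) '' Ici 0) B)
    (ht : 0 ≤ t) (htA : t * A ≤ 1) (htB : t * B ≤ 1) :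
    2 * √ω * reducedAction μ (γ * √ω) (t * A) (t * B) ≤
      t ^ 2 * ((∫ x, ‖ψ.weakDeriv x‖ ^ 2) + ω * (∫ x, ‖ψ.toFun x‖ ^ 2) -
        1 / γ * ‖ψ.valRight - ψ.valLeft‖ ^ 2) -
      t ^ (2 * μ + 2) * (ω * ∫ x, ‖ψ.toFun x‖ ^ (2 * μ + 2)) := by
  have hmono {u : ℝ → ℂ} {C : ℝ} (hC : IsLUB ((fun x => ‖u x‖) '' Ici 0) C) :
      profileAction μ (t * ‖u 0‖) ≤ profileAction μ (t * C) := by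
    have hle : t * ‖u 0‖ ≤ t * C := mul_le_mul_of_nonneg_left (norm_le_of_isLUB hC le_rfl) ht
    have hnonneg : 0 ≤ t * ‖u 0‖ := by positivity
    exact monotoneOn_profileAction hμ hnonneg (hnonneg.trans hle) hle
  have hjump : ‖ψ.valRight - ψ.valLeft‖ ≤ A + B := by
    rw [← h.val_right, ← h.val_left]
    exact (norm_sub_le _ _).trans (add_le_add (norm_le_of_isLUB hA le_rfl)
      (norm_le_of_isLUB hB le_rfl))
  have hjump_sq : t ^ 2 * (1 / γ * ‖ψ.valRight - ψ.valLeft‖ ^ 2) ≤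
      2 * √ω * ((t * A + t * B) ^ 2 / (2 * (γ * √ω))) := by
    calc t ^ 2 * (1 / γ * ‖ψ.valRight - ψ.valLeft‖ ^ 2) ≤ t ^ 2 * (1 / γ * (A + B) ^ 2) := by
          gcongr
      _ = _ := by
          have := Real.sqrt_pos.2 hω
          field_simp
  have henergy_right := hv.le_energy hμ hω hA ht htA
  have henergy_left := hw.le_energy hμ hω hB ht htB
  have hmul_right := mul_le_mul_of_nonneg_left (hmono hA) (Real.sqrt_nonneg ω)
  have hmul_left := mul_le_mul_of_nonneg_left (hmono hB) (Real.sqrt_nonneg ω)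
  rw [h.integral_sq_norm_deriv hv.integrableOn_deriv_sq hw.integrableOn_deriv_sq,
    h.integral_comp (f := fun z => ‖z‖ ^ 2) hv.integrableOn_sq hw.integrableOn_sq,
    h.integral_comp (f := fun z => ‖z‖ ^ (2 * μ + 2)) (hv.integrableOn_rpow hμ)
      (hw.integrableOn_rpow hμ), reducedAction]
  linarith

end EnergySpace.HasHalves

section Amplitude

variable {lam μ ω : ℝ}

/-- The amplitude `((μ+1)ω/λ)^{1/(2μ)}` of the soliton on the line. -/
noncomputable def amplitude (lam μ ω : ℝ) : ℝ := ((μ + 1) * ω / lam) ^ (1 / (2 * μ))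

lemma amplitude_pos (hlam : 0 < lam) (hμ : 0 < μ) (hω : 0 < ω) : 0 < amplitude lam μ ω := by
  unfold amplitude
  positivity

lemma amplitude_rpow (hlam : 0 < lam) (hμ : 0 < μ) (hω : 0 < ω) :
    lam * amplitude lam μ ω ^ (2 * μ) = (μ + 1) * ω := by
  rw [amplitude, ← Real.rpow_mul (by positivity), one_div_mul_cancel (by positivity),
    Real.rpow_one]
  field_simp

lemma sq_half_sub_rpow_le {θ : ℝ} (hμ : 0 < μ) (hθ : 0 ≤ θ) :
    θ ^ 2 / 2 - θ ^ (2 * μ + 2) / (2 * μ + 2) ≤ 1 / 2 - 1 / (2 * μ + 2) := by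
  have hbernoulli := one_add_mul_self_le_rpow_one_add (s := θ ^ 2 - 1)
    (by linarith [sq_nonneg θ]) (p := μ + 1) (by linarith)
  rw [add_sub_cancel, ← Real.rpow_two, ← Real.rpow_mul hθ, Real.rpow_two,
    show (2 : ℝ) * (μ + 1) = 2 * μ + 2 by ring] at hbernoulli
  rw [← sub_nonneg, show 1 / 2 - 1 / (2 * μ + 2) - (θ ^ 2 / 2 - θ ^ (2 * μ + 2) / (2 * μ + 2)) =
      (θ ^ (2 * μ + 2) - (1 + (μ + 1) * (θ ^ 2 - 1))) / (2 * μ + 2) by field_simp; ring]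
  exact div_nonneg (by linarith) (by positivity)

lemma amplitude_sq_mul_le {t P : ℝ} (hlam : 0 < lam) (hμ : 0 < μ) (hω : 0 < ω) (ht : 0 ≤ t)
    (hP : 0 ≤ P) :
    amplitude lam μ ω ^ 2 * (t ^ 2 * (lam * P) - t ^ (2 * μ + 2) * (ω * P)) ≤
      2 * ((1 / 2 - 1 / (2 * μ + 2)) * (lam * P)) := by
  have hm := amplitude_pos hlam hμ hω
  have hbound := mul_le_mul_of_nonneg_left (sq_half_sub_rpow_le hμ (mul_nonneg ht hm.le))
    (mul_nonneg hlam.le hP)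
  have hexpand : lam * P * ((t * amplitude lam μ ω) ^ (2 * μ + 2) / (2 * μ + 2)) =
      amplitude lam μ ω ^ 2 * (t ^ (2 * μ + 2) * (ω * P)) / 2 := by
    rw [Real.mul_rpow ht hm.le, rpow_two_mul_add_two hm.le hμ]
    calc _ = lam * amplitude lam μ ω ^ (2 * μ) *
          (P * t ^ (2 * μ + 2) * amplitude lam μ ω ^ 2) / (2 * μ + 2) := by ring
      _ = _ := by
          rw [amplitude_rpow hlam hμ hω]
          field_simp
  rw [mul_sub, hexpand] at hbound
  linarith

lemma action_eq_of_nehari_eq_zero {γ : ℝ} {ψ : EnergySpace} (hN : nehari γ lam μ ω ψ = 0) :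
    action γ lam μ ω ψ =
      (1 / 2 - 1 / (2 * μ + 2)) * (lam * ∫ x, ‖ψ.toFun x‖ ^ (2 * μ + 2)) := by
  rw [nehari] at hN
  rw [action, ← div_div]
  linear_combination hN / 2

end Amplitude

lemma exists_reducedAction_le_action {γ lam μ ω : ℝ} (hγ : 0 < γ) (hlam : 0 < lam) (hμ : 0 < μ)
    (hω : 0 < ω) (ψ : EnergySpace) (hne : ¬ ψ.toFun =ᵐ[volume] 0)
    (hN : nehari γ lam μ ω ψ = 0) :
    ∃ A B : ℝ, 0 ≤ A ∧ 0 ≤ B ∧ 0 < max A B ∧ ∀ t, 0 ≤ t → t * A ≤ 1 → t * B ≤ 1 →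
      √ω * amplitude lam μ ω ^ 2 * reducedAction μ (γ * √ω) (t * A) (t * B) ≤
        action γ lam μ ω ψ := by
  obtain ⟨v, v', w, w', hv, hw, hψ⟩ := ψ.exists_hasHalves
  obtain ⟨A, hA⟩ := hv.exists_isLUB
  obtain ⟨B, hB⟩ := hw.exists_isLUB
  have hnonneg {u : ℝ → ℂ} {C : ℝ} (hC : IsLUB ((fun x => ‖u x‖) '' Ici 0) C) : 0 ≤ C :=
    (norm_nonneg (u 0)).trans (norm_le_of_isLUB hC le_rfl)
  have hzero {u : ℝ → ℂ} {C : ℝ} (hC : IsLUB ((fun x => ‖u x‖) '' Ici 0) C) (hC0 : C ≤ 0) :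
      EqOn u 0 (Ioi 0) := fun x hx =>
    norm_le_zero_iff.1 ((norm_le_of_isLUB hC (le_of_lt hx)).trans hC0)
  refine ⟨A, B, hnonneg hA, hnonneg hB, ?_, fun t ht htA htB => ?_⟩
  · by_contra hmax
    obtain ⟨hA0, hB0⟩ := max_le_iff.1 (not_lt.1 hmax)
    exact hne (hψ.ae_eq_zero (hzero hA hA0) (hzero hB hB0))
  · have hP : 0 ≤ ∫ x, ‖ψ.toFun x‖ ^ (2 * μ + 2) := integral_nonneg fun x => by positivity
    have hreduced := mul_le_mul_of_nonneg_left
      (hψ.reducedAction_le hv hw hγ hμ hω hA hB ht htA htB) (sq_nonneg (amplitude lam μ ω))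
    have hamp := amplitude_sq_mul_le hlam hμ hω ht hP
    rw [action_eq_of_nehari_eq_zero hN]
    rw [nehari, sub_eq_zero] at hN
    rw [hN] at hreduced
    linarith

/-! ### Explicit stationary states -/

section Soliton

variable {μ κ c s x : ℝ}

lemma hasDerivAt_tanh (x : ℝ) : HasDerivAt Real.tanh (1 - Real.tanh x ^ 2) x := by
  have hcosh := (Real.cosh_pos x).ne'
  rw [funext Real.tanh_eq_sinh_div_cosh]
  refine ((Real.hasDerivAt_sinh x).div (Real.hasDerivAt_cosh x) hcosh).congr_deriv ?_
  field_simp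

lemma tanh_pos (hx : 0 < x) : 0 < Real.tanh x := by
  rw [Real.tanh_eq_sinh_div_cosh]
  exact div_pos (Real.sinh_pos_iff.2 hx) (Real.cosh_pos x)

/-- The soliton of amplitude one at frequency `κ ^ 2`, with its phase shifted by `c`. -/
noncomputable def soliton (μ κ c s : ℝ) : ℝ := Real.cosh (c + μ * κ * s) ^ (-(1 / μ))

/-- The derivative of `soliton μ κ c`. -/
noncomputable def solitonDeriv (μ κ c s : ℝ) : ℝ :=
  -(κ * Real.tanh (c + μ * κ * s) * soliton μ κ c s)

lemma soliton_pos (μ κ c s : ℝ) : 0 < soliton μ κ c s := Real.rpow_pos_of_pos (Real.cosh_pos _) _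

lemma hasDerivAt_phase (μ κ c s : ℝ) : HasDerivAt (fun s => c + μ * κ * s) (μ * κ) s := by
  simpa using ((hasDerivAt_id s).const_mul (μ * κ)).const_add c

lemma hasDerivAt_soliton (hμ : μ ≠ 0) (κ c s : ℝ) :
    HasDerivAt (soliton μ κ c) (solitonDeriv μ κ c s) s := by
  have hcosh := (Real.cosh_pos (c + μ * κ * s)).ne'
  refine ((hasDerivAt_phase μ κ c s).cosh.rpow_const (Or.inl hcosh)).congr_deriv ?_
  rw [Real.rpow_sub_one hcosh, solitonDeriv, soliton, Real.tanh_eq_sinh_div_cosh]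
  field_simp

lemma hasDerivAt_solitonDeriv (hμ : μ ≠ 0) (κ c s : ℝ) :
    HasDerivAt (solitonDeriv μ κ c)
      (κ ^ 2 * (1 - (μ + 1) * (1 - Real.tanh (c + μ * κ * s) ^ 2)) * soliton μ κ c s) s := by
  have htanh := (hasDerivAt_tanh (c + μ * κ * s)).comp s (hasDerivAt_phase μ κ c s)
  refine ((htanh.const_mul κ).mul (hasDerivAt_soliton hμ κ c s)).neg.congr_deriv ?_
  simp only [Function.comp_apply, solitonDeriv]
  ring

lemma continuous_soliton (hμ : μ ≠ 0) (κ c : ℝ) : Continuous (soliton μ κ c) :=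
  continuous_iff_continuousAt.2 fun s => (hasDerivAt_soliton hμ κ c s).continuousAt

lemma continuous_solitonDeriv (hμ : μ ≠ 0) (κ c : ℝ) : Continuous (solitonDeriv μ κ c) :=
  continuous_iff_continuousAt.2 fun s => (hasDerivAt_solitonDeriv hμ κ c s).continuousAt

lemma soliton_rpow_two_mul (hμ : μ ≠ 0) (κ c s : ℝ) :
    soliton μ κ c s ^ (2 * μ) = 1 - Real.tanh (c + μ * κ * s) ^ 2 := by
  have hcosh := Real.cosh_pos (c + μ * κ * s)
  rw [soliton, ← Real.rpow_mul hcosh.le, show -(1 / μ) * (2 * μ) = -2 by field_simp,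
    Real.rpow_neg hcosh.le, Real.rpow_two, Real.tanh_eq_sinh_div_cosh, div_pow, Real.sinh_sq]
  field_simp
  ring

lemma soliton_rpow_two_mul_add_two (hμ : 0 < μ) (κ c s : ℝ) :
    soliton μ κ c s ^ (2 * μ + 2) =
      (1 - Real.tanh (c + μ * κ * s) ^ 2) * soliton μ κ c s ^ 2 := by
  rw [rpow_two_mul_add_two (soliton_pos μ κ c s).le hμ, soliton_rpow_two_mul hμ.ne']

lemma profileSpeed_soliton (hμ : 0 < μ) (hκ : 0 ≤ κ) (hc : 0 < c) (hs : 0 ≤ s) :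
    profileSpeed μ (soliton μ κ c s) = Real.tanh (c + μ * κ * s) * soliton μ κ c s := by
  rw [profileSpeed, soliton_rpow_two_mul hμ.ne', sub_sub_cancel,
    Real.sqrt_sq (tanh_pos (by positivity)).le, mul_comm]

lemma exists_soliton_zero_eq (hμ : 0 < μ) (κ : ℝ) (hx : 0 < x) (hx1 : x < 1) :
    ∃ c, 0 < c ∧ soliton μ κ c 0 = x := by
  have hxμ : 1 < x ^ (-μ) := Real.one_lt_rpow_of_pos_of_lt_one_of_neg hx hx1 (by linarith)
  refine ⟨Real.arcosh (x ^ (-μ)), Real.arcosh_pos hxμ, ?_⟩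
  rw [soliton, mul_zero, add_zero, Real.cosh_arcosh hxμ.le, ← Real.rpow_mul hx.le,
    show -μ * -(1 / μ) = 1 by field_simp, Real.rpow_one]

lemma soliton_le (hμ : 0 < μ) (κ c s : ℝ) :
    soliton μ κ c s ≤ 2 ^ (1 / μ) * Real.exp (-(c / μ)) * Real.exp (-κ * s) := by
  calc soliton μ κ c s ≤ (Real.exp (c + μ * κ * s) / 2) ^ (-(1 / μ)) := by
        refine Real.rpow_le_rpow_of_nonpos (by positivity) ?_ (by simpa using hμ.le)
        rw [Real.cosh_eq]
        linarith [Real.exp_pos (-(c + μ * κ * s))]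
    _ = _ := by
        rw [Real.div_rpow (Real.exp_pos _).le two_pos.le, ← Real.exp_mul,
          Real.rpow_neg two_pos.le, div_inv_eq_mul, mul_comm,
          mul_assoc (2 ^ (1 / μ)), ← Real.exp_add]
        congr 2
        field_simp
        ring

lemma tendsto_soliton (hμ : 0 < μ) (hκ : 0 < κ) (c : ℝ) :
    Tendsto (soliton μ κ c) atTop (𝓝 0) := by
  have hexp : Tendsto (fun s => Real.exp (-κ * s)) atTop (𝓝 0) :=
    Real.tendsto_exp_atBot.comp (tendsto_id.const_mul_atTop_of_neg (neg_neg_of_pos hκ))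
  exact squeeze_zero (fun s => (soliton_pos μ κ c s).le) (soliton_le hμ κ c)
    (by simpa only [mul_zero] using hexp.const_mul (2 ^ (1 / μ) * Real.exp (-(c / μ))))

lemma integrableOn_soliton_sq (hμ : 0 < μ) (hκ : 0 < κ) (c : ℝ) :
    IntegrableOn (fun s => soliton μ κ c s ^ 2) (Ioi 0) := by
  refine Integrable.mono' ((exp_neg_integrableOn_Ioi 0 (mul_pos two_pos hκ)).const_mul
    ((2 ^ (1 / μ) * Real.exp (-(c / μ))) ^ 2))
    ((continuous_soliton hμ.ne' κ c).pow 2).aestronglyMeasurable (.of_forall fun s => ?_)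
  rw [Real.norm_of_nonneg (sq_nonneg _)]
  refine (pow_le_pow_left₀ (soliton_pos μ κ c s).le (soliton_le hμ κ c s) 2).trans_eq ?_
  rw [mul_pow, ← Real.exp_nat_mul]
  congr 2
  push_cast
  ring

lemma integrableOn_solitonDeriv_sq (hμ : 0 < μ) (hκ : 0 < κ) (c : ℝ) :
    IntegrableOn (fun s => solitonDeriv μ κ c s ^ 2) (Ioi 0) := by
  refine Integrable.mono' ((integrableOn_soliton_sq hμ hκ c).const_mul (κ ^ 2))
    ((continuous_solitonDeriv hμ.ne' κ c).pow 2).aestronglyMeasurable (.of_forall fun s => ?_)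
  rw [Real.norm_of_nonneg (sq_nonneg _), solitonDeriv, neg_sq, mul_pow, mul_pow]
  gcongr
  exact mul_le_of_le_one_right (sq_nonneg κ) (Real.tanh_sq_lt_one _).le

lemma integrableOn_soliton_rpow (hμ : 0 < μ) (hκ : 0 < κ) (c : ℝ) :
    IntegrableOn (fun s => soliton μ κ c s ^ (2 * μ + 2)) (Ioi 0) := by
  refine Integrable.mono' (integrableOn_soliton_sq hμ hκ c) ((continuous_soliton hμ.ne' κ
    c).rpow_const fun s => Or.inl (soliton_pos μ κ c s).ne').aestronglyMeasurable
    (.of_forall fun s => ?_)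
  rw [Real.norm_of_nonneg (Real.rpow_nonneg (soliton_pos μ κ c s).le _),
    soliton_rpow_two_mul_add_two hμ]
  exact mul_le_of_le_one_left (sq_nonneg _) (sub_le_self 1 (sq_nonneg _))

lemma integrableOn_soliton_energy (hμ : 0 < μ) (hκ : 0 < κ) (b c : ℝ) :
    IntegrableOn (fun s => solitonDeriv μ κ c s ^ 2 + κ ^ 2 * soliton μ κ c s ^ 2 -
      b * soliton μ κ c s ^ (2 * μ + 2)) (Ioi 0) :=
  ((integrableOn_solitonDeriv_sq hμ hκ c).add
    ((integrableOn_soliton_sq hμ hκ c).const_mul _)).sub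
    ((integrableOn_soliton_rpow hμ hκ c).const_mul b)

lemma integral_soliton_energy (hμ : 0 < μ) (hκ : 0 < κ) (b c : ℝ) :
    ∫ s in Ioi 0, (solitonDeriv μ κ c s ^ 2 + κ ^ 2 * soliton μ κ c s ^ 2 -
        b * soliton μ κ c s ^ (2 * μ + 2)) =
      (∫ s in Ioi 0, solitonDeriv μ κ c s ^ 2) + κ ^ 2 * (∫ s in Ioi 0, soliton μ κ c s ^ 2) -
        b * ∫ s in Ioi 0, soliton μ κ c s ^ (2 * μ + 2) := by
  have hderiv := integrableOn_solitonDeriv_sq hμ hκ c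
  have hsq := (integrableOn_soliton_sq hμ hκ c).const_mul (κ ^ 2)
  have hsum : IntegrableOn (fun s => solitonDeriv μ κ c s ^ 2 + κ ^ 2 * soliton μ κ c s ^ 2)
    (Ioi 0) := hderiv.add hsq
  rw [integral_sub hsum ((integrableOn_soliton_rpow hμ hκ c).const_mul b),
    integral_add hderiv hsq, integral_const_mul, integral_const_mul]

lemma soliton_action_eq (hμ : 0 < μ) (hκ : 0 < κ) (hc : 0 < c) :
    (∫ s in Ioi 0, solitonDeriv μ κ c s ^ 2) + κ ^ 2 * (∫ s in Ioi 0, soliton μ κ c s ^ 2) -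
        κ ^ 2 * (∫ s in Ioi 0, soliton μ κ c s ^ (2 * μ + 2)) =
      2 * κ * profileAction μ (soliton μ κ c 0) := by
  have hprim : Continuous fun x => -(2 * κ) * profileAction μ x :=
    continuous_const.mul (continuous_profileAction hμ)
  have hlim : Tendsto (fun s => -(2 * κ) * profileAction μ (soliton μ κ c s)) atTop (𝓝 0) := by
    simpa [profileAction, Function.comp_def] using (hprim.tendsto 0).comp (tendsto_soliton hμ hκ c)
  rw [← integral_soliton_energy hμ hκ, integral_Ioi_of_hasDerivAt_of_tendsto
    (hprim.comp (continuous_soliton hμ.ne' κ c)).continuousWithinAt (fun s hs => ?_)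
    (integrableOn_soliton_energy hμ hκ _ c) hlim]
  · simp only [Function.comp_apply]
    ring
  · refine (((hasDerivAt_profileAction hμ _).comp s
      (hasDerivAt_soliton hμ.ne' κ c s)).const_mul (-(2 * κ))).congr_deriv ?_
    rw [profileSpeed_soliton hμ hκ.le hc (le_of_lt hs), soliton_rpow_two_mul_add_two hμ,
      solitonDeriv]
    ring

lemma soliton_nehari_eq (hμ : 0 < μ) (hκ : 0 < κ) (hc : 0 < c) :
    (∫ s in Ioi 0, solitonDeriv μ κ c s ^ 2) + κ ^ 2 * (∫ s in Ioi 0, soliton μ κ c s ^ 2) -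
        (μ + 1) * κ ^ 2 * (∫ s in Ioi 0, soliton μ κ c s ^ (2 * μ + 2)) =
      κ * (soliton μ κ c 0 * profileSpeed μ (soliton μ κ c 0)) := by
  have hlim : Tendsto (fun s => soliton μ κ c s * solitonDeriv μ κ c s) atTop (𝓝 0) := by
    have hsq := ((tendsto_soliton hμ hκ c).pow 2).const_mul κ
    rw [zero_pow two_ne_zero, mul_zero] at hsq
    refine squeeze_zero_norm (fun s => ?_) hsq
    rw [solitonDeriv, Real.norm_eq_abs, mul_neg, abs_neg,
      show soliton μ κ c s * (κ * Real.tanh (c + μ * κ * s) * soliton μ κ c s) =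
        κ * soliton μ κ c s ^ 2 * Real.tanh (c + μ * κ * s) by ring, abs_mul,
      abs_of_nonneg (mul_nonneg hκ.le (sq_nonneg _))]
    exact mul_le_of_le_one_right (mul_nonneg hκ.le (sq_nonneg _)) (Real.abs_tanh_lt_one _).le
  rw [← integral_soliton_energy hμ hκ, integral_Ioi_of_hasDerivAt_of_tendsto
    ((continuous_soliton hμ.ne' κ c).mul (continuous_solitonDeriv hμ.ne' κ c)).continuousWithinAt
    (fun s _ => ?_) (integrableOn_soliton_energy hμ hκ _ c) hlim]
  · rw [profileSpeed_soliton hμ hκ.le hc le_rfl, Pi.mul_apply, solitonDeriv]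
    ring
  · refine ((hasDerivAt_soliton hμ.ne' κ c s).mul
      (hasDerivAt_solitonDeriv hμ.ne' κ c s)).congr_deriv ?_
    rw [soliton_rpow_two_mul_add_two hμ]
    ring

end Soliton

lemma isWeakDerivOn_of_hasDerivAt (U : Set ℝ) {u u' : ℝ → ℂ} (hu : ∀ s, HasDerivAt u (u' s) s)
    (hu' : Continuous u') : IsWeakDerivOn U u u' := by
  intro φ hφ hφc hφU
  have huc : Continuous u := continuous_iff_continuousAt.2 fun s => (hu s).continuousAt
  have hφ1 : ContDiff ℝ 1 φ := hφ.of_le (by exact_mod_cast le_top)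
  have hφ' (s : ℝ) : HasDerivAt φ (deriv φ s) s :=
    (hφ1.differentiable one_ne_zero s).hasDerivAt
  have hzero : ∀ s ∉ U, φ s = 0 := fun s hs => by
    contrapose! hs
    exact hφU (subset_tsupport _ hs)
  have hzero' : ∀ s ∉ U, deriv φ s = 0 := fun s hs => by
    contrapose! hs
    exact hφU (support_deriv_subset hs)
  have hinteg : Integrable fun s => φ s • u s :=
    (hφ1.continuous.smul huc).integrable_of_hasCompactSupport hφc.smul_right
  have hint_left : Integrable fun s => deriv φ s • u s :=
    ((hφ1.continuous_deriv le_rfl).smul huc).integrable_of_hasCompactSupport hφc.deriv.smul_right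
  have hint_right : Integrable fun s => φ s • u' s :=
    (hφ1.continuous.smul hu').integrable_of_hasCompactSupport hφc.smul_right
  have htotal := integral_eq_zero_of_hasDerivAt_of_integrable
    (fun s => (hφ' s).smul (hu s)) (hint_right.add hint_left) hinteg
  rw [integral_add hint_right hint_left] at htotal
  rw [setIntegral_eq_integral_of_forall_compl_eq_zero fun s hs => by rw [hzero' s hs, zero_smul],
    setIntegral_eq_integral_of_forall_compl_eq_zero fun s hs => by rw [hzero s hs, zero_smul]]
  linear_combination htotal

lemma IsH1On.congr {U : Set ℝ} {u g u' g' : ℝ → ℂ} (h : IsH1On U u g)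
    (hu : u =ᵐ[volume.restrict U] u') (hg : g =ᵐ[volume.restrict U] g') : IsH1On U u' g' := by
  refine ⟨(memLp_congr_ae hu).1 h.memLp, (memLp_congr_ae hg).1 h.memLp_deriv,
    fun φ hφ hφc hφU => ?_⟩
  have hleft : ∫ s in U, deriv φ s • u' s = ∫ s in U, deriv φ s • u s :=
    integral_congr_ae (hu.mono fun s hs => by simp only [hs])
  have hright : ∫ s in U, φ s • g' s = ∫ s in U, φ s • g s :=
    integral_congr_ae (hg.mono fun s hs => by simp only [hs])
  rw [hleft, hright]
  exact h.isWeakDeriv φ hφ hφc hφU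

namespace EnergySpace

variable {v v' w w' : ℝ → ℂ}

/-- The element of the energy space whose right half is `v` and whose left half is the reflection
of `w`. -/
noncomputable def ofHalves (hv : IsH1On (Ioi 0) v v') (hvc : Continuous v)
    (hw : IsH1On (Ioi 0) w w') (hwc : Continuous w) : EnergySpace where
  toFun s := if 0 < s then v s else w (-s)
  weakDeriv s := if 0 < s then v' s else -w' (-s)
  valRight := v 0
  valLeft := w 0
  isH1_right := hv.congr
    ((ae_restrict_mem measurableSet_Ioi).mono fun _ hs => (if_pos (mem_Ioi.1 hs)).symm)
    ((ae_restrict_mem measurableSet_Ioi).mono fun _ hs => (if_pos (mem_Ioi.1 hs)).symm)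
  isH1_left := (by simpa using hw.comp_neg : IsH1On (Iio 0) _ _).congr
    ((ae_restrict_mem measurableSet_Iio).mono fun _ hs => (if_neg (mem_Iio.1 hs).not_gt).symm)
    ((ae_restrict_mem measurableSet_Iio).mono fun _ hs => (if_neg (mem_Iio.1 hs).not_gt).symm)
  isRightTrace := ⟨v, hvc.continuousOn,
    (ae_restrict_mem measurableSet_Ioi).mono fun _ hs => (if_pos (mem_Ioi.1 hs)).symm, rfl⟩
  isLeftTrace := ⟨fun s => w (-s), (hwc.comp continuous_neg).continuousOn,
    (ae_restrict_mem measurableSet_Iio).mono fun _ hs => (if_neg (mem_Iio.1 hs).not_gt).symm,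
    by simp⟩

lemma hasHalves_ofHalves (hv : IsH1On (Ioi 0) v v') (hvc : Continuous v)
    (hw : IsH1On (Ioi 0) w w') (hwc : Continuous w) :
    (ofHalves hv hvc hw hwc).HasHalves v v' w w' where
  right := (ae_restrict_mem measurableSet_Ioi).mono fun _ hs => (if_pos (mem_Ioi.1 hs)).symm
  deriv_right := (ae_restrict_mem measurableSet_Ioi).mono fun _ hs => (if_pos (mem_Ioi.1 hs)).symm
  left := (ae_restrict_mem measurableSet_Ioi).mono fun s hs => by
    have hs' : ¬ 0 < -s := by linarith [mem_Ioi.1 hs]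
    simp only [ofHalves, if_neg hs', neg_neg]
  deriv_left := (ae_restrict_mem measurableSet_Ioi).mono fun s hs => by
    have hs' : ¬ 0 < -s := by linarith [mem_Ioi.1 hs]
    simp only [ofHalves, if_neg hs', neg_neg]
  val_right := rfl
  val_left := rfl

lemma HasHalves.not_ae_eq_zero {ψ : EnergySpace} (h : ψ.HasHalves v v' w w')
    (hv : ∀ s, v s ≠ 0) : ¬ ψ.toFun =ᵐ[volume] 0 := by
  intro hzero
  have hfalse : ∀ᵐ _ ∂volume.restrict (Ioi (0 : ℝ)), False := by
    filter_upwards [h.right, ae_restrict_of_ae hzero] with s hs hs0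
    exact hv s (hs.trans hs0)
  rw [eventually_false_iff_eq_bot, ae_eq_bot, Measure.restrict_eq_zero, Real.volume_Ioi] at hfalse
  exact ENNReal.top_ne_zero hfalse

end EnergySpace

section Soliton

variable {μ κ : ℝ}

lemma isH1On_soliton (hμ : 0 < μ) (hκ : 0 < κ) (m c : ℝ) :
    IsH1On (Ioi 0) (fun s => ((m * soliton μ κ c s : ℝ) : ℂ))
      (fun s => ((m * solitonDeriv μ κ c s : ℝ) : ℂ)) := by
  have hcont := continuous_soliton hμ.ne' κ c
  have hcont' := continuous_solitonDeriv hμ.ne' κ c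
  have hmemLp {w : ℝ → ℝ} (hw : Continuous w) (hinteg : IntegrableOn (fun s => w s ^ 2) (Ioi 0)) :
      MemLp (fun s => ((m * w s : ℝ) : ℂ)) 2 (volume.restrict (Ioi 0)) := by
    rw [memLp_two_iff_integrable_sq_norm (by fun_prop)]
    simp only [Complex.norm_real, Real.norm_eq_abs, sq_abs, mul_pow]
    exact hinteg.const_mul _
  exact ⟨hmemLp hcont (integrableOn_soliton_sq hμ hκ c),
    hmemLp hcont' (integrableOn_solitonDeriv_sq hμ hκ c), isWeakDerivOn_of_hasDerivAt _
      (fun s => ((hasDerivAt_soliton hμ.ne' κ c s).const_mul m).ofReal_comp) (by fun_prop)⟩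

end Soliton

section SolitonPair

variable {μ κ : ℝ} (hμ : 0 < μ) (hκ : 0 < κ) (m a b : ℝ)

/-- The state with halves `m · soliton μ κ a` on `(0, ∞)` and, reflected,
`-m · soliton μ κ b` on `(-∞, 0)`. -/
noncomputable def solitonPair : EnergySpace :=
  .ofHalves (isH1On_soliton hμ hκ m a) (by have := continuous_soliton hμ.ne' κ a; fun_prop)
    (isH1On_soliton hμ hκ (-m) b) (by have := continuous_soliton hμ.ne' κ b; fun_prop)

lemma hasHalves_solitonPair : (solitonPair hμ hκ m a b).HasHalves
    (fun s => ((m * soliton μ κ a s : ℝ) : ℂ)) (fun s => ((m * solitonDeriv μ κ a s : ℝ) : ℂ))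
    (fun s => ((-m * soliton μ κ b s : ℝ) : ℂ)) (fun s => ((-m * solitonDeriv μ κ b s : ℝ) : ℂ)) :=
  EnergySpace.hasHalves_ofHalves ..

variable {m} in
lemma solitonPair_not_ae_eq_zero (hm : m ≠ 0) :
    ¬ (solitonPair hμ hκ m a b).toFun =ᵐ[volume] 0 :=
  (hasHalves_solitonPair hμ hκ m a b).not_ae_eq_zero fun s =>
    Complex.ofReal_ne_zero.2 (mul_ne_zero hm (soliton_pos μ κ a s).ne')

lemma sq_norm_ofReal_mul (r t : ℝ) : ‖((r * t : ℝ) : ℂ)‖ ^ 2 = r ^ 2 * t ^ 2 := by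
  rw [Complex.norm_real, Real.norm_eq_abs, sq_abs, mul_pow]

lemma integral_sq_norm_deriv_solitonPair :
    ∫ s, ‖(solitonPair hμ hκ m a b).weakDeriv s‖ ^ 2 =
      m ^ 2 * ((∫ s in Ioi 0, solitonDeriv μ κ a s ^ 2) +
        ∫ s in Ioi 0, solitonDeriv μ κ b s ^ 2) := by
  have hright := (integrableOn_solitonDeriv_sq hμ hκ a).const_mul (m ^ 2)
  have hleft := (integrableOn_solitonDeriv_sq hμ hκ b).const_mul ((-m) ^ 2)
  rw [(hasHalves_solitonPair hμ hκ m a b).integral_sq_norm_deriv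
    (by simp only [sq_norm_ofReal_mul]; exact hright)
    (by simp only [sq_norm_ofReal_mul]; exact hleft)]
  simp only [sq_norm_ofReal_mul, neg_sq, integral_const_mul, mul_add]

lemma integral_sq_norm_solitonPair :
    ∫ s, ‖(solitonPair hμ hκ m a b).toFun s‖ ^ 2 =
      m ^ 2 * ((∫ s in Ioi 0, soliton μ κ a s ^ 2) + ∫ s in Ioi 0, soliton μ κ b s ^ 2) := by
  have hright := (integrableOn_soliton_sq hμ hκ a).const_mul (m ^ 2)
  have hleft := (integrableOn_soliton_sq hμ hκ b).const_mul ((-m) ^ 2)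
  rw [(hasHalves_solitonPair hμ hκ m a b).integral_comp (f := fun z => ‖z‖ ^ 2)
    (by simp only [sq_norm_ofReal_mul]; exact hright)
    (by simp only [sq_norm_ofReal_mul]; exact hleft)]
  simp only [sq_norm_ofReal_mul, neg_sq, integral_const_mul, mul_add]

lemma integral_rpow_norm_solitonPair :
    ∫ s, ‖(solitonPair hμ hκ m a b).toFun s‖ ^ (2 * μ + 2) =
      |m| ^ (2 * μ + 2) * ((∫ s in Ioi 0, soliton μ κ a s ^ (2 * μ + 2)) +
        ∫ s in Ioi 0, soliton μ κ b s ^ (2 * μ + 2)) := by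
  have hnorm (r c s : ℝ) : ‖((r * soliton μ κ c s : ℝ) : ℂ)‖ ^ (2 * μ + 2) =
      |r| ^ (2 * μ + 2) * soliton μ κ c s ^ (2 * μ + 2) := by
    rw [Complex.norm_real, Real.norm_eq_abs, abs_mul, abs_of_pos (soliton_pos μ κ c s),
      Real.mul_rpow (abs_nonneg r) (soliton_pos μ κ c s).le]
  have hright := (integrableOn_soliton_rpow hμ hκ a).const_mul (|m| ^ (2 * μ + 2))
  have hleft := (integrableOn_soliton_rpow hμ hκ b).const_mul (|-m| ^ (2 * μ + 2))
  rw [(hasHalves_solitonPair hμ hκ m a b).integral_comp (f := fun z => ‖z‖ ^ (2 * μ + 2))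
    (by simp only [hnorm]; exact hright) (by simp only [hnorm]; exact hleft)]
  simp only [hnorm, abs_neg, integral_const_mul, mul_add]

lemma sq_norm_jump_solitonPair :
    ‖(solitonPair hμ hκ m a b).valRight - (solitonPair hμ hκ m a b).valLeft‖ ^ 2 =
      m ^ 2 * (soliton μ κ a 0 + soliton μ κ b 0) ^ 2 := by
  rw [← (hasHalves_solitonPair hμ hκ m a b).val_right,
    ← (hasHalves_solitonPair hμ hκ m a b).val_left, ← Complex.ofReal_sub,
    ← sq_norm_ofReal_mul]
  ring_nf

end SolitonPair

/-- `x` and `-y` are the boundary values at `0±` of a stationary state, rescaled to amplitude one: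
the one-sided derivatives at `0` agree, and the jump is `-γ` times their common value. Here `k`
stands for `γ √ω`. -/
structure IsCritical (μ k x y : ℝ) : Prop where
  left_mem : x ∈ Ioo (0 : ℝ) 1
  right_mem : y ∈ Ioo (0 : ℝ) 1
  profileSpeed_left : profileSpeed μ x = (x + y) / k
  profileSpeed_right : profileSpeed μ y = (x + y) / k

section IsCritical

variable {γ lam μ κ m a b : ℝ}

lemma nehari_solitonPair (hγ : 0 < γ) (hμ : 0 < μ) (hκ : 0 < κ) (hm : 0 < m) (ha : 0 < a)
    (hb : 0 < b) (hamp : lam * m ^ (2 * μ) = (μ + 1) * κ ^ 2)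
    (h : IsCritical μ (γ * κ) (soliton μ κ a 0) (soliton μ κ b 0)) :
    nehari γ lam μ (κ ^ 2) (solitonPair hμ hκ m a b) = 0 := by
  have hright := soliton_nehari_eq hμ hκ ha
  have hleft := soliton_nehari_eq hμ hκ hb
  rw [h.profileSpeed_left] at hright
  rw [h.profileSpeed_right] at hleft
  have hjump (x y : ℝ) : κ * (x * ((x + y) / (γ * κ))) + κ * (y * ((x + y) / (γ * κ))) =
      1 / γ * (x + y) ^ 2 := by
    field_simp
  rw [nehari, integral_sq_norm_deriv_solitonPair, integral_sq_norm_solitonPair,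
    integral_rpow_norm_solitonPair, sq_norm_jump_solitonPair, abs_of_pos hm,
    rpow_two_mul_add_two hm.le hμ]
  linear_combination m ^ 2 * (hright + hleft + hjump (soliton μ κ a 0) (soliton μ κ b 0)) - m ^ 2 *
    ((∫ s in Ioi 0, soliton μ κ a s ^ (2 * μ + 2)) +
      ∫ s in Ioi 0, soliton μ κ b s ^ (2 * μ + 2)) * hamp

lemma action_solitonPair (hγ : 0 < γ) (hμ : 0 < μ) (hκ : 0 < κ) (hm : 0 < m) (ha : 0 < a)
    (hb : 0 < b) (hamp : lam * m ^ (2 * μ) = (μ + 1) * κ ^ 2) :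
    action γ lam μ (κ ^ 2) (solitonPair hμ hκ m a b) =
      κ * m ^ 2 * reducedAction μ (γ * κ) (soliton μ κ a 0) (soliton μ κ b 0) := by
  have hjump (x : ℝ) : κ * (x ^ 2 / (2 * (γ * κ))) = 1 / (2 * γ) * x ^ 2 := by
    field_simp
  have hpow : lam / (2 * μ + 2) * m ^ (2 * μ) = κ ^ 2 / 2 := by
    rw [div_mul_eq_mul_div, hamp]
    field_simp
  rw [action, reducedAction, integral_sq_norm_deriv_solitonPair, integral_sq_norm_solitonPair,
    integral_rpow_norm_solitonPair, sq_norm_jump_solitonPair, abs_of_pos hm,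
    rpow_two_mul_add_two hm.le hμ]
  linear_combination (m ^ 2 / 2) * (soliton_action_eq hμ hκ ha + soliton_action_eq hμ hκ hb) +
    m ^ 2 * hjump (soliton μ κ a 0 + soliton μ κ b 0) -
    m ^ 2 * ((∫ s in Ioi 0, soliton μ κ a s ^ (2 * μ + 2)) +
      ∫ s in Ioi 0, soliton μ κ b s ^ (2 * μ + 2)) * hpow

lemma IsCritical.exists_state {ω x y : ℝ} (h : IsCritical μ (γ * √ω) x y) (hγ : 0 < γ)
    (hlam : 0 < lam) (hμ : 0 < μ) (hω : 0 < ω) :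
    ∃ ψ : EnergySpace, ¬ ψ.toFun =ᵐ[volume] 0 ∧ nehari γ lam μ ω ψ = 0 ∧
      √ω * amplitude lam μ ω ^ 2 * reducedAction μ (γ * √ω) x y = action γ lam μ ω ψ := by
  have hκ : 0 < √ω := Real.sqrt_pos.2 hω
  obtain ⟨a, ha, rfl⟩ := exists_soliton_zero_eq hμ (√ω) h.left_mem.1 h.left_mem.2
  obtain ⟨b, hb, rfl⟩ := exists_soliton_zero_eq hμ (√ω) h.right_mem.1 h.right_mem.2
  have hm := amplitude_pos hlam hμ hω
  have hamp : lam * amplitude lam μ ω ^ (2 * μ) = (μ + 1) * √ω ^ 2 := by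
    rw [Real.sq_sqrt hω.le, amplitude_rpow hlam hμ hω]
  have hnehari := nehari_solitonPair hγ hμ hκ hm ha hb hamp h
  have haction := action_solitonPair hγ hμ hκ hm ha hb hamp
  rw [Real.sq_sqrt hω.le] at hnehari haction
  exact ⟨_, solitonPair_not_ae_eq_zero hμ hκ a b hm.ne', hnehari, haction.symm⟩

end IsCritical

/-- The reduced action at `(x, y)` is at most its supremum along each ray of the unit square. -/
def IsRayMinimax (μ k x y : ℝ) : Prop :=
  ∀ A B c : ℝ, 0 ≤ A → 0 ≤ B → 0 < max A B →
    (∀ t, 0 ≤ t → t * A ≤ 1 → t * B ≤ 1 → reducedAction μ k (t * A) (t * B) ≤ c) →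
      reducedAction μ k x y ≤ c

lemma groundAction_eq {γ lam μ ω x y : ℝ} (hγ : 0 < γ) (hlam : 0 < lam) (hμ : 0 < μ)
    (hω : 0 < ω) (h : IsCritical μ (γ * √ω) x y) (hmin : IsRayMinimax μ (γ * √ω) x y) :
    groundAction γ lam μ ω = √ω * amplitude lam μ ω ^ 2 * reducedAction μ (γ * √ω) x y := by
  refine IsLeast.csInf_eq ⟨h.exists_state hγ hlam hμ hω, ?_⟩
  rintro s ⟨ψ, hne, hN, rfl⟩
  obtain ⟨A, B, hA, hB, hAB, hle⟩ := exists_reducedAction_le_action hγ hlam hμ hω ψ hne hN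
  have hpos : 0 < √ω * amplitude lam μ ω ^ 2 :=
    mul_pos (Real.sqrt_pos.2 hω) (pow_pos (amplitude_pos hlam hμ hω) 2)
  rw [mul_comm, ← le_div_iff₀ hpos]
  refine hmin A B _ hA hB hAB fun t ht htA htB => ?_
  rw [le_div_iff₀ hpos, mul_comm]
  exact hle t ht htA htB

/-! ### The function `x coth x` and the logarithmic derivative of `sinh` -/

section XCoth

variable {x : ℝ}

/-- The function `x coth x` for `0 < x`; at `0` it takes the junk value `0` rather than `1`. -/
noncomputable def xcoth (x : ℝ) : ℝ := x * Real.cosh x / Real.sinh x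

lemma hasDerivAt_mul_cosh_sub_sinh (x : ℝ) :
    HasDerivAt (fun t => t * Real.cosh t - Real.sinh t) (x * Real.sinh x) x :=
  (((hasDerivAt_id x).mul (Real.hasDerivAt_cosh x)).sub (Real.hasDerivAt_sinh x)).congr_deriv
    (by simp)

lemma sinh_lt_mul_cosh (hx : 0 < x) : Real.sinh x < x * Real.cosh x := by
  have hmono : StrictMonoOn (fun t => t * Real.cosh t - Real.sinh t) (Ici 0) := by
    refine strictMonoOn_of_deriv_pos (convex_Ici 0) (by fun_prop) fun t ht => ?_
    rw [interior_Ici] at ht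
    rw [(hasDerivAt_mul_cosh_sub_sinh t).deriv]
    exact mul_pos ht (Real.sinh_pos_iff.2 ht)
  simpa using hmono (mem_Ici.2 le_rfl) (mem_Ici.2 hx.le) hx

lemma hasDerivAt_xcoth (hx : 0 < x) :
    HasDerivAt xcoth ((Real.cosh x * Real.sinh x - x) / Real.sinh x ^ 2) x := by
  refine (((hasDerivAt_id x).mul (Real.hasDerivAt_cosh x)).div (Real.hasDerivAt_sinh x)
    (Real.sinh_pos_iff.2 hx).ne').congr_deriv ?_
  simp only [id, Pi.mul_apply]
  congr 1
  linear_combination (-x) * Real.cosh_sq x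

lemma hasDerivAt_deriv_xcoth (hx : 0 < x) :
    HasDerivAt (fun x => (Real.cosh x * Real.sinh x - x) / Real.sinh x ^ 2)
      (2 * (x * Real.cosh x - Real.sinh x) / Real.sinh x ^ 3) x := by
  have hs := Real.sinh_pos_iff.2 hx
  refine ((((Real.hasDerivAt_cosh x).mul (Real.hasDerivAt_sinh x)).sub (hasDerivAt_id x)).div
    ((Real.hasDerivAt_sinh x).pow 2) (pow_ne_zero 2 hs.ne')).congr_deriv ?_
  simp only [id, Pi.mul_apply, Pi.sub_apply, Pi.pow_apply]
  field_simp
  simp only [Nat.add_one_sub_one, pow_one, Nat.cast_ofNat]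
  linear_combination (-Real.sinh x ^ 2) * Real.cosh_sq x

lemma continuousOn_xcoth : ContinuousOn xcoth (Ioi 0) := fun _ hx =>
  (hasDerivAt_xcoth hx).continuousAt.continuousWithinAt

lemma strictConvexOn_xcoth : StrictConvexOn ℝ (Ioi 0) xcoth := by
  refine StrictMonoOn.strictConvexOn_of_deriv (convex_Ioi 0) continuousOn_xcoth ?_
  rw [interior_Ioi]
  refine StrictMonoOn.congr (strictMonoOn_of_deriv_pos (convex_Ioi 0)
    (fun x hx => (hasDerivAt_deriv_xcoth hx).continuousAt.continuousWithinAt) fun x hx => ?_)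
    fun x hx => (hasDerivAt_xcoth hx).deriv.symm
  rw [interior_Ioi] at hx
  rw [(hasDerivAt_deriv_xcoth hx).deriv]
  exact div_pos (mul_pos two_pos (sub_pos.2 (sinh_lt_mul_cosh hx)))
    (pow_pos (Real.sinh_pos_iff.2 hx) 3)

lemma strictMonoOn_xcoth : StrictMonoOn xcoth (Ioi 0) := by
  refine strictMonoOn_of_deriv_pos (convex_Ioi 0) continuousOn_xcoth fun x hx => ?_
  rw [interior_Ioi] at hx
  have hs := Real.sinh_pos_iff.2 hx
  rw [(hasDerivAt_xcoth hx).deriv]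
  refine div_pos (sub_pos.2 ?_) (pow_pos hs 2)
  exact (Real.self_lt_sinh_iff.2 hx).trans_le
    (le_mul_of_one_le_left hs.le (Real.one_le_cosh x))

lemma cosh_mul_sinh_sub_le_sinh_sq (x : ℝ) :
    Real.cosh x * Real.sinh x - x ≤ Real.sinh x ^ 2 := by
  have hexp := Real.add_one_le_exp (-(2 * x))
  have hsplit : Real.exp (-(2 * x)) = Real.exp (-x) ^ 2 := by
    rw [← Real.exp_nat_mul]
    ring_nf
  have hinv : Real.exp x * Real.exp (-x) = 1 := by
    rw [← Real.exp_add, add_neg_cancel, Real.exp_zero]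
  rw [Real.cosh_eq, Real.sinh_eq]
  linarith [show (Real.exp x + Real.exp (-x)) / 2 * ((Real.exp x - Real.exp (-x)) / 2) =
    ((Real.exp x - Real.exp (-x)) / 2) ^ 2 +
      (Real.exp x * Real.exp (-x) - Real.exp (-x) ^ 2) / 2 by ring]

lemma antitoneOn_xcoth_sub : AntitoneOn (fun x => xcoth x - x) (Ioi 0) := by
  have hderiv {x : ℝ} (hx : 0 < x) : HasDerivAt (fun x => xcoth x - x)
      ((Real.cosh x * Real.sinh x - x) / Real.sinh x ^ 2 - 1) x :=
    (hasDerivAt_xcoth hx).sub (hasDerivAt_id x)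
  refine antitoneOn_of_deriv_nonpos (convex_Ioi 0)
    (fun x hx => (hderiv hx).continuousAt.continuousWithinAt) (fun x hx => ?_) fun x hx => ?_
  · rw [interior_Ioi] at hx
    exact (hderiv hx).differentiableAt.differentiableWithinAt
  · rw [interior_Ioi] at hx
    rw [(hderiv hx).deriv, sub_nonpos, div_le_one (pow_pos (Real.sinh_pos_iff.2 hx) 2)]
    exact cosh_mul_sinh_sub_le_sinh_sq x

lemma tendsto_mul_nhdsGT_zero {m : ℝ} (hm : 0 < m) :
    Tendsto (fun z => m * z) (𝓝[>] 0) (𝓝[>] 0) := by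
  refine tendsto_nhdsWithin_iff.2 ⟨?_, ?_⟩
  · simpa using ((continuous_const_mul m).tendsto 0).mono_left nhdsWithin_le_nhds
  · filter_upwards [self_mem_nhdsWithin] with z hz using mul_pos hm hz

lemma tendsto_sinh_mul_div (m : ℝ) :
    Tendsto (fun z => Real.sinh (m * z) / z) (𝓝[>] 0) (𝓝 m) := by
  have hderiv : HasDerivAt (fun z => Real.sinh (m * z)) m 0 :=
    ((Real.hasDerivAt_sinh (m * 0)).comp 0 ((hasDerivAt_id 0).const_mul m)).congr_deriv (by simp)
  refine (hderiv.tendsto_slope.mono_left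
    (nhdsWithin_mono _ fun z (hz : 0 < z) => hz.ne')).congr fun z => ?_
  simp [slope_def_field]

lemma tendsto_mul_cosh_sub_sinh_div_pow_three :
    Tendsto (fun x => (x * Real.cosh x - Real.sinh x) / x ^ 3) (𝓝[>] 0) (𝓝 (1 / 3)) := by
  refine HasDerivAt.lhopital_zero_nhdsGT (f' := fun x => x * Real.sinh x)
    (g' := fun x => 3 * x ^ 2) (.of_forall hasDerivAt_mul_cosh_sub_sinh)
    (.of_forall fun t => (hasDerivAt_pow 3 t).congr_deriv (by norm_num)) ?_ ?_ ?_ ?_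
  · filter_upwards [self_mem_nhdsWithin] with x hx
    exact mul_ne_zero three_ne_zero (pow_ne_zero 2 (mem_Ioi.1 hx).ne')
  · have hcont : Continuous fun x : ℝ => x * Real.cosh x - Real.sinh x := by fun_prop
    simpa using (hcont.tendsto 0).mono_left nhdsWithin_le_nhds
  · simpa using ((continuous_pow (M := ℝ) 3).tendsto 0).mono_left nhdsWithin_le_nhds
  · have hlim := (tendsto_sinh_mul_div 1).div_const 3
    refine hlim.congr' ?_
    filter_upwards [self_mem_nhdsWithin] with x hx
    have hx : (0 : ℝ) < x := hx
    rw [one_mul]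
    field_simp

lemma tendsto_xcoth_sub_one_div_sq :
    Tendsto (fun x => (xcoth x - 1) / x ^ 2) (𝓝[>] 0) (𝓝 (1 / 3)) := by
  have hlim := tendsto_mul_cosh_sub_sinh_div_pow_three.div (tendsto_sinh_mul_div 1) one_ne_zero
  rw [div_one] at hlim
  refine hlim.congr' ?_
  filter_upwards [self_mem_nhdsWithin] with x hx
  have hx : (0 : ℝ) < x := hx
  have := Real.sinh_pos_iff.2 hx
  simp only [Pi.div_apply, one_mul, xcoth]
  field_simp

end XCoth

section MCoth

variable {l m n z : ℝ}

/-- The logarithmic derivative of `z ↦ sinh (m z)`. -/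
noncomputable def mcoth (m z : ℝ) : ℝ := m * Real.cosh (m * z) / Real.sinh (m * z)

lemma xcoth_mul (m z : ℝ) : xcoth (m * z) = z * mcoth m z := by
  unfold xcoth mcoth
  ring

lemma mcoth_sub_mcoth (m n : ℝ) (hz : z ≠ 0) :
    mcoth m z - mcoth n z = (xcoth (m * z) - xcoth (n * z)) / z := by
  rw [xcoth_mul, xcoth_mul, ← mul_sub, mul_div_cancel_left₀ _ hz]

lemma mcoth_lt (hm : 0 < m) (hmn : m < n) (hz : 0 < z) : mcoth m z < mcoth n z := by
  rw [← sub_pos, mcoth_sub_mcoth _ _ hz.ne']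
  exact div_pos (sub_pos.2 (strictMonoOn_xcoth (mul_pos hm hz) (mul_pos (hm.trans hmn) hz)
    (mul_lt_mul_of_pos_right hmn hz))) hz

lemma mcoth_sub_le (hm : 0 < m) (hmn : m ≤ n) (hz : 0 < z) :
    mcoth n z - mcoth m z ≤ n - m := by
  rw [mcoth_sub_mcoth _ _ hz.ne', div_le_iff₀ hz, sub_mul, sub_le_sub_iff]
  linarith [antitoneOn_xcoth_sub (mul_pos hm hz) (mul_pos (hm.trans_le hmn) hz)
    (mul_le_mul_of_nonneg_right hmn hz.le)]

lemma mcoth_secant_mono (hl : 0 < l) (hm : 0 < m) (hn : 0 < n) (hz : 0 < z)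
    (hml : m ≠ l) (hnl : n ≠ l) (hmn : m ≤ n) :
    (mcoth m z - mcoth l z) / (m - l) ≤ (mcoth n z - mcoth l z) / (n - l) := by
  have hsecant := strictConvexOn_xcoth.convexOn.secant_mono (a := l * z) (x := m * z) (y := n * z)
    (mul_pos hl hz) (mul_pos hm hz) (mul_pos hn hz) (fun h => hml (mul_right_cancel₀ hz.ne' h))
    (fun h => hnl (mul_right_cancel₀ hz.ne' h)) (mul_le_mul_of_nonneg_right hmn hz.le)
  rw [mcoth_sub_mcoth _ _ hz.ne', mcoth_sub_mcoth _ _ hz.ne', div_div, div_div, mul_sub, mul_sub]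
  simpa only [mul_comm z] using hsecant

lemma mcoth_slope_lt (hl : 0 < l) (hlm : l < m) (hmn : m < n) (hz : 0 < z) :
    (mcoth m z - mcoth l z) / (m - l) < (mcoth n z - mcoth m z) / (n - m) := by
  have hslope := strictConvexOn_xcoth.slope_strict_mono_adjacent (x := l * z) (y := m * z)
    (z := n * z) (mul_pos hl hz) (mul_pos (hl.trans (hlm.trans hmn)) hz)
    (mul_lt_mul_of_pos_right hlm hz) (mul_lt_mul_of_pos_right hmn hz)
  rw [mcoth_sub_mcoth _ _ hz.ne', mcoth_sub_mcoth _ _ hz.ne', div_div, div_div, mul_sub, mul_sub]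
  simpa only [mul_comm z] using hslope

lemma tendsto_mcoth_sub_div (hm : 0 < m) (hn : 0 < n) :
    Tendsto (fun z => (mcoth m z - mcoth n z) / z) (𝓝[>] 0) (𝓝 ((m ^ 2 - n ^ 2) / 3)) := by
  have hlim {m : ℝ} (hm : 0 < m) :
      Tendsto (fun z => (xcoth (m * z) - 1) / z ^ 2) (𝓝[>] 0) (𝓝 (m ^ 2 / 3)) := by
    have hscale :=
      (tendsto_xcoth_sub_one_div_sq.comp (tendsto_mul_nhdsGT_zero hm)).const_mul (m ^ 2)
    rw [mul_one_div] at hscale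
    refine hscale.congr fun z => ?_
    rw [Function.comp_apply, mul_pow, mul_div_assoc', mul_div_mul_left _ _ (pow_ne_zero 2 hm.ne')]
  have hsub := (hlim hm).sub (hlim hn)
  rw [← sub_div] at hsub
  refine hsub.congr' ?_
  filter_upwards [self_mem_nhdsWithin] with z hz
  rw [mcoth_sub_mcoth _ _ (mem_Ioi.1 hz).ne', ← sub_div, sub_sub_sub_cancel_right, sq, div_div]

end MCoth

section HalfAngle

variable {z : ℝ}

lemma sinh_eq_half (z : ℝ) : Real.sinh z = 2 * Real.sinh (z / 2) * Real.cosh (z / 2) := by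
  rw [← Real.sinh_two_mul, mul_div_cancel₀ z two_ne_zero]

lemma cosh_eq_half (z : ℝ) : Real.cosh z = 1 + 2 * Real.sinh (z / 2) ^ 2 := by
  have h := Real.cosh_two_mul (z / 2)
  rw [mul_div_cancel₀ z two_ne_zero, Real.cosh_sq] at h
  linarith

lemma tanh_le_two_mul_tanh_half (hz : 0 < z) : Real.tanh z ≤ 2 * Real.tanh (z / 2) := by
  have := Real.sinh_pos_iff.2 (half_pos hz)
  have hc := Real.cosh_pos (z / 2)
  rw [Real.tanh_eq_sinh_div_cosh, Real.tanh_eq_sinh_div_cosh, sinh_eq_half z, cosh_eq_half z,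
    mul_div_assoc', div_le_div_iff₀ (by positivity) hc, mul_assoc, ← sq, Real.cosh_sq]
  exact mul_le_mul_of_nonneg_left (by linarith [sq_nonneg (Real.sinh (z / 2))]) (by positivity)

lemma mcoth_one_sub_half (hz : 0 < z) :
    (mcoth 1 z - mcoth (1 / 2) z) / (1 - 1 / 2) = Real.tanh (z / 2) := by
  have := Real.sinh_pos_iff.2 (half_pos hz)
  have := Real.cosh_pos (z / 2)
  rw [mcoth, mcoth, one_mul, one_mul, one_div_mul_eq_div, Real.tanh_eq_sinh_div_cosh,
    sinh_eq_half, cosh_eq_half]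
  field_simp
  rw [Real.cosh_sq]
  ring

lemma mcoth_two_sub_one (hz : 0 < z) : mcoth 2 z - mcoth 1 z = Real.tanh z := by
  have := Real.sinh_pos_iff.2 hz
  have := Real.cosh_pos z
  rw [mcoth, mcoth, one_mul, one_mul, Real.tanh_eq_sinh_div_cosh, Real.sinh_two_mul,
    Real.cosh_two_mul]
  field_simp
  ring

lemma mcoth_three_sub_one (hz : 0 < z) :
    mcoth 3 z - mcoth 1 z = 8 * Real.sinh z * Real.cosh z / (4 * Real.sinh z ^ 2 + 3) := by
  have := Real.sinh_pos_iff.2 hz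
  rw [mcoth, mcoth, one_mul, one_mul, Real.sinh_three_mul, Real.cosh_three_mul,
    show 4 * Real.sinh z ^ 3 + 3 * Real.sinh z = Real.sinh z * (4 * Real.sinh z ^ 2 + 3) by ring,
    show 4 * Real.cosh z ^ 3 - 3 * Real.cosh z = Real.cosh z * (4 * Real.cosh z ^ 2 - 3) by ring,
    Real.cosh_sq]
  field_simp
  ring

lemma mcoth_three_sub_one_le (hz : 0 < z) : mcoth 3 z - mcoth 1 z ≤ 8 / 3 * Real.tanh z := by
  have hs := Real.sinh_pos_iff.2 hz
  have hc := Real.cosh_pos z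
  rw [mcoth_three_sub_one hz, Real.tanh_eq_sinh_div_cosh, mul_div_assoc',
    div_le_div_iff₀ (by positivity) hc, mul_assoc, ← sq, Real.cosh_sq]
  linarith [pow_pos hs 3]

lemma tendsto_tanh_half_div :
    Tendsto (fun z : ℝ => Real.tanh (z / 2) / z) (𝓝[>] 0) (𝓝 (1 / 2)) := by
  have hcosh : Tendsto (fun z : ℝ => Real.cosh (z / 2)) (𝓝[>] 0) (𝓝 1) := by
    have hcont : Continuous fun z : ℝ => Real.cosh (z / 2) := by fun_prop
    simpa using (hcont.tendsto 0).mono_left nhdsWithin_le_nhds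
  have hlim := (tendsto_sinh_mul_div (1 / 2)).div hcosh one_ne_zero
  rw [div_one] at hlim
  refine hlim.congr fun z => ?_
  rw [Pi.div_apply, one_div_mul_eq_div, Real.tanh_eq_sinh_div_cosh, div_right_comm]

end HalfAngle

section Rates

variable {μ z : ℝ}

/-- Minus the logarithmic derivative of the jump along the asymmetric branch. -/
noncomputable def jumpRate (μ z : ℝ) : ℝ :=
  ((mcoth (μ + 1) z - mcoth 1 z) / μ - Real.tanh (z / 2)) / 2

/-- The logarithmic derivative of `k` along the asymmetric branch. -/
noncomputable def paramRate (μ z : ℝ) : ℝ :=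
  (Real.tanh (z / 2) + mcoth (μ + 1) z - mcoth μ z) / 2

lemma jumpRate_pos (hμ : 0 < μ) (hz : 0 < z) : 0 < jumpRate μ z := by
  have hslope := mcoth_slope_lt (l := 1 / 2) (m := 1) (n := μ + 1) (by norm_num) (by norm_num)
    (by linarith) hz
  rw [mcoth_one_sub_half hz, add_sub_cancel_right] at hslope
  unfold jumpRate
  linarith

lemma paramRate_pos (hμ : 0 < μ) (hz : 0 < z) : 0 < paramRate μ z := by
  have htanh := tanh_pos (half_pos hz)
  have hmcoth := mcoth_lt hμ (lt_add_one μ) hz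
  unfold paramRate
  linarith

lemma jumpRate_lt_of_le_one (hμ : 0 < μ) (hμ1 : μ ≤ 1) (hz : 0 < z) :
    jumpRate μ z < 3 / 2 * paramRate μ z := by
  have htanh := tanh_le_two_mul_tanh_half hz
  have htanh_pos := tanh_pos (half_pos hz)
  have hmcoth := mcoth_lt hμ (lt_add_one μ) hz
  have hsecant := mcoth_secant_mono (l := 1) (m := μ + 1) (n := 2) one_pos (by linarith) two_pos hz
    (by linarith) (by norm_num) (by linarith)
  rw [add_sub_cancel_right, mcoth_two_sub_one hz, show (2 : ℝ) - 1 = 1 by norm_num,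
    div_one] at hsecant
  unfold jumpRate paramRate
  linarith

lemma jumpRate_lt_of_one_lt (hμ : 1 < μ) (hμ2 : μ ≤ 2) (hz : 0 < z) :
    jumpRate μ z < 1 / 2 * paramRate μ z := by
  have htanh := tanh_le_two_mul_tanh_half hz
  have htanh_pos := tanh_pos (half_pos hz)
  have hthree := mcoth_three_sub_one_le hz
  have hright := mcoth_secant_mono (l := 1) (m := μ + 1) (n := 3) one_pos (by linarith) three_pos
    hz (by linarith) (by norm_num) (by linarith)
  have hleft := mcoth_secant_mono (l := μ + 1) (m := 1) (n := μ) (by linarith) one_pos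
    (by linarith) hz (by linarith) (by linarith) hμ.le
  rw [← neg_div_neg_eq, neg_sub, neg_sub, add_sub_cancel_right,
    ← neg_div_neg_eq (mcoth μ z - mcoth (μ + 1) z), neg_sub, neg_sub, add_sub_cancel_left,
    div_one] at hleft
  rw [add_sub_cancel_right, show (3 : ℝ) - 1 = 2 by norm_num] at hright
  unfold jumpRate paramRate
  linarith

lemma jumpRate_lt (hμ : 0 < μ) (hμ2 : μ ≤ 2) (hz : 0 < z) :
    jumpRate μ z < (2 / μ - 1 / 2) * paramRate μ z := by
  have hB := paramRate_pos hμ hz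
  rcases le_or_gt μ 1 with hμ1 | hμ1
  · refine (jumpRate_lt_of_le_one hμ hμ1 hz).trans_le (mul_le_mul_of_nonneg_right ?_ hB.le)
    linarith [(le_div_iff₀ hμ).2 (by linarith : 2 * μ ≤ 2)]
  · refine (jumpRate_lt_of_one_lt hμ1 hμ2 hz).trans_le (mul_le_mul_of_nonneg_right ?_ hB.le)
    linarith [(le_div_iff₀ hμ).2 (by linarith : 1 * μ ≤ 2)]

lemma tendsto_jumpRate_div (hμ : 0 < μ) :
    Tendsto (fun z => jumpRate μ z / z) (𝓝[>] 0) (𝓝 ((2 * μ + 1) / 12)) := by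
  have hlim := (((tendsto_mcoth_sub_div (m := μ + 1) (n := 1) (by linarith)
    one_pos).div_const μ).sub tendsto_tanh_half_div).div_const 2
  convert hlim using 1
  · ext z
    unfold jumpRate
    ring
  · congr 1
    field_simp
    ring

lemma tendsto_paramRate_div (hμ : 0 < μ) :
    Tendsto (fun z => paramRate μ z / z) (𝓝[>] 0) (𝓝 ((4 * μ + 5) / 12)) := by
  have hlim := ((tendsto_mcoth_sub_div (m := μ + 1) (n := μ) (by linarith) hμ).add
    tendsto_tanh_half_div).div_const 2
  convert hlim using 1
  · ext z
    unfold paramRate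
    ring
  · congr 1
    ring

lemma tendsto_jumpRate_div_paramRate (hμ : 0 < μ) :
    Tendsto (fun z => jumpRate μ z / paramRate μ z) (𝓝[>] 0)
      (𝓝 ((2 * μ + 1) / (4 * μ + 5))) := by
  have hlim := (tendsto_jumpRate_div hμ).div (tendsto_paramRate_div hμ) (by positivity)
  rw [div_div_div_cancel_right₀ (by norm_num)] at hlim
  refine hlim.congr' ?_
  filter_upwards [self_mem_nhdsWithin] with z hz
  rw [Pi.div_apply, div_div_div_cancel_right₀ (mem_Ioi.1 hz).ne']

end Rates

/-! ### The curve of asymmetric boundary values -/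

section Branch

variable {m n μ k z : ℝ}

/-- The ratio `sinh (m z) / sinh (n z)`, through which the asymmetric boundary values and their
parameter `k` are expressed. -/
noncomputable def sinhRatio (m n z : ℝ) : ℝ := Real.sinh (m * z) / Real.sinh (n * z)

lemma sinhRatio_pos (hm : 0 < m) (hn : 0 < n) (hz : 0 < z) : 0 < sinhRatio m n z :=
  div_pos (Real.sinh_pos_iff.2 (mul_pos hm hz)) (Real.sinh_pos_iff.2 (mul_pos hn hz))

lemma hasDerivAt_sinhRatio (hm : 0 < m) (hn : 0 < n) (hz : 0 < z) :
    HasDerivAt (sinhRatio m n) (sinhRatio m n z * (mcoth m z - mcoth n z)) z := by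
  have hderiv (m : ℝ) : HasDerivAt (fun z => Real.sinh (m * z)) (Real.cosh (m * z) * m) z :=
    (Real.hasDerivAt_sinh (m * z)).comp z (((hasDerivAt_id z).const_mul m).congr_deriv (mul_one m))
  have := Real.sinh_pos_iff.2 (mul_pos hm hz)
  have hsn := Real.sinh_pos_iff.2 (mul_pos hn hz)
  refine ((hderiv m).div (hderiv n) hsn.ne').congr_deriv ?_
  unfold sinhRatio mcoth
  field_simp

lemma tendsto_sinhRatio (m : ℝ) (hn : n ≠ 0) :
    Tendsto (sinhRatio m n) (𝓝[>] 0) (𝓝 (m / n)) := by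
  refine ((tendsto_sinh_mul_div m).div (tendsto_sinh_mul_div n) hn).congr' ?_
  filter_upwards [self_mem_nhdsWithin] with z hz
  exact div_div_div_cancel_right₀ (mem_Ioi.1 hz).ne' _ _

lemma exp_mul_sinhRatio (hμ : 0 < μ) (hz : 0 < z) :
    Real.exp (μ * z) * sinhRatio 1 (μ + 1) z = 1 - Real.exp (-z) * sinhRatio μ (μ + 1) z := by
  have hs := Real.sinh_pos_iff.2 (mul_pos (add_pos hμ one_pos) hz)
  rw [sinhRatio, sinhRatio, mul_div_assoc', mul_div_assoc', eq_sub_iff_add_eq, ← add_div,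
    div_eq_one_iff_eq hs.ne', one_mul, add_mul, one_mul, Real.sinh_add, ← Real.cosh_add_sinh,
    ← Real.cosh_sub_sinh]
  ring

lemma exp_neg_mul_sinhRatio (hμ : 0 < μ) (hz : 0 < z) :
    Real.exp (-(μ * z)) * sinhRatio 1 (μ + 1) z = 1 - Real.exp z * sinhRatio μ (μ + 1) z := by
  have hs := Real.sinh_pos_iff.2 (mul_pos (add_pos hμ one_pos) hz)
  rw [sinhRatio, sinhRatio, mul_div_assoc', mul_div_assoc', eq_sub_iff_add_eq, ← add_div,
    div_eq_one_iff_eq hs.ne', one_mul, add_mul, one_mul, Real.sinh_add, ← Real.cosh_add_sinh z,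
    ← Real.cosh_sub_sinh (μ * z)]
  ring

lemma sinhRatio_le_one (hn : 0 < n) (hmn : m ≤ n) (hz : 0 < z) :
    sinhRatio m n z ≤ 1 := by
  rw [sinhRatio, div_le_one (Real.sinh_pos_iff.2 (mul_pos hn hz)), Real.sinh_le_sinh]
  exact mul_le_mul_of_nonneg_right hmn hz.le

lemma strictAntiOn_sinhRatio (hm : 0 < m) (hmn : m < n) :
    StrictAntiOn (sinhRatio m n) (Ioi 0) := by
  have hn := hm.trans hmn
  refine strictAntiOn_of_deriv_neg (convex_Ioi 0)
    (fun z hz => (hasDerivAt_sinhRatio hm hn hz).continuousAt.continuousWithinAt) fun z hz => ?_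
  rw [interior_Ioi] at hz
  rw [(hasDerivAt_sinhRatio hm hn hz).deriv]
  exact mul_neg_of_pos_of_neg (sinhRatio_pos hm hn hz) (sub_neg.2 (mcoth_lt hm hmn hz))

lemma sinhRatio_le (hm : 0 < m) (hmn : m < n) (hz : 0 < z) :
    sinhRatio m n z ≤ m / n := by
  refine ge_of_tendsto (tendsto_sinhRatio m (hm.trans hmn).ne') ?_
  filter_upwards [Ioo_mem_nhdsGT hz] with s hs
  exact (strictAntiOn_sinhRatio hm hmn (mem_Ioi.2 hs.1) (mem_Ioi.2 hz) hs.2).le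

/-- The common scale of the two boundary values on the asymmetric branch. -/
noncomputable def profileScale (μ z : ℝ) : ℝ := sinhRatio 1 (μ + 1) z ^ (1 / (2 * μ))

/-- The larger boundary value on the asymmetric branch, with the parameter `z` the logarithm of the
ratio of the two values. -/
noncomputable def branchRight (μ z : ℝ) : ℝ := Real.exp (z / 2) * profileScale μ z

/-- The smaller boundary value on the asymmetric branch. -/
noncomputable def branchLeft (μ z : ℝ) : ℝ := Real.exp (-(z / 2)) * profileScale μ z

/-- The value of `k` for which `(branchRight μ z, branchLeft μ z)` is critical. -/
noncomputable def branchParam (μ z : ℝ) : ℝ :=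
  2 * Real.cosh (z / 2) / √(sinhRatio μ (μ + 1) z)

/-- The bifurcation value of `k`. -/
noncomputable def bifParam (μ : ℝ) : ℝ := 2 * √((μ + 1) / μ)

lemma profileScale_pos (hμ : 0 < μ) (hz : 0 < z) : 0 < profileScale μ z :=
  Real.rpow_pos_of_pos (sinhRatio_pos one_pos (by linarith) hz) _

lemma branchRight_pos (hμ : 0 < μ) (hz : 0 < z) : 0 < branchRight μ z :=
  mul_pos (Real.exp_pos _) (profileScale_pos hμ hz)

lemma branchLeft_pos (hμ : 0 < μ) (hz : 0 < z) : 0 < branchLeft μ z :=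
  mul_pos (Real.exp_pos _) (profileScale_pos hμ hz)

lemma branchLeft_eq (μ z : ℝ) : branchLeft μ z = Real.exp (-z) * branchRight μ z := by
  unfold branchLeft branchRight
  rw [← mul_assoc, ← Real.exp_add]
  congr 2
  ring

lemma branchParam_pos (hμ : 0 < μ) (hz : 0 < z) : 0 < branchParam μ z :=
  div_pos (mul_pos two_pos (Real.cosh_pos _))
    (Real.sqrt_pos.2 (sinhRatio_pos hμ (by linarith) hz))

lemma hasDerivAt_profileScale (hμ : 0 < μ) (hz : 0 < z) :
    HasDerivAt (profileScale μ) (profileScale μ z *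
      (-((mcoth (μ + 1) z - mcoth 1 z) / μ) / 2)) z := by
  have hratio := sinhRatio_pos one_pos (add_pos hμ one_pos) hz
  refine ((hasDerivAt_sinhRatio one_pos (add_pos hμ one_pos) hz).rpow_const
    (Or.inl hratio.ne')).congr_deriv ?_
  rw [Real.rpow_sub_one hratio.ne', profileScale]
  field_simp
  ring

lemma hasDerivAt_branchRight (hμ : 0 < μ) (hz : 0 < z) :
    HasDerivAt (branchRight μ) (branchRight μ z *
      ((1 - (mcoth (μ + 1) z - mcoth 1 z) / μ) / 2)) z := by
  have hexp : HasDerivAt (fun z : ℝ => Real.exp (z / 2)) (Real.exp (z / 2) * (1 / 2)) z :=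
    (Real.hasDerivAt_exp _).comp z ((hasDerivAt_id z).div_const 2)
  refine (hexp.mul (hasDerivAt_profileScale hμ hz)).congr_deriv ?_
  unfold branchRight
  ring

lemma hasDerivAt_branchLeft (hμ : 0 < μ) (hz : 0 < z) :
    HasDerivAt (branchLeft μ) (branchLeft μ z *
      ((-1 - (mcoth (μ + 1) z - mcoth 1 z) / μ) / 2)) z := by
  have hexp : HasDerivAt (fun z : ℝ => Real.exp (-(z / 2))) (Real.exp (-(z / 2)) * (-(1 / 2))) z :=
    (Real.hasDerivAt_exp _).comp z ((hasDerivAt_id z).div_const 2).neg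
  refine (hexp.mul (hasDerivAt_profileScale hμ hz)).congr_deriv ?_
  unfold branchLeft
  ring

lemma branch_add (μ z : ℝ) :
    branchRight μ z + branchLeft μ z = 2 * Real.cosh (z / 2) * profileScale μ z := by
  unfold branchLeft branchRight
  rw [Real.cosh_eq]
  ring

lemma branch_sub (μ z : ℝ) :
    branchRight μ z - branchLeft μ z = 2 * Real.sinh (z / 2) * profileScale μ z := by
  unfold branchLeft branchRight
  rw [Real.sinh_eq]
  ring

lemma branch_log_deriv (μ z : ℝ) :
    branchRight μ z * ((1 - (mcoth (μ + 1) z - mcoth 1 z) / μ) / 2) +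
      branchLeft μ z * ((-1 - (mcoth (μ + 1) z - mcoth 1 z) / μ) / 2) =
      -jumpRate μ z * (branchRight μ z + branchLeft μ z) := by
  have htanh : Real.tanh (z / 2) * (branchRight μ z + branchLeft μ z) =
      branchRight μ z - branchLeft μ z := by
    rw [branch_add, branch_sub, Real.tanh_eq_sinh_div_cosh]
    have := Real.cosh_pos (z / 2)
    field_simp
  unfold jumpRate
  linear_combination (-1 / 2) * htanh

lemma branchRight_rpow (hμ : 0 < μ) (hz : 0 < z) :
    branchRight μ z ^ (2 * μ) = 1 - Real.exp (-z) * sinhRatio μ (μ + 1) z := by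
  have hratio := sinhRatio_pos one_pos (add_pos hμ one_pos) hz
  rw [← exp_mul_sinhRatio hμ hz, branchRight, profileScale,
    Real.mul_rpow (Real.exp_pos _).le (by positivity), ← Real.rpow_mul hratio.le,
    one_div_mul_cancel (by positivity), Real.rpow_one, ← Real.exp_mul]
  congr 2
  ring

lemma branchLeft_rpow (hμ : 0 < μ) (hz : 0 < z) :
    branchLeft μ z ^ (2 * μ) = 1 - Real.exp z * sinhRatio μ (μ + 1) z := by
  have hratio := sinhRatio_pos one_pos (add_pos hμ one_pos) hz
  rw [← exp_neg_mul_sinhRatio hμ hz, branchLeft, profileScale,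
    Real.mul_rpow (Real.exp_pos _).le (by positivity), ← Real.rpow_mul hratio.le,
    one_div_mul_cancel (by positivity), Real.rpow_one, ← Real.exp_mul]
  congr 2
  ring

lemma branchRight_lt_one (hμ : 0 < μ) (hz : 0 < z) : branchRight μ z < 1 := by
  by_contra! hge
  have hpow := Real.one_le_rpow hge (mul_pos two_pos hμ).le
  rw [branchRight_rpow hμ hz] at hpow
  linarith [mul_pos (Real.exp_pos (-z)) (sinhRatio_pos hμ (add_pos hμ one_pos) hz)]

lemma branchLeft_lt_branchRight (hμ : 0 < μ) (hz : 0 < z) :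
    branchLeft μ z < branchRight μ z := by
  rw [branchLeft_eq]
  exact mul_lt_of_lt_one_left (branchRight_pos hμ hz) (Real.exp_lt_one_iff.2 (by linarith))

lemma branchLeft_lt_one (hμ : 0 < μ) (hz : 0 < z) : branchLeft μ z < 1 :=
  (branchLeft_lt_branchRight hμ hz).trans (branchRight_lt_one hμ hz)

lemma profileSpeed_branchRight (hμ : 0 < μ) (hz : 0 < z) :
    profileSpeed μ (branchRight μ z) = profileScale μ z * √(sinhRatio μ (μ + 1) z) := by
  have hexp : Real.exp (z / 2) * Real.exp (-(z / 2)) = 1 := by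
    rw [← Real.exp_add, add_neg_cancel, Real.exp_zero]
  rw [profileSpeed, branchRight_rpow hμ hz, sub_sub_cancel, Real.sqrt_mul (Real.exp_pos _).le,
    ← Real.exp_half, neg_div, branchRight]
  linear_combination profileScale μ z * √(sinhRatio μ (μ + 1) z) * hexp

lemma profileSpeed_branchLeft (hμ : 0 < μ) (hz : 0 < z) :
    profileSpeed μ (branchLeft μ z) = profileScale μ z * √(sinhRatio μ (μ + 1) z) := by
  have hexp : Real.exp (z / 2) * Real.exp (-(z / 2)) = 1 := by
    rw [← Real.exp_add, add_neg_cancel, Real.exp_zero]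
  rw [profileSpeed, branchLeft_rpow hμ hz, sub_sub_cancel, Real.sqrt_mul (Real.exp_pos _).le,
    ← Real.exp_half, branchLeft]
  linear_combination profileScale μ z * √(sinhRatio μ (μ + 1) z) * hexp

lemma branch_add_div_branchParam (hμ : 0 < μ) (hz : 0 < z) :
    (branchRight μ z + branchLeft μ z) / branchParam μ z =
      profileScale μ z * √(sinhRatio μ (μ + 1) z) := by
  have := Real.cosh_pos (z / 2)
  have := Real.sqrt_pos.2 (sinhRatio_pos hμ (add_pos hμ one_pos) hz)
  rw [branch_add, branchParam]
  field_simp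

lemma isCritical_branch (hμ : 0 < μ) (hz : 0 < z) :
    IsCritical μ (branchParam μ z) (branchRight μ z) (branchLeft μ z) where
  left_mem := ⟨branchRight_pos hμ hz, branchRight_lt_one hμ hz⟩
  right_mem := ⟨branchLeft_pos hμ hz, branchLeft_lt_one hμ hz⟩
  profileSpeed_left := by rw [branch_add_div_branchParam hμ hz, profileSpeed_branchRight hμ hz]
  profileSpeed_right := by rw [branch_add_div_branchParam hμ hz, profileSpeed_branchLeft hμ hz]

lemma hasDerivAt_branchParam (hμ : 0 < μ) (hz : 0 < z) :
    HasDerivAt (branchParam μ) (branchParam μ z * paramRate μ z) z := by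
  have hratio := sinhRatio_pos hμ (add_pos hμ one_pos) hz
  have hcosh : HasDerivAt (fun z : ℝ => 2 * Real.cosh (z / 2))
      (2 * (Real.sinh (z / 2) * (1 / 2))) z :=
    ((Real.hasDerivAt_cosh _).comp z ((hasDerivAt_id z).div_const 2)).const_mul 2
  have hsqrt := (hasDerivAt_sinhRatio hμ (add_pos hμ one_pos) hz).sqrt hratio.ne'
  have hpos := Real.sqrt_pos.2 hratio
  have := Real.cosh_pos (z / 2)
  refine (hcosh.div hsqrt hpos.ne').congr_deriv ?_
  unfold branchParam paramRate
  rw [Real.tanh_eq_sinh_div_cosh]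
  nth_rewrite 2 [← Real.sq_sqrt hratio.le]
  field_simp
  ring

lemma strictMonoOn_branchParam (hμ : 0 < μ) : StrictMonoOn (branchParam μ) (Ioi 0) := by
  refine strictMonoOn_of_deriv_pos (convex_Ioi 0)
    (fun z hz => (hasDerivAt_branchParam hμ hz).continuousAt.continuousWithinAt) fun z hz => ?_
  rw [interior_Ioi] at hz
  rw [(hasDerivAt_branchParam hμ hz).deriv]
  exact mul_pos (branchParam_pos hμ hz) (paramRate_pos hμ hz)

lemma tendsto_branchParam (hμ : 0 < μ) :
    Tendsto (branchParam μ) (𝓝[>] 0) (𝓝 (bifParam μ)) := by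
  have hcont : Continuous fun z : ℝ => 2 * Real.cosh (z / 2) := by fun_prop
  have hcosh : Tendsto (fun z : ℝ => 2 * Real.cosh (z / 2)) (𝓝[>] 0) (𝓝 2) := by
    simpa using (hcont.tendsto 0).mono_left nhdsWithin_le_nhds
  have hratio := (tendsto_sinhRatio μ (add_pos hμ one_pos).ne').sqrt
  rw [bifParam, ← inv_div, Real.sqrt_inv, ← div_eq_mul_inv]
  exact hcosh.div hratio (Real.sqrt_pos.2 (by positivity)).ne'

lemma bifParam_lt_branchParam (hμ : 0 < μ) (hz : 0 < z) :
    bifParam μ < branchParam μ z := by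
  refine lt_of_le_of_lt ?_ (strictMonoOn_branchParam hμ (mem_Ioi.2 (half_pos hz)) (mem_Ioi.2 hz)
    (half_lt_self hz))
  refine le_of_tendsto (tendsto_branchParam hμ) ?_
  filter_upwards [Ioo_mem_nhdsGT (half_pos hz)] with s hs
  exact (strictMonoOn_branchParam hμ (mem_Ioi.2 hs.1) (mem_Ioi.2 (half_pos hz)) hs.2).le

lemma tendsto_branchParam_atTop (hμ : 0 < μ) : Tendsto (branchParam μ) atTop atTop := by
  refine tendsto_atTop_mono' _ ?_ tendsto_id
  filter_upwards [eventually_gt_atTop 0] with z hz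
  have hle : √(sinhRatio μ (μ + 1) z) ≤ 1 :=
    Real.sqrt_le_one.2 (sinhRatio_le_one (by linarith) (by linarith) hz)
  have hpos := Real.sqrt_pos.2 (sinhRatio_pos hμ (add_pos hμ one_pos) hz)
  have hcosh : z / 2 ≤ Real.cosh (z / 2) :=
    ((Real.self_lt_sinh_iff.2 (half_pos hz)).trans (Real.sinh_lt_cosh _)).le
  rw [id, branchParam, le_div_iff₀ hpos]
  exact (mul_le_of_le_one_right hz.le hle).trans (by linarith)

lemma exists_branchParam_eq (hμ : 0 < μ) (hk : bifParam μ < k) :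
    ∃ z, 0 < z ∧ branchParam μ z = k := by
  obtain ⟨a, hak, ha⟩ := (((tendsto_branchParam hμ).eventually (gt_mem_nhds hk)).and
    self_mem_nhdsWithin).exists
  obtain ⟨b, hbk, hb⟩ := (((tendsto_branchParam_atTop hμ).eventually (eventually_ge_atTop k)).and
    (eventually_gt_atTop 0)).exists
  exact isPreconnected_Ioi.intermediate_value (mem_Ioi.2 ha) (mem_Ioi.2 hb)
    (fun z hz => (hasDerivAt_branchParam hμ hz).continuousAt.continuousWithinAt) ⟨hak.le, hbk⟩

lemma tendsto_profileScale (hμ : 0 < μ) :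
    Tendsto (profileScale μ) (𝓝[>] 0) (𝓝 ((1 / (μ + 1)) ^ (1 / (2 * μ)))) :=
  (tendsto_sinhRatio 1 (add_pos hμ one_pos).ne').rpow_const (Or.inr (by positivity))

lemma tendsto_branchRight (hμ : 0 < μ) :
    Tendsto (branchRight μ) (𝓝[>] 0) (𝓝 ((1 / (μ + 1)) ^ (1 / (2 * μ)))) := by
  have hcont : Continuous fun z : ℝ => Real.exp (z / 2) := by fun_prop
  have hexp : Tendsto (fun z : ℝ => Real.exp (z / 2)) (𝓝[>] 0) (𝓝 1) := by
    simpa using (hcont.tendsto 0).mono_left nhdsWithin_le_nhds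
  exact one_mul ((1 / (μ + 1)) ^ (1 / (2 * μ)) : ℝ) ▸ hexp.mul (tendsto_profileScale hμ)

lemma tendsto_branchLeft (hμ : 0 < μ) :
    Tendsto (branchLeft μ) (𝓝[>] 0) (𝓝 ((1 / (μ + 1)) ^ (1 / (2 * μ)))) := by
  have hcont : Continuous fun z : ℝ => Real.exp (-(z / 2)) := by fun_prop
  have hexp : Tendsto (fun z : ℝ => Real.exp (-(z / 2))) (𝓝[>] 0) (𝓝 1) := by
    simpa using (hcont.tendsto 0).mono_left nhdsWithin_le_nhds
  exact one_mul ((1 / (μ + 1)) ^ (1 / (2 * μ)) : ℝ) ▸ hexp.mul (tendsto_profileScale hμ)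

lemma tendsto_branchRight_atTop (hμ : 0 < μ) : Tendsto (branchRight μ) atTop (𝓝 1) := by
  have hsmall : Tendsto (fun z => Real.exp (-z) * sinhRatio μ (μ + 1) z) atTop (𝓝 0) := by
    refine squeeze_zero' ?_ ?_ Real.tendsto_exp_neg_atTop_nhds_zero
    · filter_upwards [eventually_gt_atTop 0] with z hz
      exact (mul_pos (Real.exp_pos _) (sinhRatio_pos hμ (by linarith) hz)).le
    · filter_upwards [eventually_gt_atTop 0] with z hz
      exact mul_le_of_le_one_right (Real.exp_pos _).le
        (sinhRatio_le_one (by linarith) (by linarith) hz)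
  have hroot := (hsmall.const_sub 1).rpow_const (p := 1 / (2 * μ)) (Or.inl (by norm_num))
  rw [sub_zero, Real.one_rpow] at hroot
  refine hroot.congr' ?_
  filter_upwards [eventually_gt_atTop 0] with z hz
  rw [← branchRight_rpow hμ hz, ← Real.rpow_mul (branchRight_pos hμ hz).le,
    mul_one_div_cancel (by positivity), Real.rpow_one]

end Branch

/-! ### The minimax property -/

section RayMinimax

variable {μ k x y z : ℝ} {X Y : ℝ → ℝ}

lemma reducedAction_comm (μ k x y : ℝ) : reducedAction μ k x y = reducedAction μ k y x := by
  rw [reducedAction, reducedAction, add_comm y x, add_comm (profileAction μ y)]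

lemma tendsto_reducedAction {l : Filter ℝ} (hμ : 0 < μ) (hX : Tendsto X l (𝓝 x))
    (hY : Tendsto Y l (𝓝 y)) :
    Tendsto (fun z => reducedAction μ k (X z) (Y z)) l (𝓝 (reducedAction μ k x y)) :=
  ((((continuous_profileAction hμ).tendsto x).comp hX).add
    (((continuous_profileAction hμ).tendsto y).comp hY)).sub (((hX.add hY).pow 2).div_const _)

lemma hasDerivAt_reducedAction {x' y' : ℝ} (hμ : 0 < μ) (hX : HasDerivAt X x' z)
    (hY : HasDerivAt Y y' z) :
    HasDerivAt (fun z => reducedAction μ k (X z) (Y z))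
      ((profileSpeed μ (X z) - (X z + Y z) / k) * x' +
        (profileSpeed μ (Y z) - (X z + Y z) / k) * y') z := by
  have hsq := ((hX.add hY).pow 2).div_const (2 * k)
  refine ((((hasDerivAt_profileAction hμ (X z)).comp z hX).add
    ((hasDerivAt_profileAction hμ (Y z)).comp z hY)).sub hsq).congr_deriv ?_
  simp only [Pi.add_apply, Nat.cast_ofNat, Nat.add_one_sub_one, pow_one]
  rw [mul_assoc 2, mul_div_mul_left _ _ two_ne_zero]
  ring

lemma isRayMinimax_of_forall_slope
    (h : ∀ r ∈ Icc (0 : ℝ) 1, ∃ a ∈ Icc (0 : ℝ) 1,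
      reducedAction μ k x y ≤ reducedAction μ k a (r * a)) :
    IsRayMinimax μ k x y := by
  have hbelow {A B c : ℝ} (hB : 0 ≤ B) (hBA : B ≤ A) (hA : 0 < A)
      (hc : ∀ t, 0 ≤ t → t * A ≤ 1 → t * B ≤ 1 → reducedAction μ k (t * A) (t * B) ≤ c) :
      reducedAction μ k x y ≤ c := by
    have hr : B / A ≤ 1 := div_le_one_of_le₀ hBA hA.le
    obtain ⟨a, ⟨ha0, ha1⟩, ha⟩ := h (B / A) ⟨div_nonneg hB hA.le, hr⟩
    refine ha.trans ?_
    have hle := hc (a / A) (div_nonneg ha0 hA.le)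
    rw [div_mul_cancel₀ a hA.ne', div_mul_eq_mul_div, mul_comm a, ← div_mul_eq_mul_div] at hle
    exact hle ha1 (mul_le_one₀ hr ha0 ha1)
  intro A B c hA hB hAB hc
  rcases le_total B A with hle | hle
  · exact hbelow hB hle (by rwa [max_eq_left hle] at hAB) hc
  · refine hbelow hA hle (by rwa [max_eq_right hle] at hAB) fun t ht htB htA => ?_
    rw [reducedAction_comm]
    exact hc t ht htA htB

lemma isRayMinimax_of_curve {x₀ x₁ : ℝ} (hμ : 0 < μ) (hX : ∀ z, 0 < z → X z ∈ Icc 0 1)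
    (hX₀ : Tendsto X (𝓝[>] 0) (𝓝 x₀)) (hX₁ : Tendsto X atTop (𝓝 x₁))
    (hmin : ∀ z, 0 < z → reducedAction μ k x y ≤ reducedAction μ k (X z) (Real.exp (-z) * X z)) :
    IsRayMinimax μ k x y := by
  have hlim {l : Filter ℝ} [l.NeBot] {a r : ℝ} (hl : ∀ᶠ z in l, 0 < z) (ha : Tendsto X l (𝓝 a))
      (hr : Tendsto (fun z => Real.exp (-z)) l (𝓝 r)) :
      ∃ a ∈ Icc (0 : ℝ) 1, reducedAction μ k x y ≤ reducedAction μ k a (r * a) :=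
    ⟨a, isClosed_Icc.mem_of_tendsto ha (hl.mono hX),
      ge_of_tendsto (tendsto_reducedAction hμ ha (hr.mul ha)) (hl.mono hmin)⟩
  refine isRayMinimax_of_forall_slope fun r ⟨hr0, hr1⟩ => ?_
  rcases hr0.eq_or_lt with rfl | hr0
  · exact hlim (eventually_gt_atTop 0) hX₁ Real.tendsto_exp_neg_atTop_nhds_zero
  rcases hr1.eq_or_lt with rfl | hr1
  · have hcont : Continuous fun z : ℝ => Real.exp (-z) := by fun_prop
    refine hlim (l := 𝓝[>] 0) self_mem_nhdsWithin hX₀ ?_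
    simpa using (hcont.tendsto 0).mono_left nhdsWithin_le_nhds
  · have hz : 0 < -Real.log r := neg_pos.2 (Real.log_neg hr0 hr1)
    have hle := hmin _ hz
    rw [neg_neg, Real.exp_log hr0] at hle
    exact ⟨_, hX _ hz, hle⟩

end RayMinimax

section AsymmetricMinimax

variable {μ k z z₀ : ℝ}

lemma hasDerivAt_reducedAction_scaled_branch (k a : ℝ) (hμ : 0 < μ) (hz : 0 < z) :
    HasDerivAt (fun z => reducedAction μ k (a * branchRight μ z) (a * branchLeft μ z))
      ((profileSpeed μ (a * branchRight μ z) - profileSpeed μ (a * branchLeft μ z)) *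
        (a * branchRight μ z * ((1 - (mcoth (μ + 1) z - mcoth 1 z) / μ) / 2)) +
      ((a * branchRight μ z + a * branchLeft μ z) / k - profileSpeed μ (a * branchLeft μ z)) *
        (jumpRate μ z * (a * branchRight μ z + a * branchLeft μ z))) z := by
  refine (hasDerivAt_reducedAction hμ ((hasDerivAt_branchRight hμ hz).const_mul a)
    ((hasDerivAt_branchLeft hμ hz).const_mul a)).congr_deriv ?_
  linear_combination (profileSpeed μ (a * branchLeft μ z) -
    (a * branchRight μ z + a * branchLeft μ z) / k) * a * branch_log_deriv μ z

lemma hasDerivAt_reducedAction_branch (k : ℝ) (hμ : 0 < μ) (hz : 0 < z) :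
    HasDerivAt (fun z => reducedAction μ k (branchRight μ z) (branchLeft μ z))
      ((1 / k - 1 / branchParam μ z) *
        (jumpRate μ z * (branchRight μ z + branchLeft μ z) ^ 2)) z := by
  have hderiv := hasDerivAt_reducedAction_scaled_branch k 1 hμ hz
  simp only [one_mul] at hderiv
  refine hderiv.congr_deriv ?_
  rw [profileSpeed_branchRight hμ hz, profileSpeed_branchLeft hμ hz,
    ← branch_add_div_branchParam hμ hz]
  ring

lemma reducedAction_branch_rate_pos (hμ : 0 < μ) (hz : 0 < z) :
    0 < jumpRate μ z * (branchRight μ z + branchLeft μ z) ^ 2 :=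
  mul_pos (jumpRate_pos hμ hz)
    (pow_pos (add_pos (branchRight_pos hμ hz) (branchLeft_pos hμ hz)) 2)

lemma antitoneOn_reducedAction_branch (hμ : 0 < μ) (hz₀ : 0 < z₀) :
    AntitoneOn (fun z => reducedAction μ (branchParam μ z₀) (branchRight μ z) (branchLeft μ z))
      (Ioc 0 z₀) := by
  have hderiv {z : ℝ} (hz : 0 < z) := hasDerivAt_reducedAction_branch (branchParam μ z₀) hμ hz
  refine antitoneOn_of_deriv_nonpos (convex_Ioc 0 z₀)
    (fun z hz => (hderiv hz.1).continuousAt.continuousWithinAt) (fun z hz => ?_) fun z hz => ?_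
  · rw [interior_Ioc] at hz
    exact (hderiv hz.1).differentiableAt.differentiableWithinAt
  · rw [interior_Ioc] at hz
    rw [(hderiv hz.1).deriv]
    exact mul_nonpos_of_nonpos_of_nonneg (sub_nonpos.2 (one_div_le_one_div_of_le
      (branchParam_pos hμ hz.1) (strictMonoOn_branchParam hμ (mem_Ioi.2 hz.1) (mem_Ioi.2 hz₀)
      hz.2).le)) (reducedAction_branch_rate_pos hμ hz.1).le

lemma monotoneOn_reducedAction_branch (hμ : 0 < μ) (hz₀ : 0 < z₀) :
    MonotoneOn (fun z => reducedAction μ (branchParam μ z₀) (branchRight μ z) (branchLeft μ z))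
      (Ici z₀) := by
  have hderiv {z : ℝ} (hz : z₀ ≤ z) :=
    hasDerivAt_reducedAction_branch (branchParam μ z₀) hμ (hz₀.trans_le hz)
  refine monotoneOn_of_deriv_nonneg (convex_Ici z₀)
    (fun z hz => (hderiv hz).continuousAt.continuousWithinAt) (fun z hz => ?_) fun z hz => ?_
  · exact (hderiv (interior_subset hz)).differentiableAt.differentiableWithinAt
  · have hz : z₀ ≤ z := interior_subset hz
    have hz0 := hz₀.trans_le hz
    rw [(hderiv hz).deriv]
    exact mul_nonneg (sub_nonneg.2 (one_div_le_one_div_of_le (branchParam_pos hμ hz₀)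
      ((strictMonoOn_branchParam hμ).monotoneOn (mem_Ioi.2 hz₀) (mem_Ioi.2 hz0) hz)))
      (reducedAction_branch_rate_pos hμ hz0).le

lemma isRayMinimax_branch (hμ : 0 < μ) (hz₀ : 0 < z₀) :
    IsRayMinimax μ (branchParam μ z₀) (branchRight μ z₀) (branchLeft μ z₀) := by
  refine isRayMinimax_of_curve hμ
    (fun z hz => ⟨(branchRight_pos hμ hz).le, (branchRight_lt_one hμ hz).le⟩)
    (tendsto_branchRight hμ) (tendsto_branchRight_atTop hμ) fun z hz => ?_
  rw [← branchLeft_eq]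
  rcases le_total z z₀ with hle | hle
  · exact antitoneOn_reducedAction_branch hμ hz₀ ⟨hz, hle⟩ ⟨hz₀, le_rfl⟩ hle
  · exact monotoneOn_reducedAction_branch hμ hz₀ (mem_Ici.2 le_rfl) hle hle

end AsymmetricMinimax

section SymmetricMinimax

variable {μ k a z : ℝ}

/-- The common boundary value of the symmetric stationary state. -/
noncomputable def symVal (μ k : ℝ) : ℝ := (1 - 4 / k ^ 2) ^ (1 / (2 * μ))

lemma one_sub_four_div_pos (hk : 2 < k) : 0 < 1 - 4 / k ^ 2 := by
  rw [sub_pos, div_lt_one (by positivity)]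
  nlinarith

lemma symVal_pos (hk : 2 < k) : 0 < symVal μ k :=
  Real.rpow_pos_of_pos (one_sub_four_div_pos hk) _

lemma symVal_rpow (hμ : 0 < μ) (hk : 2 < k) : symVal μ k ^ (2 * μ) = 1 - 4 / k ^ 2 := by
  rw [symVal, ← Real.rpow_mul (one_sub_four_div_pos hk).le, one_div_mul_cancel (by positivity),
    Real.rpow_one]

lemma symVal_lt_one (hμ : 0 < μ) (hk : 2 < k) : symVal μ k < 1 :=
  Real.rpow_lt_one (one_sub_four_div_pos hk).le (sub_lt_self _ (by positivity)) (by positivity)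

lemma profileSpeed_symVal (hμ : 0 < μ) (hk : 2 < k) :
    profileSpeed μ (symVal μ k) = (symVal μ k + symVal μ k) / k := by
  have hsq : 4 / k ^ 2 = (2 / k) ^ 2 := by
    rw [div_pow]
    norm_num
  rw [profileSpeed, symVal_rpow hμ hk, sub_sub_cancel, hsq, Real.sqrt_sq (by positivity)]
  ring

lemma isCritical_symVal (hμ : 0 < μ) (hk : 2 < k) :
    IsCritical μ k (symVal μ k) (symVal μ k) where
  left_mem := ⟨symVal_pos hk, symVal_lt_one hμ hk⟩
  right_mem := ⟨symVal_pos hk, symVal_lt_one hμ hk⟩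
  profileSpeed_left := profileSpeed_symVal hμ hk
  profileSpeed_right := profileSpeed_symVal hμ hk

lemma sq_bifParam (hμ : 0 < μ) : bifParam μ ^ 2 = 4 * ((μ + 1) / μ) := by
  rw [bifParam, mul_pow, Real.sq_sqrt (by positivity)]
  norm_num

lemma two_lt_bifParam (hμ : 0 < μ) : 2 < bifParam μ := by
  have hratio : 1 < (μ + 1) / μ := (one_lt_div hμ).2 (lt_add_one μ)
  rw [bifParam]
  linarith [Real.lt_sqrt_of_sq_lt (show (1 : ℝ) ^ 2 < (μ + 1) / μ by linarith)]

/-- The factor by which the curve `(branchRight μ z, branchLeft μ z)` is scaled so that it starts at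
the symmetric state with parameter `k`. -/
noncomputable def symScale (μ k : ℝ) : ℝ := ((μ + 1) * (1 - 4 / k ^ 2)) ^ (1 / (2 * μ))

lemma symScale_base_pos (hμ : 0 < μ) (hk : 2 < k) : 0 < (μ + 1) * (1 - 4 / k ^ 2) :=
  mul_pos (by linarith) (one_sub_four_div_pos hk)

lemma symScale_pos (hμ : 0 < μ) (hk : 2 < k) : 0 < symScale μ k :=
  Real.rpow_pos_of_pos (symScale_base_pos hμ hk) _

lemma symScale_rpow (hμ : 0 < μ) (hk : 2 < k) :
    symScale μ k ^ (2 * μ) = (μ + 1) * (1 - 4 / k ^ 2) := by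
  rw [symScale, ← Real.rpow_mul (symScale_base_pos hμ hk).le, one_div_mul_cancel (by positivity),
    Real.rpow_one]

lemma sq_le_of_le_bifParam (hμ : 0 < μ) (hk : 2 < k) (hkb : k ≤ bifParam μ) :
    k ^ 2 ≤ 4 * ((μ + 1) / μ) := by
  rw [← sq_bifParam hμ]
  exact pow_le_pow_left₀ (by linarith) hkb 2

lemma symScale_le_one (hμ : 0 < μ) (hk : 2 < k) (hkb : k ≤ bifParam μ) : symScale μ k ≤ 1 := by
  have hk2 := sq_le_of_le_bifParam hμ hk hkb
  rw [mul_div_assoc', le_div_iff₀ hμ] at hk2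
  refine Real.rpow_le_one (symScale_base_pos hμ hk).le ?_ (by positivity)
  rw [one_sub_div (by positivity), mul_div_assoc', div_le_one (by positivity)]
  linarith

lemma symScale_mul (hμ : 0 < μ) (hk : 2 < k) :
    symScale μ k * (1 / (μ + 1)) ^ (1 / (2 * μ)) = symVal μ k := by
  rw [symScale, ← Real.mul_rpow (symScale_base_pos hμ hk).le (by positivity), mul_comm (μ + 1),
    mul_assoc, mul_one_div_cancel (by positivity), mul_one, symVal]

lemma profileSpeed_mul_branchLeft_le (hμ : 0 < μ) (hz : 0 < z) (ha : 0 ≤ a) (ha1 : a ≤ 1) :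
    profileSpeed μ (a * branchLeft μ z) ≤ profileSpeed μ (a * branchRight μ z) := by
  have hR := (branchRight_pos hμ hz).le
  have hL := (branchLeft_pos hμ hz).le
  have hsq {s : ℝ} (hs : 0 ≤ s) (hs1 : s ≤ 1) : profileSpeed μ (a * s) ^ 2 =
      a ^ 2 * a ^ (2 * μ) * profileSpeed μ s ^ 2 + a ^ 2 * (1 - a ^ (2 * μ)) * s ^ 2 := by
    rw [sq_profileSpeed hμ (mul_nonneg ha hs) (mul_le_one₀ ha1 hs hs1), sq_profileSpeed hμ hs hs1,
      rpow_two_mul_add_two (mul_nonneg ha hs) hμ, rpow_two_mul_add_two hs hμ, Real.mul_rpow ha hs]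
    ring
  rw [← pow_le_pow_iff_left₀ (profileSpeed_nonneg (mul_nonneg ha hL))
    (profileSpeed_nonneg (mul_nonneg ha hR)) two_ne_zero, hsq hL (branchLeft_lt_one hμ hz).le,
    hsq hR (branchRight_lt_one hμ hz).le, profileSpeed_branchRight hμ hz,
    profileSpeed_branchLeft hμ hz]
  have := sub_nonneg.2 (Real.rpow_le_one ha ha1 (show 0 ≤ 2 * μ by positivity))
  have := (branchLeft_lt_branchRight hμ hz).le
  gcongr

lemma branchLeft_rpow_le (hμ : 0 < μ) (hz : 0 < z) : (μ + 1) * branchLeft μ z ^ (2 * μ) ≤ 1 := by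
  have hratio : sinhRatio 1 (μ + 1) z ≤ 1 / (μ + 1) :=
    sinhRatio_le one_pos (lt_add_of_pos_left 1 hμ) hz
  rw [branchLeft_rpow hμ hz, ← exp_neg_mul_sinhRatio hμ hz, ← le_div_iff₀' (by linarith)]
  exact (mul_le_of_le_one_left (sinhRatio_pos one_pos (by linarith) hz).le
    (Real.exp_le_one_iff.2 (neg_nonpos.2 (mul_pos hμ hz).le))).trans hratio

lemma sq_two_mul_cosh_half_mul_exp (z : ℝ) :
    (2 * Real.cosh (z / 2)) ^ 2 * Real.exp z = (1 + Real.exp z) ^ 2 := by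
  have hinv : Real.exp z * Real.exp (-z) = 1 := by
    rw [← Real.exp_add, add_neg_cancel, Real.exp_zero]
  have hcosh := cosh_eq_half z
  rw [← sub_eq_iff_eq_add'.2 (Real.cosh_sq' (z / 2)), Real.cosh_eq] at hcosh
  linear_combination 2 * Real.exp z * (-hcosh) + hinv

lemma one_sub_branchLeft_rpow_le (hμ : 0 < μ) (hz : 0 < z) :
    4 * ((μ + 1) / μ) * (1 - branchLeft μ z ^ (2 * μ)) ≤ (1 + Real.exp z) ^ 2 := by
  have hratio := sinhRatio_pos hμ (add_pos hμ one_pos) hz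
  have hsq := pow_le_pow_left₀ (by linarith [two_lt_bifParam hμ])
    (bifParam_lt_branchParam hμ hz).le 2
  rw [sq_bifParam hμ, branchParam, div_pow, Real.sq_sqrt hratio.le, le_div_iff₀ hratio] at hsq
  rw [branchLeft_rpow hμ hz, sub_sub_cancel, mul_left_comm, mul_comm,
    ← sq_two_mul_cosh_half_mul_exp]
  exact mul_le_mul_of_nonneg_right hsq (Real.exp_pos z).le

lemma sq_mul_one_sub_symScale_rpow_le (hμ : 0 < μ) (hz : 0 < z) (hk : 2 < k)
    (hkb : k ≤ bifParam μ) :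
    k ^ 2 * (1 - (symScale μ k * branchLeft μ z) ^ (2 * μ)) ≤ (1 + Real.exp z) ^ 2 := by
  rw [Real.mul_rpow (symScale_pos hμ hk).le (branchLeft_pos hμ hz).le, symScale_rpow hμ hk]
  refine le_trans ?_ (one_sub_branchLeft_rpow_le hμ hz)
  set β := branchLeft μ z ^ (2 * μ)
  calc k ^ 2 * (1 - (μ + 1) * (1 - 4 / k ^ 2) * β)
      = k ^ 2 * (1 - (μ + 1) * β) + 4 * ((μ + 1) * β) := by
        field_simp
        ring
    _ ≤ 4 * ((μ + 1) / μ) * (1 - (μ + 1) * β) + 4 * ((μ + 1) * β) :=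
        add_le_add_left (mul_le_mul_of_nonneg_right (sq_le_of_le_bifParam hμ hk hkb)
          (sub_nonneg.2 (branchLeft_rpow_le hμ hz))) _
    _ = 4 * ((μ + 1) / μ) * (1 - β) := by
        field_simp
        ring

lemma profileSpeed_symScale_mul_branchLeft_le (hμ : 0 < μ) (hz : 0 < z) (hk : 2 < k)
    (hkb : k ≤ bifParam μ) :
    profileSpeed μ (symScale μ k * branchLeft μ z) ≤
      (symScale μ k * branchRight μ z + symScale μ k * branchLeft μ z) / k := by
  have : 0 < k := by linarith
  have hsum : symScale μ k * branchRight μ z + symScale μ k * branchLeft μ z =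
      symScale μ k * branchLeft μ z * (1 + Real.exp z) := by
    rw [branchLeft_eq, Real.exp_neg]
    field_simp
    ring
  rw [hsum, profileSpeed, mul_div_assoc]
  refine mul_le_mul_of_nonneg_left (Real.sqrt_le_iff.2 ⟨by positivity, ?_⟩)
    (mul_pos (symScale_pos hμ hk) (branchLeft_pos hμ hz)).le
  rw [div_pow, le_div_iff₀' (by positivity)]
  exact sq_mul_one_sub_symScale_rpow_le hμ hz hk hkb

lemma monotoneOn_reducedAction_symScale_branch (hμ : 0 < μ) (hk : 2 < k) (hkb : k ≤ bifParam μ) :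
    MonotoneOn (fun z => reducedAction μ k (symScale μ k * branchRight μ z)
      (symScale μ k * branchLeft μ z)) (Ioi 0) := by
  have hderiv {z : ℝ} (hz : 0 < z) := hasDerivAt_reducedAction_scaled_branch k (symScale μ k) hμ hz
  have ha := symScale_pos hμ hk
  refine monotoneOn_of_deriv_nonneg (convex_Ioi 0)
    (fun z hz => (hderiv hz).continuousAt.continuousWithinAt)
    (fun z hz => (hderiv (interior_subset hz)).differentiableAt.differentiableWithinAt)
    fun z hz => ?_
  have hz : 0 < z := interior_subset hz
  have hR := branchRight_pos hμ hz
  have hL := branchLeft_pos hμ hz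
  have hlog : (mcoth (μ + 1) z - mcoth 1 z) / μ ≤ 1 := by
    rw [div_le_one hμ]
    linarith [mcoth_sub_le one_pos (show 1 ≤ μ + 1 by linarith) hz]
  rw [(hderiv hz).deriv]
  refine add_nonneg (mul_nonneg (sub_nonneg.2 ?_) (mul_nonneg (mul_pos ha hR).le (by linarith)))
    (mul_nonneg (sub_nonneg.2 ?_) (mul_nonneg (jumpRate_pos hμ hz).le (by positivity)))
  · exact profileSpeed_mul_branchLeft_le hμ hz ha.le (symScale_le_one hμ hk hkb)
  · exact profileSpeed_symScale_mul_branchLeft_le hμ hz hk hkb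

lemma isRayMinimax_symVal (hμ : 0 < μ) (hk : 2 < k) (hkb : k ≤ bifParam μ) :
    IsRayMinimax μ k (symVal μ k) (symVal μ k) := by
  have ha := (symScale_pos hμ hk).le
  have hR := (tendsto_branchRight hμ).const_mul (symScale μ k)
  have hL := (tendsto_branchLeft hμ).const_mul (symScale μ k)
  rw [symScale_mul hμ hk] at hR hL
  refine isRayMinimax_of_curve hμ
    (fun z hz => ⟨mul_nonneg ha (branchRight_pos hμ hz).le,
      mul_le_one₀ (symScale_le_one hμ hk hkb) (branchRight_pos hμ hz).le
        (branchRight_lt_one hμ hz).le⟩)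
    hR ((tendsto_branchRight_atTop hμ).const_mul (symScale μ k)) fun z hz => ?_
  rw [mul_left_comm, ← branchLeft_eq]
  refine le_of_tendsto (tendsto_reducedAction hμ hR hL) ?_
  filter_upwards [Ioo_mem_nhdsGT hz] with s hs
  exact monotoneOn_reducedAction_symScale_branch hμ hk hkb (mem_Ioi.2 hs.1) (mem_Ioi.2 hz) hs.2.le

end SymmetricMinimax

/-! ### The minimax value as a function of the parameter `k` -/

lemma hasDerivAt_of_eventually_punctured {f g : ℝ → ℝ} {a : ℝ}
    (hd : ∀ᶠ y in 𝓝[≠] a, HasDerivAt f (g y) y) (hf : ContinuousAt f a) (hg : ContinuousAt g a) :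
    HasDerivAt f (g a) a := by
  obtain ⟨s, hs, hds⟩ := (eventually_nhdsWithin_iff.1 hd).exists_mem
  have hderiv {t : Set ℝ} (hat : a ∉ t) : Tendsto (deriv f) (𝓝[t] a) (𝓝 (g a)) := by
    refine (hg.tendsto.mono_left nhdsWithin_le_nhds).congr' ?_
    filter_upwards [self_mem_nhdsWithin, mem_nhdsWithin_of_mem_nhds hs] with y hyt hys
    exact (hds y hys (ne_of_mem_of_not_mem hyt hat)).deriv.symm
  have hdiff {t : Set ℝ} (hat : a ∉ t) : DifferentiableOn ℝ f (s ∩ t) := fun y hy =>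
    (hds y hy.1 (ne_of_mem_of_not_mem hy.2 hat)).differentiableAt.differentiableWithinAt
  have hright := hasDerivWithinAt_Ici_of_tendsto_deriv (hdiff self_notMem_Ioi)
    hf.continuousWithinAt (inter_mem (mem_nhdsWithin_of_mem_nhds hs) self_mem_nhdsWithin)
    (hderiv self_notMem_Ioi)
  have hleft := hasDerivWithinAt_Iic_of_tendsto_deriv (hdiff self_notMem_Iio)
    hf.continuousWithinAt (inter_mem (mem_nhdsWithin_of_mem_nhds hs) self_mem_nhdsWithin)
    (hderiv self_notMem_Iio)
  simpa only [Iic_union_Ici, hasDerivWithinAt_univ] using hleft.union hright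

section Crit

variable {μ k z : ℝ}

/-- The inverse of `branchParam`. -/
noncomputable def branchInv (μ k : ℝ) : ℝ := Function.invFunOn (branchParam μ) (Ioi 0) k

lemma branchInv_pos (hμ : 0 < μ) (hk : bifParam μ < k) : 0 < branchInv μ k :=
  Function.invFunOn_mem (exists_branchParam_eq hμ hk)

lemma branchParam_branchInv (hμ : 0 < μ) (hk : bifParam μ < k) :
    branchParam μ (branchInv μ k) = k :=
  Function.invFunOn_eq (exists_branchParam_eq hμ hk)

lemma branchInv_lt_iff (hμ : 0 < μ) (hk : bifParam μ < k) (hz : 0 < z) :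
    branchInv μ k < z ↔ k < branchParam μ z := by
  rw [← (strictMonoOn_branchParam hμ).lt_iff_lt (mem_Ioi.2 (branchInv_pos hμ hk)) (mem_Ioi.2 hz),
    branchParam_branchInv hμ hk]

lemma strictMonoOn_branchInv (hμ : 0 < μ) : StrictMonoOn (branchInv μ) (Ioi (bifParam μ)) :=
  fun k hk l hl hkl => by
    rwa [branchInv_lt_iff hμ hk (branchInv_pos hμ hl), branchParam_branchInv hμ hl]

lemma continuousAt_branchInv (hμ : 0 < μ) (hk : bifParam μ < k) :
    ContinuousAt (branchInv μ) k := by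
  refine (strictMonoOn_branchInv hμ).continuousAt_of_image_mem_nhds (Ioi_mem_nhds hk) ?_
  filter_upwards [Ioi_mem_nhds (branchInv_pos hμ hk)] with z hz
  have hz' := bifParam_lt_branchParam hμ hz
  exact ⟨branchParam μ z, hz', (strictMonoOn_branchParam hμ).injOn
    (mem_Ioi.2 (branchInv_pos hμ hz')) hz (branchParam_branchInv hμ hz')⟩

lemma hasDerivAt_branchInv (hμ : 0 < μ) (hk : bifParam μ < k) :
    HasDerivAt (branchInv μ) (k * paramRate μ (branchInv μ k))⁻¹ k := by
  have hz := branchInv_pos hμ hk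
  have hparam := hasDerivAt_branchParam hμ hz
  rw [branchParam_branchInv hμ hk] at hparam
  have hk0 : 0 < k := by linarith [two_lt_bifParam hμ]
  refine hparam.of_local_left_inverse (continuousAt_branchInv hμ hk)
    (mul_pos hk0 (paramRate_pos hμ hz)).ne' ?_
  filter_upwards [Ioi_mem_nhds hk] with l hl using branchParam_branchInv hμ hl

lemma tendsto_branchInv (hμ : 0 < μ) :
    Tendsto (branchInv μ) (𝓝[>] (bifParam μ)) (𝓝[>] 0) := by
  have hpos : ∀ᶠ k in 𝓝[>] (bifParam μ), 0 < branchInv μ k := by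
    filter_upwards [self_mem_nhdsWithin] with k hk using branchInv_pos hμ hk
  refine tendsto_nhdsWithin_iff.2 ⟨tendsto_order.2 ⟨fun a ha => ?_, fun a ha => ?_⟩, hpos⟩
  · filter_upwards [hpos] with k hk using ha.trans hk
  · filter_upwards [Ioo_mem_nhdsGT (bifParam_lt_branchParam hμ ha)] with k hk
    exact (branchInv_lt_iff hμ hk.1 ha).2 hk.2

/-- The larger boundary value of the ground state, rescaled by its amplitude: the profile is
symmetric up to the bifurcation and asymmetric beyond it. -/
noncomputable def critRight (μ k : ℝ) : ℝ :=
  if k ≤ bifParam μ then symVal μ k else branchRight μ (branchInv μ k)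

/-- The modulus of the other boundary value of the ground state, rescaled by its amplitude. -/
noncomputable def critLeft (μ k : ℝ) : ℝ :=
  if k ≤ bifParam μ then symVal μ k else branchLeft μ (branchInv μ k)

lemma critRight_of_le (hk : k ≤ bifParam μ) : critRight μ k = symVal μ k := if_pos hk

lemma critLeft_of_le (hk : k ≤ bifParam μ) : critLeft μ k = symVal μ k := if_pos hk

lemma critRight_of_lt (hk : bifParam μ < k) :
    critRight μ k = branchRight μ (branchInv μ k) := if_neg (not_le.2 hk)

lemma critLeft_of_lt (hk : bifParam μ < k) :
    critLeft μ k = branchLeft μ (branchInv μ k) := if_neg (not_le.2 hk)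

lemma isCritical_crit (hμ : 0 < μ) (hk : 2 < k) :
    IsCritical μ k (critRight μ k) (critLeft μ k) := by
  rcases le_or_gt k (bifParam μ) with hle | hlt
  · rw [critRight_of_le hle, critLeft_of_le hle]
    exact isCritical_symVal hμ hk
  · rw [critRight_of_lt hlt, critLeft_of_lt hlt]
    simpa only [branchParam_branchInv hμ hlt] using isCritical_branch hμ (branchInv_pos hμ hlt)

lemma isRayMinimax_crit (hμ : 0 < μ) (hk : 2 < k) :
    IsRayMinimax μ k (critRight μ k) (critLeft μ k) := by
  rcases le_or_gt k (bifParam μ) with hle | hlt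
  · rw [critRight_of_le hle, critLeft_of_le hle]
    exact isRayMinimax_symVal hμ hk hle
  · rw [critRight_of_lt hlt, critLeft_of_lt hlt]
    simpa only [branchParam_branchInv hμ hlt] using isRayMinimax_branch hμ (branchInv_pos hμ hlt)

lemma hasDerivAt_symVal (hμ : 0 < μ) (hk : 2 < k) :
    HasDerivAt (symVal μ) (symVal μ k * (4 / (μ * k * (k ^ 2 - 4)))) k := by
  have hbase := one_sub_four_div_pos hk
  have : k ^ 2 - 4 ≠ 0 := by nlinarith
  have hk0 : k ≠ 0 := by linarith
  have hderiv : HasDerivAt (fun k : ℝ => 1 - 4 / k ^ 2) (8 / k ^ 3) k := by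
    refine (((hasDerivAt_const k (4 : ℝ)).div (hasDerivAt_pow 2 k)
      (pow_ne_zero 2 hk0)).const_sub 1).congr_deriv ?_
    field_simp
    norm_num
    ring
  refine (hderiv.rpow_const (p := 1 / (2 * μ)) (Or.inl hbase.ne')).congr_deriv ?_
  have hbase_eq : 1 - 4 / k ^ 2 = (k ^ 2 - 4) / k ^ 2 := by field_simp
  rw [Real.rpow_sub_one hbase.ne', ← symVal, hbase_eq]
  field_simp
  ring

lemma sq_bifParam_sub (hμ : 0 < μ) : bifParam μ ^ 2 - 4 = 4 / μ := by
  rw [sq_bifParam hμ]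
  field_simp
  ring

lemma symVal_bifParam (hμ : 0 < μ) :
    symVal μ (bifParam μ) = (1 / (μ + 1)) ^ (1 / (2 * μ)) := by
  rw [symVal, sq_bifParam hμ]
  congr 1
  field_simp
  ring

lemma continuousAt_critRight (hμ : 0 < μ) : ContinuousAt (critRight μ) (bifParam μ) := by
  refine continuousAt_iff_continuous_left'_right'.2 ⟨?_, ?_⟩
  · exact ((hasDerivAt_symVal hμ (two_lt_bifParam hμ)).continuousAt.continuousWithinAt).congr
      (fun k hk => critRight_of_le (le_of_lt hk)) (critRight_of_le le_rfl)
  · rw [ContinuousWithinAt, critRight_of_le le_rfl, symVal_bifParam hμ]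
    refine ((tendsto_branchRight hμ).comp (tendsto_branchInv hμ)).congr' ?_
    filter_upwards [self_mem_nhdsWithin] with k hk using (critRight_of_lt hk).symm

lemma continuousAt_critLeft (hμ : 0 < μ) : ContinuousAt (critLeft μ) (bifParam μ) := by
  refine continuousAt_iff_continuous_left'_right'.2 ⟨?_, ?_⟩
  · exact ((hasDerivAt_symVal hμ (two_lt_bifParam hμ)).continuousAt.continuousWithinAt).congr
      (fun k hk => critLeft_of_le (le_of_lt hk)) (critLeft_of_le le_rfl)
  · rw [ContinuousWithinAt, critLeft_of_le le_rfl, symVal_bifParam hμ]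
    refine ((tendsto_branchLeft hμ).comp (tendsto_branchInv hμ)).congr' ?_
    filter_upwards [self_mem_nhdsWithin] with k hk using (critLeft_of_lt hk).symm

/-- The minimax value of the reduced action, attained at the boundary values of the ground state. -/
noncomputable def minimaxValue (μ k : ℝ) : ℝ := reducedAction μ k (critRight μ k) (critLeft μ k)

/-- The square of the jump of the rescaled ground state; its two boundary values have opposite
signs. -/
noncomputable def jumpSq (μ k : ℝ) : ℝ := (critRight μ k + critLeft μ k) ^ 2

/-- The logarithmic derivative of `jumpSq` with respect to `log k`. -/
noncomputable def jumpSqRate (μ k : ℝ) : ℝ :=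
  if k ≤ bifParam μ then 8 / (μ * (k ^ 2 - 4))
  else -2 * (jumpRate μ (branchInv μ k) / paramRate μ (branchInv μ k))

lemma jumpSqRate_of_le (hk : k ≤ bifParam μ) : jumpSqRate μ k = 8 / (μ * (k ^ 2 - 4)) := if_pos hk

lemma jumpSqRate_of_lt (hk : bifParam μ < k) :
    jumpSqRate μ k = -2 * (jumpRate μ (branchInv μ k) / paramRate μ (branchInv μ k)) :=
  if_neg (not_le.2 hk)

lemma continuousAt_minimaxValue_bifParam (hμ : 0 < μ) :
    ContinuousAt (minimaxValue μ) (bifParam μ) := by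
  have hR := continuousAt_critRight hμ
  have hL := continuousAt_critLeft hμ
  have hb : bifParam μ ≠ 0 := by linarith [two_lt_bifParam hμ]
  exact (((continuous_profileAction hμ).continuousAt.comp hR).add
    ((continuous_profileAction hμ).continuousAt.comp hL)).sub
      (((hR.add hL).pow 2).div (by fun_prop) (mul_ne_zero two_ne_zero hb))

lemma continuousAt_jumpSq_bifParam (hμ : 0 < μ) : ContinuousAt (jumpSq μ) (bifParam μ) :=
  ((continuousAt_critRight hμ).add (continuousAt_critLeft hμ)).pow 2

/-- Along a curve of critical points only the explicit dependence on `k` contributes. -/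
lemma IsCritical.hasDerivAt_reducedAction {x' y' : ℝ} (hμ : 0 < μ) (hk : k ≠ 0) {X Y : ℝ → ℝ}
    (h : IsCritical μ k (X k) (Y k)) (hX : HasDerivAt X x' k) (hY : HasDerivAt Y y' k) :
    HasDerivAt (fun k => reducedAction μ k (X k) (Y k)) ((X k + Y k) ^ 2 / (2 * k ^ 2)) k := by
  have hprofX := (hasDerivAt_profileAction hμ (X k)).comp k hX
  have hprofY := (hasDerivAt_profileAction hμ (Y k)).comp k hY
  have hjump := ((hX.add hY).pow 2).div ((hasDerivAt_id k).const_mul 2)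
    (mul_ne_zero two_ne_zero hk)
  refine ((hprofX.add hprofY).sub hjump).congr_deriv ?_
  rw [h.profileSpeed_left, h.profileSpeed_right]
  simp only [Pi.add_apply, Pi.pow_apply, Nat.cast_ofNat, Nat.add_one_sub_one, pow_one, id]
  field_simp
  ring

lemma hasDerivAt_branchRight_branchInv (hμ : 0 < μ) (hk : bifParam μ < k) :
    HasDerivAt (fun k => branchRight μ (branchInv μ k)) (branchRight μ (branchInv μ k) *
      ((1 - (mcoth (μ + 1) (branchInv μ k) - mcoth 1 (branchInv μ k)) / μ) / 2) *
      (k * paramRate μ (branchInv μ k))⁻¹) k :=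
  (hasDerivAt_branchRight hμ (branchInv_pos hμ hk)).comp k (hasDerivAt_branchInv hμ hk)

lemma hasDerivAt_branchLeft_branchInv (hμ : 0 < μ) (hk : bifParam μ < k) :
    HasDerivAt (fun k => branchLeft μ (branchInv μ k)) (branchLeft μ (branchInv μ k) *
      ((-1 - (mcoth (μ + 1) (branchInv μ k) - mcoth 1 (branchInv μ k)) / μ) / 2) *
      (k * paramRate μ (branchInv μ k))⁻¹) k :=
  (hasDerivAt_branchLeft hμ (branchInv_pos hμ hk)).comp k (hasDerivAt_branchInv hμ hk)

lemma critRight_eventuallyEq_symVal (hk : k < bifParam μ) : critRight μ =ᶠ[𝓝 k] symVal μ := by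
  filter_upwards [Iio_mem_nhds hk] with l hl using critRight_of_le (le_of_lt hl)

lemma critLeft_eventuallyEq_symVal (hk : k < bifParam μ) : critLeft μ =ᶠ[𝓝 k] symVal μ := by
  filter_upwards [Iio_mem_nhds hk] with l hl using critLeft_of_le (le_of_lt hl)

lemma critRight_eventuallyEq_branchRight (hk : bifParam μ < k) :
    critRight μ =ᶠ[𝓝 k] fun k => branchRight μ (branchInv μ k) := by
  filter_upwards [Ioi_mem_nhds hk] with l hl using critRight_of_lt hl

lemma critLeft_eventuallyEq_branchLeft (hk : bifParam μ < k) :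
    critLeft μ =ᶠ[𝓝 k] fun k => branchLeft μ (branchInv μ k) := by
  filter_upwards [Ioi_mem_nhds hk] with l hl using critLeft_of_lt hl

lemma differentiableAt_critRight (hμ : 0 < μ) (hk : 2 < k) (hne : k ≠ bifParam μ) :
    DifferentiableAt ℝ (critRight μ) k := by
  rcases lt_or_gt_of_ne hne with hlt | hgt
  · exact (critRight_eventuallyEq_symVal hlt).differentiableAt_iff.2
      (hasDerivAt_symVal hμ hk).differentiableAt
  · exact (critRight_eventuallyEq_branchRight hgt).differentiableAt_iff.2
      (hasDerivAt_branchRight_branchInv hμ hgt).differentiableAt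

lemma differentiableAt_critLeft (hμ : 0 < μ) (hk : 2 < k) (hne : k ≠ bifParam μ) :
    DifferentiableAt ℝ (critLeft μ) k := by
  rcases lt_or_gt_of_ne hne with hlt | hgt
  · exact (critLeft_eventuallyEq_symVal hlt).differentiableAt_iff.2
      (hasDerivAt_symVal hμ hk).differentiableAt
  · exact (critLeft_eventuallyEq_branchLeft hgt).differentiableAt_iff.2
      (hasDerivAt_branchLeft_branchInv hμ hgt).differentiableAt

lemma hasDerivAt_minimaxValue_of_ne (hμ : 0 < μ) (hk : 2 < k) (hne : k ≠ bifParam μ) :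
    HasDerivAt (minimaxValue μ) (jumpSq μ k / (2 * k ^ 2)) k :=
  (isCritical_crit hμ hk).hasDerivAt_reducedAction hμ (by linarith)
    (differentiableAt_critRight hμ hk hne).hasDerivAt
    (differentiableAt_critLeft hμ hk hne).hasDerivAt

lemma hasDerivAt_minimaxValue (hμ : 0 < μ) (hk : 2 < k) :
    HasDerivAt (minimaxValue μ) (jumpSq μ k / (2 * k ^ 2)) k := by
  rcases eq_or_ne k (bifParam μ) with rfl | hne
  · refine hasDerivAt_of_eventually_punctured (g := fun k => jumpSq μ k / (2 * k ^ 2)) ?_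
      (continuousAt_minimaxValue_bifParam hμ) ?_
    · filter_upwards [self_mem_nhdsWithin, nhdsWithin_le_nhds (Ioi_mem_nhds hk)] with l hne hl
      exact hasDerivAt_minimaxValue_of_ne hμ hl hne
    · exact (continuousAt_jumpSq_bifParam hμ).div (by fun_prop) (by positivity)
  · exact hasDerivAt_minimaxValue_of_ne hμ hk hne

lemma hasDerivAt_jumpSq_of_lt (hμ : 0 < μ) (hk : 2 < k) (hlt : k < bifParam μ) :
    HasDerivAt (jumpSq μ) (jumpSq μ k * jumpSqRate μ k / k) k := by
  have hR := (hasDerivAt_symVal hμ hk).congr_of_eventuallyEq (critRight_eventuallyEq_symVal hlt)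
  have hL := (hasDerivAt_symVal hμ hk).congr_of_eventuallyEq (critLeft_eventuallyEq_symVal hlt)
  refine ((hR.add hL).pow 2).congr_deriv ?_
  have : k ^ 2 - 4 ≠ 0 := by nlinarith
  simp only [jumpSq, Pi.add_apply, critRight_of_le hlt.le, critLeft_of_le hlt.le,
    jumpSqRate_of_le hlt.le, Nat.cast_ofNat, Nat.add_one_sub_one, pow_one]
  field_simp
  ring

lemma hasDerivAt_jumpSq_of_gt (hμ : 0 < μ) (hgt : bifParam μ < k) :
    HasDerivAt (jumpSq μ) (jumpSq μ k * jumpSqRate μ k / k) k := by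
  have hR := (hasDerivAt_branchRight_branchInv hμ hgt).congr_of_eventuallyEq
    (critRight_eventuallyEq_branchRight hgt)
  have hL := (hasDerivAt_branchLeft_branchInv hμ hgt).congr_of_eventuallyEq
    (critLeft_eventuallyEq_branchLeft hgt)
  refine ((hR.add hL).pow 2).congr_deriv ?_
  have := paramRate_pos hμ (branchInv_pos hμ hgt)
  simp only [jumpSq, Pi.add_apply, critRight_of_lt hgt, critLeft_of_lt hgt,
    jumpSqRate_of_lt hgt, Nat.cast_ofNat, Nat.add_one_sub_one, pow_one]
  rw [← add_mul, branch_log_deriv]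
  field_simp

lemma hasDerivAt_jumpSq (hμ : 0 < μ) (hk : 2 < k) (hne : k ≠ bifParam μ) :
    HasDerivAt (jumpSq μ) (jumpSq μ k * jumpSqRate μ k / k) k :=
  (lt_or_gt_of_ne hne).elim (hasDerivAt_jumpSq_of_lt hμ hk) (hasDerivAt_jumpSq_of_gt hμ)

lemma tendsto_jumpSqRate_left (hμ : 0 < μ) :
    Tendsto (jumpSqRate μ) (𝓝[<] (bifParam μ)) (𝓝 2) := by
  have hval : 8 / (μ * (bifParam μ ^ 2 - 4)) = 2 := by
    rw [sq_bifParam_sub hμ, mul_div_cancel₀ _ hμ.ne']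
    norm_num
  have hcont : ContinuousAt (fun k : ℝ => 8 / (μ * (k ^ 2 - 4))) (bifParam μ) :=
    continuousAt_const.div (by fun_prop) (by rw [sq_bifParam_sub hμ]; positivity)
  refine Tendsto.congr' ?_ (hval ▸ hcont.tendsto.mono_left nhdsWithin_le_nhds)
  filter_upwards [self_mem_nhdsWithin] with k hk using (jumpSqRate_of_le (le_of_lt hk)).symm

lemma tendsto_jumpSqRate_right (hμ : 0 < μ) :
    Tendsto (jumpSqRate μ) (𝓝[>] (bifParam μ)) (𝓝 (-2 * ((2 * μ + 1) / (4 * μ + 5)))) := by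
  refine (((tendsto_jumpRate_div_paramRate hμ).comp (tendsto_branchInv hμ)).const_mul
    (-2)).congr' ?_
  filter_upwards [self_mem_nhdsWithin] with k hk using (jumpSqRate_of_lt hk).symm

end Crit

/-! ### The sign of the curvature -/

section Curvature

variable {μ k x : ℝ}

lemma mul_profileSpeed_div_two_lt_profileAction (hμ : 0 < μ) (hx : 0 < x) (hx1 : x ≤ 1) :
    x * profileSpeed μ x / 2 < profileAction μ x := by
  have hconst : x * profileSpeed μ x / 2 = ∫ s in (0 : ℝ)..x, s * √(1 - x ^ (2 * μ)) := by
    rw [intervalIntegral.integral_mul_const, integral_id, profileSpeed]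
    ring
  have h2μ : 0 < 2 * μ := by positivity
  rw [hconst, profileAction]
  refine intervalIntegral.integral_lt_integral_of_continuousOn_of_le_of_exists_lt hx
    (by fun_prop) (continuous_profileSpeed hμ).continuousOn (fun s hs => ?_)
    ⟨x / 2, ⟨by linarith, by linarith⟩, ?_⟩
  · exact mul_le_mul_of_nonneg_left (Real.sqrt_le_sqrt (sub_le_sub_left
      (Real.rpow_le_rpow hs.1.le hs.2 h2μ.le) 1)) hs.1.le
  · exact mul_lt_mul_of_pos_left (Real.sqrt_lt_sqrt
      (sub_nonneg.2 (Real.rpow_le_one hx.le hx1 h2μ.le))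
      (sub_lt_sub_left (Real.rpow_lt_rpow (half_pos hx).le (half_lt_self hx) h2μ) 1)) (half_pos hx)

lemma profileAction_le (hμ : 0 < μ) (hx : 0 ≤ x) : profileAction μ x ≤ x ^ 2 / 2 := by
  have hlin : x ^ 2 / 2 = ∫ s in (0 : ℝ)..x, s := by
    rw [integral_id]
    ring
  rw [hlin, profileAction]
  refine intervalIntegral.integral_mono_on hx ((continuous_profileSpeed hμ).intervalIntegrable _ _)
    (continuous_id.intervalIntegrable _ _) fun s hs => ?_
  exact mul_le_of_le_one_right hs.1
    (Real.sqrt_le_one.2 (sub_le_self 1 (Real.rpow_nonneg hs.1 (2 * μ))))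

lemma IsCritical.reducedAction_pos {y : ℝ} (hμ : 0 < μ) (hk : k ≠ 0) (h : IsCritical μ k x y) :
    0 < reducedAction μ k x y := by
  have hx := mul_profileSpeed_div_two_lt_profileAction hμ h.left_mem.1 h.left_mem.2.le
  have hy := mul_profileSpeed_div_two_lt_profileAction hμ h.right_mem.1 h.right_mem.2.le
  rw [h.profileSpeed_left] at hx
  rw [h.profileSpeed_right] at hy
  have hsq : (x + y) ^ 2 / (2 * k) = x * ((x + y) / k) / 2 + y * ((x + y) / k) / 2 := by
    field_simp
  unfold reducedAction
  linarith

lemma minimaxValue_pos (hμ : 0 < μ) (hk : 2 < k) : 0 < minimaxValue μ k :=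
  (isCritical_crit hμ hk).reducedAction_pos hμ (by linarith)

lemma jumpSq_pos (hμ : 0 < μ) (hk : 2 < k) : 0 < jumpSq μ k :=
  pow_pos (add_pos (isCritical_crit hμ hk).left_mem.1 (isCritical_crit hμ hk).right_mem.1) 2

lemma jumpSq_div_pos (hμ : 0 < μ) (hk : 2 < k) : 0 < jumpSq μ k / (2 * k) :=
  div_pos (jumpSq_pos hμ hk) (by linarith)

lemma jumpSq_le (hμ : 0 < μ) (hk : 2 < k) : jumpSq μ k ≤ 4 := by
  have h := isCritical_crit hμ hk
  have hle : critRight μ k + critLeft μ k ≤ 2 := by linarith [h.left_mem.2, h.right_mem.2]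
  calc jumpSq μ k ≤ 2 ^ 2 := pow_le_pow_left₀ (add_pos h.left_mem.1 h.right_mem.1).le hle 2
    _ = 4 := by norm_num

lemma monotoneOn_minimaxValue (hμ : 0 < μ) : MonotoneOn (minimaxValue μ) (Ioi 2) := by
  refine monotoneOn_of_deriv_nonneg (convex_Ioi 2)
    (fun k hk => (hasDerivAt_minimaxValue hμ hk).continuousAt.continuousWithinAt)
    (fun k hk => ?_) fun k hk => ?_ <;> rw [interior_Ioi] at hk
  · exact (hasDerivAt_minimaxValue hμ hk).differentiableAt.differentiableWithinAt
  · rw [(hasDerivAt_minimaxValue hμ hk).deriv]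
    exact div_nonneg (jumpSq_pos hμ hk).le (by positivity)

/-- Up to a positive factor, the second derivative of `d` at the frequency with parameter `k`, when
`R` is the logarithmic derivative of `jumpSq` there. Keeping `R` separate makes sense of the two
one-sided values at the bifurcation. -/
noncomputable def curvature (μ k R : ℝ) : ℝ :=
  (1 / μ ^ 2 - 1 / 4) * minimaxValue μ k + jumpSq μ k / (2 * k) * (1 / μ - 1 / 4 + R / 4)

lemma tendsto_curvature {R : ℝ} (hμ : 0 < μ) {l : Filter ℝ} (hl : l ≤ 𝓝 (bifParam μ))
    (hR : Tendsto (jumpSqRate μ) l (𝓝 R)) :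
    Tendsto (fun k => curvature μ k (jumpSqRate μ k)) l (𝓝 (curvature μ (bifParam μ) R)) := by
  have hb : bifParam μ ≠ 0 := by linarith [two_lt_bifParam hμ]
  have hvalue := (continuousAt_minimaxValue_bifParam hμ).tendsto.mono_left hl
  have hjump : Tendsto (fun k => jumpSq μ k / (2 * k)) l
      (𝓝 (jumpSq μ (bifParam μ) / (2 * bifParam μ))) :=
    ((continuousAt_jumpSq_bifParam hμ).div (by fun_prop)
      (mul_ne_zero two_ne_zero hb)).tendsto.mono_left hl
  exact (hvalue.const_mul _).add (hjump.mul ((hR.div_const 4).const_add _))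

lemma one_div_sq_sub_quarter_nonneg (hμ : 0 < μ) (hμ2 : μ ≤ 2) : 0 ≤ 1 / μ ^ 2 - 1 / 4 :=
  sub_nonneg.2 (one_div_le_one_div_of_le (by positivity) (by nlinarith))

lemma curvature_pos_of_le_two {R : ℝ} (hμ : 0 < μ) (hμ2 : μ ≤ 2) (hk : 2 < k)
    (hR : 0 < 1 / μ - 1 / 4 + R / 4) : 0 < curvature μ k R :=
  add_pos_of_nonneg_of_pos
    (mul_nonneg (one_div_sq_sub_quarter_nonneg hμ hμ2) (minimaxValue_pos hμ hk).le)
    (mul_pos (jumpSq_div_pos hμ hk) hR)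

lemma jumpSq_div_of_le (hk : 0 < k) (hkb : k ≤ bifParam μ) :
    jumpSq μ k / (2 * k) = symVal μ k ^ 2 * (2 / k) := by
  rw [jumpSq, critRight_of_le hkb, critLeft_of_le hkb]
  field_simp
  ring

lemma minimaxValue_le_of_le (hμ : 0 < μ) (hk : 2 < k) (hkb : k ≤ bifParam μ) :
    minimaxValue μ k ≤ symVal μ k ^ 2 * (1 - 2 / k) := by
  have hprofile := profileAction_le hμ (symVal_pos (μ := μ) hk).le
  have hjump := jumpSq_div_of_le (by linarith) hkb
  rw [jumpSq, critRight_of_le hkb, critLeft_of_le hkb] at hjump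
  rw [minimaxValue, critRight_of_le hkb, critLeft_of_le hkb, reducedAction, hjump]
  linarith

lemma lt_four_of_le_bifParam (hμ : 1 < μ) (hk : 2 < k) (hkb : k ≤ bifParam μ) : k < 4 := by
  have hμ0 : 0 < μ := by linarith
  have hratio : (μ + 1) / μ < 2 := (div_lt_iff₀ hμ0).2 (by linarith)
  nlinarith [sq_le_of_le_bifParam hμ0 hk hkb]

/-- For `μ > 2` the coefficient of `minimaxValue` is negative, but at least `-1 / 4`, and on the
symmetric branch the jump outweighs the minimax value. -/
lemma curvature_pos_of_two_lt {R : ℝ} (hμ : 2 < μ) (hk : 2 < k) (hkb : k ≤ bifParam μ)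
    (hR : 2 ≤ R) : 0 < curvature μ k R := by
  have hμ0 : 0 < μ := by linarith
  have hx := pow_pos (symVal_pos (μ := μ) hk) 2
  have hvalue := minimaxValue_le_of_le hμ0 hk hkb
  have hvalue0 : 0 ≤ 1 / μ ^ 2 * minimaxValue μ k :=
    mul_nonneg (by positivity) (minimaxValue_pos hμ0 hk).le
  have hhalf : 1 / 2 < 2 / k := by
    rw [div_lt_div_iff₀ two_pos (by linarith)]
    linarith [lt_four_of_le_bifParam (by linarith) hk hkb]
  have hinv : 0 < 1 / μ := by positivity
  have hrate : symVal μ k ^ 2 * (2 / k) * (1 / 4) <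
      symVal μ k ^ 2 * (2 / k) * (1 / μ - 1 / 4 + R / 4) :=
    mul_lt_mul_of_pos_left (by linarith) (by positivity)
  have hjump : symVal μ k ^ 2 * (1 - 2 / k) ≤ symVal μ k ^ 2 * (2 / k) :=
    mul_le_mul_of_nonneg_left (by linarith) hx.le
  rw [curvature, jumpSq_div_of_le (by linarith) hkb]
  linarith

lemma curvature_pos_of_le {R : ℝ} (hμ : 0 < μ) (hk : 2 < k) (hkb : k ≤ bifParam μ)
    (hR : 2 ≤ R) : 0 < curvature μ k R := by
  rcases le_or_gt μ 2 with hμ2 | hμ2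
  · have hinv : 0 < 1 / μ := by positivity
    exact curvature_pos_of_le_two hμ hμ2 hk (by linarith)
  · exact curvature_pos_of_two_lt hμ2 hk hkb hR

lemma two_le_jumpSqRate (hμ : 0 < μ) (hk : 2 < k) (hkb : k ≤ bifParam μ) :
    2 ≤ jumpSqRate μ k := by
  have hpos : 0 < k ^ 2 - 4 := by nlinarith
  have hle : k ^ 2 - 4 ≤ 4 / μ := by
    rw [← sq_bifParam_sub hμ]
    exact sub_le_sub_right (pow_le_pow_left₀ (by linarith) hkb 2) 4
  rw [le_div_iff₀ hμ] at hle
  rw [jumpSqRate_of_le hkb, le_div_iff₀ (by positivity)]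
  linarith

lemma curvature_pos_of_lt (hμ : 0 < μ) (hk : 2 < k) (hkb : k < bifParam μ) :
    0 < curvature μ k (jumpSqRate μ k) :=
  curvature_pos_of_le hμ hk hkb.le (two_le_jumpSqRate hμ hk hkb.le)

lemma curvature_pos_of_gt (hμ : 0 < μ) (hμ2 : μ ≤ 2) (hkb : bifParam μ < k) :
    0 < curvature μ k (jumpSqRate μ k) := by
  have hz := branchInv_pos hμ hkb
  refine curvature_pos_of_le_two hμ hμ2 ((two_lt_bifParam hμ).trans hkb) ?_
  have hrate := (div_lt_iff₀ (paramRate_pos hμ hz)).2 (jumpRate_lt hμ hμ2 hz)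
  rw [jumpSqRate_of_lt hkb]
  linarith [show 2 / μ = 2 * (1 / μ) by ring]

lemma jumpSqRate_neg (hμ : 0 < μ) (hkb : bifParam μ < k) : jumpSqRate μ k < 0 := by
  have hz := branchInv_pos hμ hkb
  rw [jumpSqRate_of_lt hkb]
  linarith [div_pos (jumpRate_pos hμ hz) (paramRate_pos hμ hz)]

lemma jumpSq_term_le_one_div (hμ : 2 ≤ μ) (hkb : bifParam μ < k) :
    jumpSq μ k / (2 * k) * (1 / μ - 1 / 4 + jumpSqRate μ k / 4) ≤ 1 / (2 * k) := by
  have hμ0 : 0 < μ := by linarith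
  have hk : 2 < k := (two_lt_bifParam hμ0).trans hkb
  have hinv : 1 / μ ≤ 1 / 2 := one_div_le_one_div_of_le two_pos hμ
  calc jumpSq μ k / (2 * k) * (1 / μ - 1 / 4 + jumpSqRate μ k / 4)
      ≤ jumpSq μ k / (2 * k) * (1 / 4) :=
        mul_le_mul_of_nonneg_left (by linarith [jumpSqRate_neg hμ0 hkb]) (jumpSq_div_pos hμ0 hk).le
    _ = jumpSq μ k / 4 / (2 * k) := by ring
    _ ≤ 1 / (2 * k) :=
        div_le_div_of_nonneg_right (by linarith [jumpSq_le hμ0 hk]) (by linarith)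

lemma exists_forall_curvature_neg (hμ : 2 < μ) :
    ∃ k₁, ∀ k, k₁ < k → curvature μ k (jumpSqRate μ k) < 0 := by
  have hμ0 : 0 < μ := by linarith
  have hb := two_lt_bifParam hμ0
  have hcoef : 0 < 1 / 4 - 1 / μ ^ 2 :=
    sub_pos.2 (one_div_lt_one_div_of_lt (by norm_num) (by nlinarith))
  set δ := (1 / 4 - 1 / μ ^ 2) * minimaxValue μ (bifParam μ)
  have hδ0 : 0 < δ := mul_pos hcoef (minimaxValue_pos hμ0 hb)
  refine ⟨max (bifParam μ) (1 / (2 * δ)), fun k hk => ?_⟩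
  obtain ⟨hkb, hkδ⟩ := max_lt_iff.1 hk
  have hvalue : δ ≤ (1 / 4 - 1 / μ ^ 2) * minimaxValue μ k :=
    mul_le_mul_of_nonneg_left (monotoneOn_minimaxValue hμ0 hb (hb.trans hkb) hkb.le) hcoef.le
  have hsmall : 1 / (2 * k) < δ := by
    rw [div_lt_iff₀ (by positivity)] at hkδ
    rw [div_lt_iff₀ (by linarith)]
    linarith
  unfold curvature
  linarith [jumpSq_term_le_one_div hμ.le hkb]

end Curvature

/-! ### The sign of the right limit of the second derivative at the bifurcation -/

section Threshold

variable {μ ν s : ℝ}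

/-- The radicand of the rescaled `profileSpeed` at the bifurcation is `1 + excess μ s`. -/
noncomputable def excess (μ s : ℝ) : ℝ := (1 - s ^ (2 * μ)) / μ

/-- The ratio of the minimax value to `jumpSq / (2k)` at the bifurcation. -/
noncomputable def bifRatio (μ : ℝ) : ℝ := ∫ s in (0 : ℝ)..1, 2 * s * (√(1 + excess μ s) - 1)

lemma excess_nonneg (hμ : 0 < μ) (hs : s ∈ Icc (0 : ℝ) 1) : 0 ≤ excess μ s :=
  div_nonneg (sub_nonneg.2 (Real.rpow_le_one hs.1 hs.2 (by positivity))) hμ.le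

lemma continuous_excess (hμ : 0 ≤ μ) : Continuous (excess μ) :=
  (continuous_const.sub (Real.continuous_rpow_const (by positivity))).div_const μ

lemma mul_excess_mono (hμ : 0 < μ) (hμν : μ ≤ ν) (hs : s ∈ Icc (0 : ℝ) 1) :
    μ / ν * excess μ s ≤ excess ν s := by
  have hpow : s ^ (2 * ν) ≤ s ^ (2 * μ) :=
    Real.rpow_le_rpow_of_exponent_ge' hs.1 hs.2 (by positivity) (by linarith)
  calc μ / ν * excess μ s = (1 - s ^ (2 * μ)) / ν := by
        unfold excess
        field_simp
    _ ≤ excess ν s := div_le_div_of_nonneg_right (sub_le_sub_left hpow 1) (hμ.trans_le hμν).le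

/-- Concavity of `w ↦ √(1 + w) - 1`, which vanishes at `0`. -/
lemma mul_sqrt_sub_one_le {θ w : ℝ} (hθ : 0 ≤ θ) (hθ1 : θ ≤ 1) (hw : 0 ≤ w) :
    θ * (√(1 + w) - 1) ≤ √(1 + θ * w) - 1 := by
  have hsq := Real.sq_sqrt (add_nonneg zero_le_one hw)
  have hnonneg : 0 ≤ θ * (1 - θ) * (√(1 + w) - 1) ^ 2 :=
    mul_nonneg (mul_nonneg hθ (sub_nonneg.2 hθ1)) (sq_nonneg _)
  refine le_sub_iff_add_le.2 (Real.le_sqrt_of_sq_le ?_)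
  linear_combination hnonneg + θ * hsq

lemma mul_bifRatio_mono (hμ : 0 < μ) (hμν : μ ≤ ν) : μ * bifRatio μ ≤ ν * bifRatio ν := by
  have hν := hμ.trans_le hμν
  have hcont {μ : ℝ} (hμ : 0 < μ) : Continuous fun s => 2 * s * (√(1 + excess μ s) - 1) := by
    have := continuous_excess hμ.le
    fun_prop
  suffices μ / ν * bifRatio μ ≤ bifRatio ν by
    rwa [div_mul_eq_mul_div, div_le_iff₀' hν] at this
  unfold bifRatio
  rw [← intervalIntegral.integral_const_mul]
  refine intervalIntegral.integral_mono_on zero_le_one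
    ((continuous_const.mul (hcont hμ)).intervalIntegrable _ _)
    ((hcont hν).intervalIntegrable _ _) fun s hs => ?_
  have hconcave := mul_sqrt_sub_one_le (div_nonneg hμ.le hν.le) ((div_le_one hν).2 hμν)
    (excess_nonneg hμ hs)
  have hexcess := Real.sqrt_le_sqrt (add_le_add_right (mul_excess_mono hμ hμν hs) 1)
  rw [mul_left_comm]
  exact mul_le_mul_of_nonneg_left (hconcave.trans (sub_le_sub_right hexcess 1))
    (mul_nonneg zero_le_two hs.1)

lemma continuousOn_bifRatio {a : ℝ} (ha : 0 < a) : ContinuousOn bifRatio (Ici a) := by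
  suffices Continuous fun μ : ℝ =>
      ∫ s in (0 : ℝ)..1, 2 * s * (√(1 + excess (max μ a) s) - 1) by
    refine this.continuousOn.congr fun μ hμ => ?_
    simp only [max_eq_left (mem_Ici.1 hμ), bifRatio]
  apply intervalIntegral.continuous_parametric_intervalIntegral_of_continuous'
  have hmax (p : ℝ × ℝ) : 0 < max p.1 a := lt_max_of_lt_right ha
  have hpow : Continuous fun p : ℝ × ℝ => p.2 ^ (2 * max p.1 a) :=
    continuous_snd.rpow (by fun_prop) fun p => Or.inr (mul_pos two_pos (hmax p))
  have hexcess : Continuous fun p : ℝ × ℝ => excess (max p.1 a) p.2 :=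
    (continuous_const.sub hpow).div (by fun_prop) fun p => (hmax p).ne'
  change Continuous fun p : ℝ × ℝ => 2 * p.2 * (√(1 + excess (max p.1 a) p.2) - 1)
  fun_prop

lemma one_sub_mul_rpow_symVal_bifParam (hμ : 0 < μ) (hs : 0 ≤ s) :
    1 - (symVal μ (bifParam μ) * s) ^ (2 * μ) = (2 / bifParam μ) ^ 2 * (1 + excess μ s) := by
  have hk := two_lt_bifParam hμ
  rw [Real.mul_rpow (symVal_pos hk).le hs, symVal_rpow hμ hk, div_pow, sq_bifParam hμ, excess]
  field_simp
  ring

lemma profileAction_symVal_bifParam (hμ : 0 < μ) :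
    profileAction μ (symVal μ (bifParam μ)) = symVal μ (bifParam μ) ^ 2 * (2 / bifParam μ) *
      ∫ s in (0 : ℝ)..1, s * √(1 + excess μ s) := by
  have hk := two_lt_bifParam hμ
  have hscale := intervalIntegral.mul_integral_comp_mul_left (a := 0) (b := 1)
    (f := profileSpeed μ) (symVal μ (bifParam μ))
  rw [mul_zero, mul_one] at hscale
  rw [profileAction, ← hscale, ← intervalIntegral.integral_const_mul,
    ← intervalIntegral.integral_const_mul]
  refine intervalIntegral.integral_congr fun s hs => ?_
  rw [uIcc_of_le zero_le_one] at hs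
  simp only [profileSpeed]
  rw [one_sub_mul_rpow_symVal_bifParam hμ hs.1, Real.sqrt_mul (sq_nonneg _),
    Real.sqrt_sq (div_pos two_pos (by linarith)).le]
  ring

lemma bifRatio_eq (hμ : 0 ≤ μ) :
    bifRatio μ = 2 * (∫ s in (0 : ℝ)..1, s * √(1 + excess μ s)) - 1 := by
  have := continuous_excess hμ
  calc bifRatio μ = ∫ s in (0 : ℝ)..1, (2 * (s * √(1 + excess μ s)) - 2 * s) :=
        intervalIntegral.integral_congr fun s _ => by ring
    _ = _ := by
        rw [intervalIntegral.integral_sub (Continuous.intervalIntegrable (by fun_prop) _ _)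
          (Continuous.intervalIntegrable (by fun_prop) _ _),
          intervalIntegral.integral_const_mul, intervalIntegral.integral_const_mul, integral_id]
        norm_num

lemma minimaxValue_bifParam (hμ : 0 < μ) : minimaxValue μ (bifParam μ) =
    jumpSq μ (bifParam μ) / (2 * bifParam μ) * bifRatio μ := by
  have hjump := jumpSq_div_of_le (μ := μ) (by linarith [two_lt_bifParam hμ]) le_rfl
  rw [minimaxValue, reducedAction, ← jumpSq, hjump, critRight_of_le le_rfl, critLeft_of_le le_rfl,
    profileAction_symVal_bifParam hμ, bifRatio_eq hμ.le]
  ring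

lemma bifRatio_pos (hμ : 0 < μ) : 0 < bifRatio μ := by
  have hk := two_lt_bifParam hμ
  have hpos := minimaxValue_pos hμ hk
  rw [minimaxValue_bifParam hμ] at hpos
  exact (mul_pos_iff_of_pos_left (jumpSq_div_pos hμ hk)).1 hpos

/-- Up to the positive factor `jumpSq / (2k)`, the right limit of the curvature at the
bifurcation. -/
noncomputable def signFun (μ : ℝ) : ℝ :=
  (1 / μ ^ 2 - 1 / 4) * bifRatio μ + (1 / μ - (8 * μ + 7) / (4 * (4 * μ + 5)))

lemma curvature_bifParam_right (hμ : 0 < μ) :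
    curvature μ (bifParam μ) (-2 * ((2 * μ + 1) / (4 * μ + 5))) =
      jumpSq μ (bifParam μ) / (2 * bifParam μ) * signFun μ := by
  have hrate : 1 / μ - 1 / 4 + -2 * ((2 * μ + 1) / (4 * μ + 5)) / 4 =
      1 / μ - (8 * μ + 7) / (4 * (4 * μ + 5)) := by
    field_simp
    ring
  rw [curvature, minimaxValue_bifParam hμ, hrate, signFun]
  ring

lemma signFun_pos_of_le (hμ : 0 < μ) (hμ2 : μ ≤ 2) : 0 < signFun μ := by
  have hinv : 1 / 2 ≤ 1 / μ := one_div_le_one_div_of_le hμ hμ2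
  have hfrac : (8 * μ + 7) / (4 * (4 * μ + 5)) < 1 / 2 := by
    rw [div_lt_div_iff₀ (by positivity) two_pos]
    linarith
  exact add_pos_of_nonneg_of_pos
    (mul_nonneg (one_div_sq_sub_quarter_nonneg hμ hμ2) (bifRatio_pos hμ).le) (by linarith)

lemma signFun_neg_of_ge (hμ : 5 / 2 ≤ μ) : signFun μ < 0 := by
  have hμ0 : 0 < μ := by linarith
  have hcoef : 1 / μ ^ 2 ≤ 1 / 4 := one_div_le_one_div_of_le (by norm_num) (by nlinarith)
  have hinv : 1 / μ ≤ 2 / 5 := by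
    rw [div_le_div_iff₀ hμ0 (by norm_num)]
    linarith
  have hfrac : 2 / 5 < (8 * μ + 7) / (4 * (4 * μ + 5)) := by
    rw [div_lt_div_iff₀ (by norm_num) (by positivity)]
    linarith
  exact add_neg_of_nonpos_of_neg
    (mul_nonpos_of_nonpos_of_nonneg (sub_nonpos.2 hcoef) (bifRatio_pos hμ0).le) (by linarith)

lemma monotoneOn_sq_sub_four_div :
    MonotoneOn (fun μ : ℝ => (μ ^ 2 - 4) / (4 * μ ^ 3)) (Icc 2 (5 / 2)) := by
  intro a ha b hb hab
  have ha0 : 0 < a := by linarith [ha.1]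
  have hb0 : 0 < b := by linarith [hb.1]
  have hprod : a * b ≤ 12 := by nlinarith [ha.2, hb.2]
  have hnonneg : 0 ≤ 4 * (a ^ 2 + a * b + b ^ 2) - a ^ 2 * b ^ 2 := by
    nlinarith [mul_nonneg (mul_pos ha0 hb0).le (sub_nonneg.2 hprod), sq_nonneg (a - b)]
  simp only
  rw [div_le_div_iff₀ (by positivity) (by positivity)]
  linear_combination 4 * mul_nonneg (sub_nonneg.2 hab) hnonneg

lemma strictAntiOn_signFun : StrictAntiOn signFun (Icc 2 (5 / 2)) := by
  intro a ha b hb hab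
  have ha0 : 0 < a := by linarith [ha.1]
  have hb0 : 0 < b := by linarith [hb.1]
  have hterm {μ : ℝ} (hμ : 0 < μ) : (1 / μ ^ 2 - 1 / 4) * bifRatio μ =
      -((μ ^ 2 - 4) / (4 * μ ^ 3) * (μ * bifRatio μ)) := by
    field_simp
    ring
  have hmono : (a ^ 2 - 4) / (4 * a ^ 3) * (a * bifRatio a) ≤
      (b ^ 2 - 4) / (4 * b ^ 3) * (b * bifRatio b) :=
    mul_le_mul (monotoneOn_sq_sub_four_div ha hb hab.le) (mul_bifRatio_mono ha0 hab.le)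
      (mul_pos ha0 (bifRatio_pos ha0)).le (div_nonneg (by nlinarith [hb.1]) (by positivity))
  have hinv : 1 / b < 1 / a := one_div_lt_one_div_of_lt ha0 hab
  have hfrac : (8 * a + 7) / (4 * (4 * a + 5)) ≤ (8 * b + 7) / (4 * (4 * b + 5)) := by
    rw [div_le_div_iff₀ (by positivity) (by positivity)]
    nlinarith
  unfold signFun
  rw [hterm ha0, hterm hb0]
  linarith

lemma continuousOn_signFun {a : ℝ} (ha : 0 < a) : ContinuousOn signFun (Ici a) := by
  have hpos {x : ℝ} (hx : x ∈ Ici a) : 0 < x := ha.trans_le hx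
  have hcoef : ContinuousOn (fun x : ℝ => 1 / x ^ 2 - 1 / 4) (Ici a) :=
    (continuousOn_const.div (by fun_prop) fun x hx => (pow_pos (hpos hx) 2).ne').sub
      continuousOn_const
  have hfrac : ContinuousOn (fun x : ℝ => 1 / x - (8 * x + 7) / (4 * (4 * x + 5))) (Ici a) :=
    (continuousOn_const.div (by fun_prop) fun x hx => (hpos hx).ne').sub
      (ContinuousOn.div (by fun_prop) (by fun_prop) fun x hx => by linarith [hpos hx])
  exact (hcoef.mul (continuousOn_bifRatio ha)).add hfrac

lemma exists_signFun_eq_zero : ∃ μs ∈ Ioo (2 : ℝ) (5 / 2), signFun μs = 0 :=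
  intermediate_value_Ioo' (by norm_num)
    ((continuousOn_signFun two_pos).mono Icc_subset_Ici_self)
    ⟨signFun_neg_of_ge le_rfl, signFun_pos_of_le two_pos le_rfl⟩

lemma exists_threshold : ∃ μs ∈ Ioo (2 : ℝ) (5 / 2), ∀ μ, 0 < μ →
    (μ < μs → 0 < signFun μ) ∧ (μ = μs → signFun μ = 0) ∧ (μs < μ → signFun μ < 0) := by
  obtain ⟨μs, hμs, hzero⟩ := exists_signFun_eq_zero
  have hμs' := Ioo_subset_Icc_self hμs
  refine ⟨μs, hμs, fun μ hμ => ⟨fun hlt => ?_, fun heq => heq ▸ hzero, fun hgt => ?_⟩⟩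
  · rcases le_or_gt μ 2 with hμ2 | hμ2
    · exact signFun_pos_of_le hμ hμ2
    · exact hzero ▸ strictAntiOn_signFun ⟨hμ2.le, hlt.le.trans hμs'.2⟩ hμs' hlt
  · rcases le_or_gt (5 / 2) μ with hμ5 | hμ5
    · exact signFun_neg_of_ge hμ5
    · exact hzero ▸ strictAntiOn_signFun hμs' ⟨hμs'.1.trans hgt.le, hμ5.le⟩ hgt

end Threshold

/-! ### Derivatives of `d` -/

section GroundAction

variable {γ lam μ ω : ℝ}

lemma freqLinear_pos (hγ : 0 < γ) : 0 < freqLinear γ := by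
  unfold freqLinear
  positivity

lemma freqLinear_lt_freqBif (hγ : 0 < γ) (hμ : 0 < μ) : freqLinear γ < freqBif γ μ := by
  refine lt_mul_of_one_lt_right (freqLinear_pos hγ) ?_
  rw [one_lt_div hμ]
  linarith

lemma freqBif_pos (hγ : 0 < γ) (hμ : 0 < μ) : 0 < freqBif γ μ :=
  (freqLinear_pos hγ).trans (freqLinear_lt_freqBif hγ hμ)

lemma lt_mul_sqrt {k : ℝ} (hγ : 0 < γ) (h : (k / γ) ^ 2 < ω) : k < γ * √ω := by
  have := Real.lt_sqrt_of_sq_lt h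
  rwa [div_lt_iff₀' hγ] at this

lemma two_lt_mul_sqrt (hγ : 0 < γ) (hω : freqLinear γ < ω) : 2 < γ * √ω := by
  refine lt_mul_sqrt hγ ?_
  rwa [div_pow, show (2 : ℝ) ^ 2 = 4 by norm_num]

lemma mul_sqrt_freqBif (hγ : 0 < γ) : γ * √(freqBif γ μ) = bifParam μ := by
  have hfreq : freqBif γ μ = (2 / γ) ^ 2 * ((μ + 1) / μ) := by
    rw [freqBif, div_pow]
    norm_num
  rw [hfreq, Real.sqrt_mul (sq_nonneg _), Real.sqrt_sq (by positivity), bifParam]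
  field_simp

lemma mul_sqrt_lt_bifParam (hγ : 0 < γ) (hω : 0 ≤ ω) (h : ω < freqBif γ μ) :
    γ * √ω < bifParam μ := by
  rw [← mul_sqrt_freqBif hγ]
  exact mul_lt_mul_of_pos_left (Real.sqrt_lt_sqrt hω h) hγ

lemma bifParam_lt_mul_sqrt (hγ : 0 < γ) (hμ : 0 < μ) (h : freqBif γ μ < ω) :
    bifParam μ < γ * √ω := by
  rw [← mul_sqrt_freqBif hγ]
  exact mul_lt_mul_of_pos_left (Real.sqrt_lt_sqrt (freqBif_pos hγ hμ).le h) hγ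

lemma mul_sqrt_ne_bifParam (hγ : 0 < γ) (hμ : 0 < μ) (hω : 0 ≤ ω) (h : ω ≠ freqBif γ μ) :
    γ * √ω ≠ bifParam μ := by
  rcases lt_or_gt_of_ne h with h | h
  · exact (mul_sqrt_lt_bifParam hγ hω h).ne
  · exact (bifParam_lt_mul_sqrt hγ hμ h).ne'

lemma tendsto_mul_sqrt_freqBif (hγ : 0 < γ) :
    Tendsto (fun ω => γ * √ω) (𝓝 (freqBif γ μ)) (𝓝 (bifParam μ)) := by
  rw [← mul_sqrt_freqBif hγ]
  exact (continuous_const.mul Real.continuous_sqrt).tendsto _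

lemma tendsto_mul_sqrt_left (hγ : 0 < γ) (hμ : 0 < μ) :
    Tendsto (fun ω => γ * √ω) (𝓝[<] (freqBif γ μ)) (𝓝[<] (bifParam μ)) := by
  refine tendsto_nhdsWithin_iff.2
    ⟨(tendsto_mul_sqrt_freqBif hγ).mono_left nhdsWithin_le_nhds, ?_⟩
  filter_upwards [Ioo_mem_nhdsLT (freqBif_pos hγ hμ)] with ω hω
  exact mul_sqrt_lt_bifParam hγ hω.1.le hω.2

lemma tendsto_mul_sqrt_right (hγ : 0 < γ) (hμ : 0 < μ) :
    Tendsto (fun ω => γ * √ω) (𝓝[>] (freqBif γ μ)) (𝓝[>] (bifParam μ)) := by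
  refine tendsto_nhdsWithin_iff.2
    ⟨(tendsto_mul_sqrt_freqBif hγ).mono_left nhdsWithin_le_nhds, ?_⟩
  filter_upwards [self_mem_nhdsWithin] with ω hω using bifParam_lt_mul_sqrt hγ hμ hω

lemma hasDerivAt_mul_sqrt (hω : 0 < ω) :
    HasDerivAt (fun ω => γ * √ω) (γ * √ω / (2 * ω)) ω := by
  refine ((Real.hasDerivAt_sqrt hω.ne').const_mul γ).congr_deriv ?_
  have := Real.sqrt_pos.2 hω
  field_simp
  rw [Real.sq_sqrt hω.le]

lemma hasDerivAt_minimaxValue_mul_sqrt (hγ : 0 < γ) (hμ : 0 < μ) (hω : freqLinear γ < ω) :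
    HasDerivAt (fun ω => minimaxValue μ (γ * √ω))
      (jumpSq μ (γ * √ω) / (2 * (γ * √ω) ^ 2) * (γ * √ω / (2 * ω))) ω :=
  HasDerivAt.comp (h₂ := minimaxValue μ) ω (hasDerivAt_minimaxValue hμ (two_lt_mul_sqrt hγ hω))
    (hasDerivAt_mul_sqrt ((freqLinear_pos hγ).trans hω))

lemma hasDerivAt_jumpSq_mul_sqrt (hγ : 0 < γ) (hμ : 0 < μ) (hω : freqLinear γ < ω)
    (hne : ω ≠ freqBif γ μ) :
    HasDerivAt (fun ω => jumpSq μ (γ * √ω))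
      (jumpSq μ (γ * √ω) * jumpSqRate μ (γ * √ω) / (γ * √ω) * (γ * √ω / (2 * ω))) ω :=
  have hω0 := (freqLinear_pos hγ).trans hω
  HasDerivAt.comp (h₂ := jumpSq μ) ω (hasDerivAt_jumpSq hμ (two_lt_mul_sqrt hγ hω)
    (mul_sqrt_ne_bifParam hγ hμ hω0.le hne)) (hasDerivAt_mul_sqrt hω0)

/-- The coefficient of `ω ^ (1 / 2 + 1 / μ)` times the minimax value in `d(ω)`. -/
noncomputable def actionConst (lam μ : ℝ) : ℝ := ((μ + 1) / lam) ^ (1 / μ)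

lemma sqrt_mul_amplitude_sq (hlam : 0 < lam) (hμ : 0 < μ) (hω : 0 < ω) :
    √ω * amplitude lam μ ω ^ 2 = actionConst lam μ * ω ^ (1 / 2 + 1 / μ) := by
  have hsq : amplitude lam μ ω ^ 2 = ((μ + 1) / lam * ω) ^ (1 / μ) := by
    rw [amplitude, ← Real.rpow_mul_natCast (by positivity), mul_div_right_comm]
    congr 1
    push_cast
    field_simp
  rw [hsq, Real.mul_rpow (by positivity) hω.le, Real.rpow_add hω, ← Real.sqrt_eq_rpow, actionConst]
  ring

lemma groundAction_eq_minimaxValue (hγ : 0 < γ) (hlam : 0 < lam) (hμ : 0 < μ)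
    (hω : freqLinear γ < ω) : groundAction γ lam μ ω =
      actionConst lam μ * ω ^ (1 / 2 + 1 / μ) * minimaxValue μ (γ * √ω) := by
  have hω0 : 0 < ω := (freqLinear_pos hγ).trans hω
  have hk := two_lt_mul_sqrt hγ hω
  rw [groundAction_eq hγ hlam hμ hω0 (isCritical_crit hμ hk) (isRayMinimax_crit hμ hk),
    sqrt_mul_amplitude_sq hlam hμ hω0, minimaxValue]

/-- The first derivative of `d`. -/
noncomputable def groundActionDeriv (γ lam μ ω : ℝ) : ℝ :=
  actionConst lam μ * (ω ^ (1 / μ - 1 / 2) * ((1 / 2 + 1 / μ) * minimaxValue μ (γ * √ω) +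
    jumpSq μ (γ * √ω) / (4 * (γ * √ω))))

lemma hasDerivAt_groundAction (hγ : 0 < γ) (hlam : 0 < lam) (hμ : 0 < μ)
    (hω : freqLinear γ < ω) :
    HasDerivAt (groundAction γ lam μ) (groundActionDeriv γ lam μ ω) ω := by
  have hω0 : 0 < ω := (freqLinear_pos hγ).trans hω
  have hpow := (Real.hasDerivAt_rpow_const (p := 1 / 2 + 1 / μ) (Or.inl hω0.ne')).const_mul
    (actionConst lam μ)
  refine ((hpow.mul (hasDerivAt_minimaxValue_mul_sqrt hγ hμ hω)).congr_deriv
    ?_).congr_of_eventuallyEq ?_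
  · rw [groundActionDeriv, show (1 : ℝ) / 2 + 1 / μ - 1 = 1 / μ - 1 / 2 by ring,
      show (1 : ℝ) / 2 + 1 / μ = 1 / μ - 1 / 2 + 1 by ring, Real.rpow_add_one hω0.ne']
    have := Real.sqrt_pos.2 hω0
    field_simp
    ring
  · filter_upwards [Ioi_mem_nhds hω] with y hy
    exact groundAction_eq_minimaxValue hγ hlam hμ hy

/-- The factor relating `d''` to `curvature`. -/
noncomputable def curvatureFactor (lam μ ω : ℝ) : ℝ := actionConst lam μ * ω ^ (1 / μ - 3 / 2)

lemma curvatureFactor_pos (hlam : 0 < lam) (hμ : 0 < μ) (hω : 0 < ω) :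
    0 < curvatureFactor lam μ ω := by
  unfold curvatureFactor actionConst
  positivity

lemma hasDerivAt_groundActionDeriv (hγ : 0 < γ) (hμ : 0 < μ) (hω : freqLinear γ < ω)
    (hne : ω ≠ freqBif γ μ) :
    HasDerivAt (groundActionDeriv γ lam μ)
      (curvatureFactor lam μ ω * curvature μ (γ * √ω) (jumpSqRate μ (γ * √ω))) ω := by
  have hω0 : 0 < ω := (freqLinear_pos hγ).trans hω
  have hk : 0 < γ * √ω := mul_pos hγ (Real.sqrt_pos.2 hω0)
  have hpow := Real.hasDerivAt_rpow_const (p := 1 / μ - 1 / 2) (Or.inl hω0.ne')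
  have hbracket := ((hasDerivAt_minimaxValue_mul_sqrt hγ hμ hω).const_mul (1 / 2 + 1 / μ)).add
    ((hasDerivAt_jumpSq_mul_sqrt hγ hμ hω hne).div ((hasDerivAt_mul_sqrt hω0).const_mul 4)
      (by positivity))
  refine ((hpow.mul hbracket).const_mul (actionConst lam μ)).congr_deriv ?_
  simp only [Pi.add_apply, Pi.div_apply]
  rw [curvatureFactor, curvature, show (1 : ℝ) / μ - 1 / 2 - 1 = 1 / μ - 3 / 2 by ring,
    show (1 : ℝ) / μ - 1 / 2 = 1 / μ - 3 / 2 + 1 by ring, Real.rpow_add_one hω0.ne']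
  set k := γ * √ω
  field_simp
  ring

lemma deriv_groundAction_eventuallyEq (hγ : 0 < γ) (hlam : 0 < lam) (hμ : 0 < μ)
    (hω : freqLinear γ < ω) :
    deriv (groundAction γ lam μ) =ᶠ[𝓝 ω] groundActionDeriv γ lam μ := by
  filter_upwards [Ioi_mem_nhds hω] with y hy
  exact (hasDerivAt_groundAction hγ hlam hμ hy).deriv

lemma hasDerivAt_deriv_groundAction (hγ : 0 < γ) (hlam : 0 < lam) (hμ : 0 < μ)
    (hω : freqLinear γ < ω) (hne : ω ≠ freqBif γ μ) :
    HasDerivAt (deriv (groundAction γ lam μ))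
      (curvatureFactor lam μ ω * curvature μ (γ * √ω) (jumpSqRate μ (γ * √ω))) ω :=
  (hasDerivAt_groundActionDeriv hγ hμ hω hne).congr_of_eventuallyEq
    (deriv_groundAction_eventuallyEq hγ hlam hμ hω)

lemma deriv_deriv_groundAction (hγ : 0 < γ) (hlam : 0 < lam) (hμ : 0 < μ)
    (hω : freqLinear γ < ω) (hne : ω ≠ freqBif γ μ) :
    deriv (deriv (groundAction γ lam μ)) ω =
      curvatureFactor lam μ ω * curvature μ (γ * √ω) (jumpSqRate μ (γ * √ω)) :=
  (hasDerivAt_deriv_groundAction hγ hlam hμ hω hne).deriv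

lemma continuousAt_groundActionDeriv_freqBif (hγ : 0 < γ) (hμ : 0 < μ) :
    ContinuousAt (groundActionDeriv γ lam μ) (freqBif γ μ) := by
  have hk : ContinuousAt (fun ω => γ * √ω) (freqBif γ μ) := by fun_prop
  have hvalue : ContinuousAt (fun ω => minimaxValue μ (γ * √ω)) (freqBif γ μ) :=
    ContinuousAt.comp (g := minimaxValue μ)
      (by rw [mul_sqrt_freqBif hγ]; exact continuousAt_minimaxValue_bifParam hμ) hk
  have hjump : ContinuousAt (fun ω => jumpSq μ (γ * √ω)) (freqBif γ μ) :=
    ContinuousAt.comp (g := jumpSq μ)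
      (by rw [mul_sqrt_freqBif hγ]; exact continuousAt_jumpSq_bifParam hμ) hk
  have hk0 : 4 * (γ * √(freqBif γ μ)) ≠ 0 := by
    have := Real.sqrt_pos.2 (freqBif_pos hγ hμ)
    positivity
  exact continuousAt_const.mul
    ((Real.continuousAt_rpow_const _ _ (Or.inl (freqBif_pos hγ hμ).ne')).mul
      ((continuousAt_const.mul hvalue).add (hjump.div (continuousAt_const.mul hk) hk0)))

lemma continuousAt_deriv_groundAction_freqBif (hγ : 0 < γ) (hlam : 0 < lam) (hμ : 0 < μ) :
    ContinuousAt (deriv (groundAction γ lam μ)) (freqBif γ μ) :=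
  (continuousAt_groundActionDeriv_freqBif hγ hμ).congr
    (deriv_groundAction_eventuallyEq hγ hlam hμ (freqLinear_lt_freqBif hγ hμ)).symm

lemma tendsto_deriv_deriv_groundAction {R : ℝ} {l l' : Filter ℝ} (hγ : 0 < γ) (hlam : 0 < lam)
    (hμ : 0 < μ) (hl : l ≤ 𝓝[≠] (freqBif γ μ)) (hl' : l' ≤ 𝓝 (bifParam μ))
    (hk : Tendsto (fun ω => γ * √ω) l l') (hR : Tendsto (jumpSqRate μ) l' (𝓝 R)) :
    Tendsto (deriv (deriv (groundAction γ lam μ))) l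
      (𝓝 (curvatureFactor lam μ (freqBif γ μ) * curvature μ (bifParam μ) R)) := by
  have hln : l ≤ 𝓝 (freqBif γ μ) := hl.trans nhdsWithin_le_nhds
  have hfactor : Tendsto (curvatureFactor lam μ) l (𝓝 (curvatureFactor lam μ (freqBif γ μ))) :=
    (continuousAt_const.mul (Real.continuousAt_rpow_const _ _
      (Or.inl (freqBif_pos hγ hμ).ne'))).tendsto.mono_left hln
  refine (hfactor.mul ((tendsto_curvature hμ hl' hR).comp hk)).congr' ?_
  filter_upwards [hl self_mem_nhdsWithin, hln (Ioi_mem_nhds (freqLinear_lt_freqBif hγ hμ))]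
    with ω hne hω
  exact (deriv_deriv_groundAction hγ hlam hμ hω hne).symm

lemma isLeftSecondDeriv_groundAction (hγ : 0 < γ) (hlam : 0 < lam) (hμ : 0 < μ) :
    IsLeftSecondDeriv (groundAction γ lam μ) (freqBif γ μ)
      (curvatureFactor lam μ (freqBif γ μ) * curvature μ (bifParam μ) 2) := by
  have hlim := tendsto_deriv_deriv_groundAction hγ hlam hμ
    (nhdsWithin_mono (freqBif γ μ) fun _ hx => ne_of_lt hx) nhdsWithin_le_nhds
    (tendsto_mul_sqrt_left hγ hμ) (tendsto_jumpSqRate_left hμ)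
  refine ⟨hlim, (hasDerivWithinAt_Iic_of_tendsto_deriv
    (s := Ioo (freqLinear γ) (freqBif γ μ)) (fun ω hω => ?_)
    (continuousAt_deriv_groundAction_freqBif hγ hlam hμ).continuousWithinAt
    (Ioo_mem_nhdsLT (freqLinear_lt_freqBif hγ hμ)) hlim).mono Iio_subset_Iic_self⟩
  exact (hasDerivAt_deriv_groundAction hγ hlam hμ hω.1
    (ne_of_lt hω.2)).differentiableAt.differentiableWithinAt

lemma isRightSecondDeriv_groundAction (hγ : 0 < γ) (hlam : 0 < lam) (hμ : 0 < μ) :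
    IsRightSecondDeriv (groundAction γ lam μ) (freqBif γ μ) (curvatureFactor lam μ (freqBif γ μ) *
      curvature μ (bifParam μ) (-2 * ((2 * μ + 1) / (4 * μ + 5)))) := by
  have hlim := tendsto_deriv_deriv_groundAction hγ hlam hμ
    (nhdsWithin_mono (freqBif γ μ) fun _ hx => ne_of_gt hx) nhdsWithin_le_nhds
    (tendsto_mul_sqrt_right hγ hμ) (tendsto_jumpSqRate_right hμ)
  refine ⟨hlim, (hasDerivWithinAt_Ici_of_tendsto_deriv (s := Ioi (freqBif γ μ)) (fun ω hω => ?_)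
    (continuousAt_deriv_groundAction_freqBif hγ hlam hμ).continuousWithinAt self_mem_nhdsWithin
    hlim).mono Ioi_subset_Ici_self⟩
  exact (hasDerivAt_deriv_groundAction hγ hlam hμ ((freqLinear_lt_freqBif hγ hμ).trans hω)
    (ne_of_gt hω)).differentiableAt.differentiableWithinAt

lemma exists_one_sided_second_derivs (hγ : 0 < γ) (hlam : 0 < lam) (hμ : 0 < μ) :
    ∃ dLeft c : ℝ, 0 < dLeft ∧ 0 < c ∧ c * signFun μ < dLeft ∧
      IsLeftSecondDeriv (groundAction γ lam μ) (freqBif γ μ) dLeft ∧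
      IsRightSecondDeriv (groundAction γ lam μ) (freqBif γ μ) (c * signFun μ) := by
  have hfactor := curvatureFactor_pos hlam hμ (freqBif_pos hγ hμ)
  have hjump := jumpSq_div_pos hμ (two_lt_bifParam hμ)
  have hright := isRightSecondDeriv_groundAction hγ hlam hμ
  have hlt : curvature μ (bifParam μ) (-2 * ((2 * μ + 1) / (4 * μ + 5))) <
      curvature μ (bifParam μ) 2 := by
    have : 0 < (2 * μ + 1) / (4 * μ + 5) := by positivity
    exact add_lt_add_right (mul_lt_mul_of_pos_left (by linarith) hjump) _
  rw [curvature_bifParam_right hμ] at hlt hright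
  rw [← mul_assoc] at hright
  refine ⟨_, _, mul_pos hfactor (curvature_pos_of_le hμ (two_lt_bifParam hμ) le_rfl le_rfl),
    mul_pos hfactor hjump, ?_, isLeftSecondDeriv_groundAction hγ hlam hμ, hright⟩
  rw [mul_assoc]
  exact mul_lt_mul_of_pos_left hlt hfactor

lemma deriv_deriv_groundAction_pos_of_lt (hγ : 0 < γ) (hlam : 0 < lam) (hμ : 0 < μ)
    (hω : freqLinear γ < ω) (hlt : ω < freqBif γ μ) :
    0 < deriv (deriv (groundAction γ lam μ)) ω := by
  have hω0 := (freqLinear_pos hγ).trans hω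
  rw [deriv_deriv_groundAction hγ hlam hμ hω hlt.ne]
  exact mul_pos (curvatureFactor_pos hlam hμ hω0) (curvature_pos_of_lt hμ (two_lt_mul_sqrt hγ hω)
    (mul_sqrt_lt_bifParam hγ hω0.le hlt))

lemma deriv_deriv_groundAction_pos_of_gt (hγ : 0 < γ) (hlam : 0 < lam) (hμ : 0 < μ) (hμ2 : μ ≤ 2)
    (hgt : freqBif γ μ < ω) : 0 < deriv (deriv (groundAction γ lam μ)) ω := by
  rw [deriv_deriv_groundAction hγ hlam hμ ((freqLinear_lt_freqBif hγ hμ).trans hgt) hgt.ne']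
  exact mul_pos (curvatureFactor_pos hlam hμ ((freqBif_pos hγ hμ).trans hgt))
    (curvature_pos_of_gt hμ hμ2 (bifParam_lt_mul_sqrt hγ hμ hgt))

lemma deriv_deriv_groundAction_pos (hγ : 0 < γ) (hlam : 0 < lam) (hμ : 0 < μ) (hμ2 : μ ≤ 2)
    (hω : freqLinear γ < ω) (hne : ω ≠ freqBif γ μ) :
    0 < deriv (deriv (groundAction γ lam μ)) ω :=
  (lt_or_gt_of_ne hne).elim (deriv_deriv_groundAction_pos_of_lt hγ hlam hμ hω)
    (deriv_deriv_groundAction_pos_of_gt hγ hlam hμ hμ2)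

lemma exists_forall_deriv_deriv_groundAction_neg (hγ : 0 < γ) (hlam : 0 < lam) (hμ : 2 < μ) :
    ∃ ω₂, freqBif γ μ ≤ ω₂ ∧ ∀ ω, ω₂ < ω → deriv (deriv (groundAction γ lam μ)) ω < 0 := by
  have hμ0 : 0 < μ := by linarith
  obtain ⟨k₁, hneg⟩ := exists_forall_curvature_neg hμ
  refine ⟨max (freqBif γ μ) ((k₁ / γ) ^ 2), le_max_left _ _, fun ω hω => ?_⟩
  obtain ⟨hbif, hk⟩ := max_lt_iff.1 hω
  rw [deriv_deriv_groundAction hγ hlam hμ0 ((freqLinear_lt_freqBif hγ hμ0).trans hbif) hbif.ne']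
  exact mul_neg_of_pos_of_neg (curvatureFactor_pos hlam hμ0 ((freqBif_pos hγ hμ0).trans hbif))
    (hneg _ (lt_mul_sqrt hγ hk))

end GroundAction

lemma IsRightSecondDeriv.exists_forall_pos {f : ℝ → ℝ} {a L : ℝ} (h : IsRightSecondDeriv f a L)
    (hL : 0 < L) : ∃ b, a < b ∧ ∀ x ∈ Ioo a b, 0 < deriv (deriv f) x := by
  obtain ⟨b, hb, hsub⟩ := mem_nhdsGT_iff_exists_Ioo_subset.1 (h.1.eventually (lt_mem_nhds hL))
  exact ⟨b, hb, fun x hx => hsub hx⟩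

end DeltaPrimeNLS

open DeltaPrimeNLS

theorem proposition6p5 :
    ∃ μs ∈ Set.Ioo (2 : ℝ) (5 / 2), ∀ γ lam μ : ℝ, 0 < γ → 0 < lam → 0 < μ →
      (∀ ω, DeltaPrimeNLS.freqLinear γ < ω →
        DifferentiableAt ℝ (DeltaPrimeNLS.groundAction γ lam μ) ω) ∧
      (∀ ω, DeltaPrimeNLS.freqLinear γ < ω → ω ≠ DeltaPrimeNLS.freqBif γ μ →
        DifferentiableAt ℝ (deriv (DeltaPrimeNLS.groundAction γ lam μ)) ω) ∧
      ∃ dLeft dRight : ℝ,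
        DeltaPrimeNLS.IsLeftSecondDeriv (DeltaPrimeNLS.groundAction γ lam μ)
          (DeltaPrimeNLS.freqBif γ μ) dLeft ∧
        DeltaPrimeNLS.IsRightSecondDeriv (DeltaPrimeNLS.groundAction γ lam μ)
          (DeltaPrimeNLS.freqBif γ μ) dRight ∧
        (μ ≤ 2 →
          (∀ ω, DeltaPrimeNLS.freqLinear γ < ω → ω ≠ DeltaPrimeNLS.freqBif γ μ →
            0 < deriv (deriv (DeltaPrimeNLS.groundAction γ lam μ)) ω) ∧
          0 < dRight ∧ dRight < dLeft) ∧
        (2 < μ →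
          (∀ ω ∈ Set.Ioo (DeltaPrimeNLS.freqLinear γ) (DeltaPrimeNLS.freqBif γ μ),
            0 < deriv (deriv (DeltaPrimeNLS.groundAction γ lam μ)) ω) ∧
          0 < dLeft) ∧
        (μ < μs →
          0 < dRight ∧
          ∃ ω₁, DeltaPrimeNLS.freqBif γ μ < ω₁ ∧
            ∀ ω ∈ Set.Ioo (DeltaPrimeNLS.freqBif γ μ) ω₁,
              0 < deriv (deriv (DeltaPrimeNLS.groundAction γ lam μ)) ω) ∧
        (μ = μs → dRight = 0) ∧
        (μs < μ → dRight < 0) ∧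
        (2 < μ →
          ∃ ω₂, DeltaPrimeNLS.freqBif γ μ ≤ ω₂ ∧
            ∀ ω, ω₂ < ω →
              deriv (deriv (DeltaPrimeNLS.groundAction γ lam μ)) ω < 0) := by
  obtain ⟨μs, hμs, hsign⟩ := exists_threshold
  refine ⟨μs, hμs, fun γ lam μ hγ hlam hμ => ?_⟩
  obtain ⟨hpos, hzero, hneg⟩ := hsign μ hμ
  obtain ⟨dLeft, c, hdLeft, hc, hlt, hleft, hright⟩ := exists_one_sided_second_derivs hγ hlam hμ
  exact ⟨fun ω hω => (hasDerivAt_groundAction hγ hlam hμ hω).differentiableAt,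
    fun ω hω hne => (hasDerivAt_deriv_groundAction hγ hlam hμ hω hne).differentiableAt,
    dLeft, c * signFun μ, hleft, hright,
    fun hμ2 => ⟨fun ω hω hne => deriv_deriv_groundAction_pos hγ hlam hμ hμ2 hω hne,
      mul_pos hc (signFun_pos_of_le hμ hμ2), hlt⟩,
    fun _ => ⟨fun ω hω => deriv_deriv_groundAction_pos_of_lt hγ hlam hμ hω.1 hω.2, hdLeft⟩,
    fun h => ⟨mul_pos hc (hpos h), hright.exists_forall_pos (mul_pos hc (hpos h))⟩,
    fun h => by rw [hzero h, mul_zero],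
    fun h => mul_neg_of_pos_of_neg hc (hneg h),
    exists_forall_deriv_deriv_groundAction_neg hγ hlam⟩
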